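/- Let $(M,g)$ be an oriented smooth 4-dimensional spacetime of signature $(-+++)$, with Levi-Civita connection $\nabla$ and metric volume element $\eta$ ($\eta_{0123}=\sqrt{-\det g}$ in positively oriented coordinates). For 2-tensors put $(S\times T)_{\alpha\beta}=S_\alpha{}^{\mu}T_{\mu\beta}$, $T^2=T\times T$; for a 2-form $A$ put $(*A)_{\alpha\beta}=\frac12\eta_{\alpha\beta\mu\nu}A^{\mu\nu}$. A 2-form $A$ is regular if $A_{\alpha\beta}A^{\alpha\beta}$ and $A_{\alpha\beta}(*A)^{\alpha\beta}$ do not vanish simultaneously at any point. It is a conformal Killing-Yano (CKY) tensor if $$\nabla_{(\alpha}A_{\beta)\mu}=g_{\alpha\beta}a_\mu-a_{(\alpha}g_{\beta)\mu},\qquad 3a_\mu=\nabla^\alpha A_{\alpha\mu}.$$ Its traceless square is $A^2-\frac14(\mathrm{tr}A^2)\,g$. For a symmetric tensor $P$ with $\mathrm{tr}P^2\neq0$ everywhere, let $\Psi(P)$ be the 1-form $$\Psi(P)_\delta=\frac{1}{\mathrm{tr}P^2}\,\eta_{\alpha\beta\gamma\delta}\,(\nabla^\alpha P^{\beta\mu})\,P_\mu{}^{\gamma}.$$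 **Theorem.** Let $P$ be a smooth symmetric 2-tensor field on $M$. (i) $P$ is locally (in a neighbourhood of each point) the traceless square of a regular CKY tensor if and only if it satisfies the algebraic conditions $$\mathrm{tr}P=0,\qquad 4P^2=(\mathrm{tr}P^2)\,g,\qquad \mathrm{tr}P^2\neq0\ \text{ at every point},\qquad P(x,x)<0\ \text{ for every time-like vector } x,$$ and the differential conditions $$\mathcal S\{3\nabla P-g\otimes\nabla\cdot P\}=0,\qquad d\Psi(P)=0,$$ where $(\nabla\cdot P)_\beta=\nabla^\alpha P_{\alpha\beta}$ and $\mathcal S$ is total symmetrization. (ii) Suppose that $P$ satisfies these conditions. For a 2-form $X$ let $(P\wedge g)(X)$ be the 2-form $\frac12(P\wedge g)_{\alpha\beta\mu\nu}X^{\mu\nu}$, where $(P\wedge g)_{\alpha\beta\mu\nu}=P_{\alpha\mu}g_{\beta\nu}+P_{\beta\nu}g_{\alpha\mu}-P_{\alpha\nu}g_{\beta\mu}-P_{\beta\mu}g_{\alpha\nu}$, and put $$Q=-P\wedge g-\frac{1}{\sqrt{\mathrm{tr}P^2}}(P\wedge g)^2$$ (the square being that of an endomorphism of the space of 2-forms)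 and $Q(X,X)=\frac12Q(X)_{\alpha\beta}X^{\alpha\beta}$. Each point has an open neighbourhood $W$ on which there are a smooth function $\psi$ with $-2\,d\psi=\Psi(P)$ and a smooth 2-form $X$ with $Q(X,X)$ nowhere zero. For every open set $W$ and all such $\psi$ and $X$ on $W$, with $A^\circ=Q(X)/\sqrt{2\,Q(X,X)}$, the 2-form $$A=\cos\psi\,A^\circ+\sin\psi\,{*A^\circ}$$ is a regular CKY tensor on $W$ whose traceless square is $P$. -/

import Mathlib

open scoped Manifold ContDiff Matrix

noncomputable section

namespace CKY

/-- The model space `ℝ⁴`. -/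
abbrev E4 : Type := EuclideanSpace ℝ (Fin 4)

/-- Components of a covariant 2-tensor in a frame. -/
abbrev Mat4 : Type := Matrix (Fin 4) (Fin 4) ℝ

/-! ### Tensor algebra in components

`G` is the matrix of components `g_{ab}` of a Lorentzian metric in a positively oriented frame;
`G⁻¹` has the components `g^{ab}`. -/

/-- The trace `g^{ab} T_{ba}`. -/
def tr (G T : Mat4) : ℝ := (G⁻¹ * T).trace

/-- The product `(S × T)_{ab} = S_a{}^m T_{mb}`, contraction of adjacent indices. -/
def mul (G S T : Mat4) : Mat4 := S * G⁻¹ * T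

/-- Both indices raised: `T^{ab} = g^{am} g^{bn} T_{mn}`. -/
def raise (G T : Mat4) : Mat4 := G⁻¹ * T * (G⁻¹)ᵀ

/-- The Levi-Civita symbol, with `ε_{0123} = 1`. -/
def levi (a b c d : Fin 4) : ℝ := ((1 : Mat4).submatrix ![a, b, c, d] id).det

/-- The metric volume element `η_{abcd} = √(-det g) ε_{abcd}`. -/
def vol (G : Mat4) (a b c d : Fin 4) : ℝ := Real.sqrt (-G.det) * levi a b c d

/-- The Hodge dual of a 2-form: `(*A)_{ab} = ½ η_{abcd} A^{cd}`. -/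
def hodge (G A : Mat4) : Mat4 :=
  Matrix.of fun a b => (1 / 2) * ∑ c, ∑ d, vol G a b c d * raise G A c d

/-- The traceless part `A² - ¼ (tr A²) g` of the square `A² = A × A`. -/
def tracelessSquare (G A : Mat4) : Mat4 := mul G A A - ((1 / 4) * tr G (mul G A A)) • G

/-- The metric on 2-forms: `G(X, Y) = ½ X_{ab} Y^{ab}`. -/
def form2Inner (G X Y : Mat4) : ℝ := (1 / 2) * ∑ a, ∑ b, X a b * raise G Y a b

/-- The double 2-form
`(T ∧ g)_{abmn} = T_{am} g_{bn} + T_{bn} g_{am} - T_{an} g_{bm} - T_{bm} g_{an}`. -/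
def doubleWedge (G T : Mat4) (a b m n : Fin 4) : ℝ :=
  T a m * G b n + T b n * G a m - T a n * G b m - T b m * G a n

/-- `T ∧ g` as an endomorphism of the space of 2-forms: `X ↦ ½ (T ∧ g)_{abmn} X^{mn}`. -/
def doubleWedgeEnd (G T X : Mat4) : Mat4 :=
  Matrix.of fun a b => (1 / 2) * ∑ m, ∑ n, doubleWedge G T a b m n * raise G X m n

/-- `Q(X)`, where `Q = T ∧ g - (tr T²)^{-1/2} (T ∧ g)²`; the square is that of an endomorphism. -/
def Q (G T X : Mat4) : Mat4 :=
  doubleWedgeEnd G T X -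
    (1 / Real.sqrt (tr G (mul G T T))) • doubleWedgeEnd G T (doubleWedgeEnd G T X)

/-- `Q(X, X) = ¼ Q_{abmn} X^{ab} X^{mn}`. -/
def QQ (G T X : Mat4) : ℝ := form2Inner G (Q G T X) X

/-- The simple 2-form `F°[T] = Q(X) / √(2 Q(X, X))`. -/
def simpleForm (G T X : Mat4) : Mat4 := (1 / Real.sqrt (2 * QQ G T X)) • Q G T X

/-! ### Tensor calculus in a coordinate domain

`G` and `T` are now the component matrices of the metric and of a covariant 2-tensor field as
functions of the coordinates. -/

/-- The partial derivative `∂_c f`. -/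
def pd (c : Fin 4) (f : E4 → ℝ) (y : E4) : ℝ := fderiv ℝ f y (EuclideanSpace.single c 1)

/-- The Christoffel symbols `Γ^k_{ij}` of the Levi-Civita connection. -/
def christoffel (G : E4 → Mat4) (y : E4) (k i j : Fin 4) : ℝ :=
  (1 / 2) * ∑ l, (G y)⁻¹ k l *
    (pd i (fun z => G z j l) y + pd j (fun z => G z i l) y - pd l (fun z => G z i j) y)

/-- The covariant derivative `∇_c T_{ab}`. -/
def covD (G T : E4 → Mat4) (y : E4) (c a b : Fin 4) : ℝ :=
  pd c (fun z => T z a b) y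
    - ∑ d, christoffel G y d c a * T y d b - ∑ d, christoffel G y d c b * T y a d

/-- The divergence `(∇·T)_b = ∇^c T_{cb}`; for a 2-form it is minus the codifferential. -/
def divergence (G T : E4 → Mat4) (y : E4) (b : Fin 4) : ℝ :=
  ∑ c, ∑ d, (G y)⁻¹ c d * covD G T y c d b

/-- Total symmetrization of a covariant 3-tensor. -/
def symmetrize (t : Fin 4 → Fin 4 → Fin 4 → ℝ) (a b c : Fin 4) : ℝ :=
  (1 / 6) * (t a b c + t b c a + t c a b + t b a c + t a c b + t c b a)

/-- The conformal Killing equation `S{3 ∇P - g ⊗ ∇·P} = 0` at the point `y`. -/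
def CKEq (G P : E4 → Mat4) (y : E4) : Prop :=
  ∀ a b c, symmetrize
    (fun i j k => 3 * covD G P y i j k - G y i j * divergence G P y k) a b c = 0

/-- The conformal Killing-Yano equation
`∇_{(a} A_{b)m} = g_{ab} α_m - α_{(a} g_{b)m}` with `3 α = ∇·A`, that is `3 α = - δA`,
at the point `y`. -/
def CKYEq (G A : E4 → Mat4) (y : E4) : Prop :=
  ∀ a b m,
    (1 / 2) * (covD G A y a b m + covD G A y b a m) =
      G y a b * ((1 / 3) * divergence G A y m)
        - (1 / 2) * ((1 / 3) * divergence G A y a * G y b m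
          + (1 / 3) * divergence G A y b * G y a m)

/-- The Rainich 1-form `Ψ(P) = (tr P²)⁻¹ *(∇P × P)`, in components
`Ψ_d = (tr P²)⁻¹ η_{abcd} (∇^a P^{bm}) P_m{}^c`. Contraction with `η` only sees the totally
skew-symmetric part of `∇P × P`. -/
def rainich (G P : E4 → Mat4) (y : E4) (d : Fin 4) : ℝ :=
  (1 / tr (G y) (mul (G y) (P y) (P y))) *
    ∑ a, ∑ b, ∑ c, vol (G y) a b c d *
      ∑ a', ∑ b', ∑ c', (G y)⁻¹ a a' * (G y)⁻¹ b b' * (G y)⁻¹ c c' *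
        ∑ m, ∑ n, covD G P y a' b' m * (G y)⁻¹ m n * P y n c'

/-! ### Fields on a 4-manifold -/

section Manifold

variable {M : Type*} [TopologicalSpace M] [ChartedSpace E4 M]

/-- The atlas of `M` is oriented: all changes of coordinates have positive Jacobian. -/
def IsOrientedAtlas (M : Type*) [TopologicalSpace M] [ChartedSpace E4 M] : Prop :=
  ∀ e ∈ atlas E4 M, ∀ e' ∈ atlas E4 M, ∀ y ∈ e.target, e.symm y ∈ e'.source →
    0 < (fderiv ℝ (fun z => e' (e.symm z)) y).det

/-- Covariant 2-tensor fields, without any regularity. -/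
abbrev Tensor2 (M : Type*) [TopologicalSpace M] [ChartedSpace E4 M] : Type _ :=
  (x : M) → LinearMap.BilinForm ℝ (TangentSpace (𝓡 4) x)

/-- The coordinate vector field `∂_i` of the chart `e` at the point with coordinates `y`. -/
def coordVec (e : OpenPartialHomeomorph M E4) (y : E4) (i : Fin 4) :
    TangentSpace (𝓡 4) (e.symm y) :=
  mfderiv (𝓡 4) (𝓡 4) e.symm y (EuclideanSpace.single i (1 : ℝ) : E4)

/-- The components of `T` in the chart `e`, as functions of the coordinates. -/
def comp (e : OpenPartialHomeomorph M E4) (T : Tensor2 M) (y : E4) : Mat4 :=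
  Matrix.of fun i j => T (e.symm y) (coordVec e y i) (coordVec e y j)

/-- In Mathlib the tangent space at `x` is the model space, the identification being the one given
by the preferred chart `chartAt E4 x`, which belongs to the atlas. The standard basis is thus the
coordinate basis of that chart. -/
def stdBasis (x : M) : Module.Basis (Fin 4) ℝ (TangentSpace (𝓡 4) x) :=
  (EuclideanSpace.basisFun (Fin 4) ℝ).toBasis

/-- The components of `T` at `x` in the coordinate basis of the preferred chart at `x`. -/
def compAt (T : Tensor2 M) (x : M) : Mat4 :=
  Matrix.of fun i j => T x (stdBasis x i) (stdBasis x j)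

/-- `T` is smooth on `W`: its components in every chart are. -/
def SmoothOn (T : Tensor2 M) (W : Set M) : Prop :=
  ∀ e ∈ atlas E4 M, ∀ i j,
    ContDiffOn ℝ ∞ (fun y => comp e T y i j) (e.target ∩ e.symm ⁻¹' W)

/-- A smooth Lorentzian metric, of signature `(-+++)`. -/
structure IsLorentzMetric (g : Tensor2 M) : Prop where
  smooth : SmoothOn g Set.univ
  signature : ∀ x, ∃ b : Module.Basis (Fin 4) ℝ (TangentSpace (𝓡 4) x),
    ∀ i j, g x (b i) (b j) = if i = j then (if i = 0 then -1 else 1) else 0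

/-- A smooth symmetric 2-tensor field on `M`. -/
structure IsSymmTensor (P : Tensor2 M) : Prop where
  smooth : SmoothOn P Set.univ
  symm : ∀ x u v, P x u v = P x v u

/-- `A` is a smooth 2-form on `W`. -/
structure IsTwoFormOn (W : Set M) (A : Tensor2 M) : Prop where
  smooth : SmoothOn A W
  skew : ∀ x ∈ W, ∀ u v, A x u v = - A x v u

/-- `A` is a conformal Killing-Yano tensor on `W`. -/
structure IsCKYOn (g : Tensor2 M) (W : Set M) (A : Tensor2 M) : Prop extends IsTwoFormOn W A where
  cky : ∀ e ∈ atlas E4 M, ∀ y ∈ e.target, e.symm y ∈ W → CKYEq (comp e g) (comp e A) y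

/-- The 2-form `A` is regular (non-null) on `W`: its two scalar invariants, which are multiples of
`A_{ab} A^{ab}` and `A_{ab} (*A)^{ab}`, nowhere vanish simultaneously. -/
def IsRegularOn (g : Tensor2 M) (W : Set M) (A : Tensor2 M) : Prop :=
  ∀ x ∈ W, ¬ (form2Inner (compAt g x) (compAt A x) (compAt A x) = 0 ∧
    form2Inner (compAt g x) (compAt A x) (hodge (compAt g x) (compAt A x)) = 0)

/-- `P = A² - ¼ (tr A²) g` on `W`. -/
def IsTracelessSquareOn (g : Tensor2 M) (W : Set M) (P A : Tensor2 M) : Prop :=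
  ∀ x ∈ W, compAt P x = tracelessSquare (compAt g x) (compAt A x)

/-- `P` is, in a neighbourhood of each point, the traceless square of a regular conformal
Killing-Yano tensor. -/
def IsLocallyTracelessSquareOfCKY (g P : Tensor2 M) : Prop :=
  ∀ x : M, ∃ W : Set M, IsOpen W ∧ x ∈ W ∧
    ∃ A : Tensor2 M, IsCKYOn g W A ∧ IsRegularOn g W A ∧ IsTracelessSquareOn g W P A

/-- The algebraic conditions `tr P = 0`, `4 P² = (tr P²) g ≠ 0`, and `P(v, v) < 0` for all
time-like `v`. -/
structure AlgebraicConditions (g P : Tensor2 M) : Prop where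
  trace : ∀ x, tr (compAt g x) (compAt P x) = 0
  square : ∀ x, (4 : ℝ) • mul (compAt g x) (compAt P x) (compAt P x) =
    tr (compAt g x) (mul (compAt g x) (compAt P x) (compAt P x)) • compAt g x
  square_ne : ∀ x, tr (compAt g x) (mul (compAt g x) (compAt P x) (compAt P x)) ≠ 0
  timelike : ∀ x v, g x v v < 0 → P x v v < 0

/-- The differential conditions `S{3 ∇P - g ⊗ ∇·P} = 0` and `dΨ(P) = 0`. -/
structure DifferentialConditions (g P : Tensor2 M) : Prop where
  ck : ∀ e ∈ atlas E4 M, ∀ y ∈ e.target, CKEq (comp e g) (comp e P) y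
  closed : ∀ e ∈ atlas E4 M, ∀ y ∈ e.target, ∀ a b,
    pd a (fun z => rainich (comp e g) (comp e P) z b) y =
      pd b (fun z => rainich (comp e g) (comp e P) z a) y

/-- `ψ` is a smooth function on `W` with `-2 dψ = Ψ(P)`. -/
structure IsRainichIndexOn (g P : Tensor2 M) (W : Set M) (ψ : M → ℝ) : Prop where
  smooth : ContMDiffOn (𝓡 4) 𝓘(ℝ, ℝ) ∞ ψ W
  deriv_eq : ∀ e ∈ atlas E4 M, ∀ y ∈ e.target, e.symm y ∈ W → ∀ a,
    -2 * pd a (fun z => ψ (e.symm z)) y = rainich (comp e g) (comp e P) y a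

/-- `X` is a smooth 2-form on `W` admissible in the formula for `F°[T]` with `T = -P`:
`Q(X, X)` has no zero on `W`. -/
structure IsAdmissibleOn (g P : Tensor2 M) (W : Set M) (X : Tensor2 M) : Prop
    extends IsTwoFormOn W X where
  ne_zero : ∀ x ∈ W, QQ (compAt g x) (-compAt P x) (compAt X x) ≠ 0

/-- The 2-form `A = cos ψ A° + sin ψ *A°`, where `A° = F°[-P] = Q(X) / √(2 Q(X, X))`. -/
def rotatedForm (g P X : Tensor2 M) (ψ : M → ℝ) : Tensor2 M := fun x =>
  Matrix.toBilin (stdBasis x)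
    (Real.cos (ψ x) • simpleForm (compAt g x) (-compAt P x) (compAt X x)
      + Real.sin (ψ x) • hodge (compAt g x) (simpleForm (compAt g x) (-compAt P x) (compAt X x)))

end Manifold

end CKY

end

noncomputable section

namespace CKY

/-! ### The Levi-Civita symbol -/

/-! At a point, a regular 2-form takes the form A = α e⁰∧e¹ + β e²∧e³ in a suitable positively
oriented orthonormal frame (`exists_form_frame`). Its traceless square is then s·diag(-1, 1, -1, -1)
with s = (α² + β²)/2. So P retains everything about A except a duality rotation, whose angle is
recorded by the invariants u = (A, A) and v = (A, *A).

The CKY equation is a system of sixteen linear equations on the twenty-four components of ∇A.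
Passing from ∇A to ∇P loses only the component along *A, one number for each direction of
differentiation. The key fact (`core_eta`) is that the CKY equation for A is equivalent to the
conformal Killing equation for P together with the four equations Ψ(P) = (u dv - v du)/(u² + v²).
All objects involved are equivariant under changes of frame, so this holds in any frame
(`ckyTensor_eq_zero_iff`). The Leibniz rule for ∇ turns it into a statement about fields
(`FormAt.ckyEq_iff`).

Necessity: the algebraic conditions are read off from the normal form, and dΨ(P) = 0 because (u dv -
v du)/(u² + v²) is locally the differential of the argument of u + iv (`pd_angle_comm`).

Sufficiency: the algebraic conditions give a frame in which P = s·diag(-1, 1, -1, -1) with s > 0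
(`AlgebraicAt.exists_frame`). There Q is -4s times the projection onto e⁰∧e¹ (`Q_eta`), so A° is a
multiple of e⁰∧e¹ normalised to have traceless square P. Rotation by ψ does not change the traceless
square and gives u = -r cos 2ψ, v = r sin 2ψ with r = √(tr P²), so that the argument of u + iv has
differential -2 dψ. This equals Ψ(P) by the choice of ψ, and the equivalence yields the CKY
equation. A local ψ exists by the Poincaré lemma (`exists_potential`). -/

theorem levi_eq_intCast (a b c d : Fin 4) :
    levi a b c d = (((1 : Matrix (Fin 4) (Fin 4) ℤ).submatrix ![a, b, c, d] id).det : ℤ) := by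
  rw [levi, ← eq_intCast (Int.castRingHom ℝ), RingHom.map_det]
  congr 1
  ext i j
  simp only [Matrix.submatrix_apply, Matrix.one_apply, RingHom.mapMatrix_apply, Matrix.map_apply]
  split_ifs <;> simp

/-- The right side is the Vandermonde product of the indices, which has the same antisymmetry; its
value at (0, 1, 2, 3) is 1·2·3·1·2·1 = 12. Working over ℤ lets the 256 cases be decided by
evaluation. -/
theorem levi_int : ∀ a b c d : Fin 4,
    ((1 : Matrix (Fin 4) (Fin 4) ℤ).submatrix ![a, b, c, d] id).det * 12 =
      ((b : ℤ) - a) * (c - a) * (d - a) * (c - b) * (d - b) * (d - c) := by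
  decide +kernel

theorem levi_eq (a b c d : Fin 4) : levi a b c d =
    (((b : ℕ) : ℝ) - (a : ℕ)) * ((c : ℕ) - (a : ℕ)) * ((d : ℕ) - (a : ℕ)) *
      ((c : ℕ) - (b : ℕ)) * ((d : ℕ) - (b : ℕ)) * ((d : ℕ) - (c : ℕ)) / 12 := by
  rw [levi_eq_intCast, eq_div_iff (by norm_num)]
  exact_mod_cast levi_int a b c d

theorem sum_levi (f : Fin 4 → Fin 4 → Fin 4 → Fin 4 → ℝ) :
    ∑ a, ∑ b, ∑ c, ∑ d, levi a b c d * f a b c d =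
      f 0 1 2 3 - f 0 1 3 2 - f 0 2 1 3 + f 0 2 3 1 + f 0 3 1 2 - f 0 3 2 1
      - f 1 0 2 3 + f 1 0 3 2 + f 1 2 0 3 - f 1 2 3 0 - f 1 3 0 2 + f 1 3 2 0
      + f 2 0 1 3 - f 2 0 3 1 - f 2 1 0 3 + f 2 1 3 0 + f 2 3 0 1 - f 2 3 1 0
      - f 3 0 1 2 + f 3 0 2 1 + f 3 1 0 2 - f 3 1 2 0 - f 3 2 0 1 + f 3 2 1 0 := by
  simp only [Fin.sum_univ_four, levi_eq, Fin.coe_ofNat_eq_mod]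
  norm_num
  ring

theorem det_four (M : Mat4) : M.det =
    M 0 0 * M 1 1 * M 2 2 * M 3 3 - M 0 0 * M 1 1 * M 2 3 * M 3 2
    - M 0 0 * M 1 2 * M 2 1 * M 3 3 + M 0 0 * M 1 2 * M 2 3 * M 3 1
    + M 0 0 * M 1 3 * M 2 1 * M 3 2 - M 0 0 * M 1 3 * M 2 2 * M 3 1
    - M 0 1 * M 1 0 * M 2 2 * M 3 3 + M 0 1 * M 1 0 * M 2 3 * M 3 2
    + M 0 1 * M 1 2 * M 2 0 * M 3 3 - M 0 1 * M 1 2 * M 2 3 * M 3 0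
    - M 0 1 * M 1 3 * M 2 0 * M 3 2 + M 0 1 * M 1 3 * M 2 2 * M 3 0
    + M 0 2 * M 1 0 * M 2 1 * M 3 3 - M 0 2 * M 1 0 * M 2 3 * M 3 1
    - M 0 2 * M 1 1 * M 2 0 * M 3 3 + M 0 2 * M 1 1 * M 2 3 * M 3 0
    + M 0 2 * M 1 3 * M 2 0 * M 3 1 - M 0 2 * M 1 3 * M 2 1 * M 3 0
    - M 0 3 * M 1 0 * M 2 1 * M 3 2 + M 0 3 * M 1 0 * M 2 2 * M 3 1
    + M 0 3 * M 1 1 * M 2 0 * M 3 2 - M 0 3 * M 1 1 * M 2 2 * M 3 0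
    - M 0 3 * M 1 2 * M 2 0 * M 3 1 + M 0 3 * M 1 2 * M 2 1 * M 3 0 := by
  simp [Matrix.det_succ_row_zero, Fin.sum_univ_succ, Fin.succAbove]
  ring

/-- Multiplicativity of the determinant, applied to Jᵀ with its rows selected by (a, b, c, d): the
Levi-Civita symbol is a tensor density. -/
theorem sum_levi_mul (J : Mat4) (a b c d : Fin 4) :
    ∑ i, ∑ j, ∑ k, ∑ l, levi i j k l * (J i a * J j b * J k c * J l d) =
      J.det * levi a b c d := by
  have : (1 : Mat4).submatrix ![a, b, c, d] id * Jᵀ = Jᵀ.submatrix ![a, b, c, d] id := by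
    ext i j
    simp only [Matrix.mul_apply, Matrix.submatrix_apply, id, Matrix.one_apply, ite_mul, one_mul,
      zero_mul, Finset.sum_ite_eq, Finset.mem_univ, if_true]
  rw [sum_levi, mul_comm J.det, levi, ← Matrix.det_transpose J, ← Matrix.det_mul, this, det_four]
  simp only [Matrix.submatrix_apply, Matrix.transpose_apply, id, Matrix.cons_val]

/-! ### Congruence -/

/-- The components `Jᵀ T J` of `T` in the frame with matrix `J`. -/
def cong (J T : Mat4) : Mat4 := Jᵀ * T * J

theorem cong_apply (J T : Mat4) (a b : Fin 4) :
    cong J T a b = ∑ i, ∑ j, J i a * J j b * T i j := by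
  simp only [cong, Matrix.mul_apply, Matrix.transpose_apply, Finset.sum_mul]
  rw [Finset.sum_comm]
  refine Finset.sum_congr rfl fun i _ => Finset.sum_congr rfl fun j _ => by ring

theorem cong_add (J S T : Mat4) : cong J (S + T) = cong J S + cong J T := by
  simp [cong, mul_add, add_mul]

theorem cong_sub (J S T : Mat4) : cong J (S - T) = cong J S - cong J T := by
  simp [cong, mul_sub, sub_mul]

theorem cong_neg (J T : Mat4) : cong J (-T) = -cong J T := by
  simp [cong]

theorem cong_smul (J : Mat4) (r : ℝ) (T : Mat4) : cong J (r • T) = r • cong J T := by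
  simp [cong]

theorem cong_sum {ι : Type*} (s : Finset ι) (J : Mat4) (T : ι → Mat4) :
    cong J (∑ i ∈ s, T i) = ∑ i ∈ s, cong J (T i) := by
  simp [cong, Finset.mul_sum, Finset.sum_mul]

theorem cong_cong (J L T : Mat4) : cong J (cong L T) = cong (L * J) T := by
  simp [cong, Matrix.mul_assoc]

theorem cong_one (T : Mat4) : cong 1 T = T := by
  simp [cong]

theorem cong_transpose (J T : Mat4) : (cong J T)ᵀ = cong J Tᵀ := by
  simp [cong, Matrix.mul_assoc]

theorem cong_injective {J : Mat4} (hJ : IsUnit J.det) {S T : Mat4} (h : cong J S = cong J T) :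
    S = T := by
  have := congrArg (cong J⁻¹) h
  rwa [cong_cong, cong_cong, Matrix.mul_nonsing_inv _ hJ, cong_one, cong_one] at this

theorem det_cong (J G : Mat4) : (cong J G).det = J.det ^ 2 * G.det := by
  simp [cong]; ring

theorem inv_cong (J G : Mat4) : (cong J G)⁻¹ = J⁻¹ * G⁻¹ * (J⁻¹)ᵀ := by
  rw [cong, Matrix.mul_inv_rev, Matrix.mul_inv_rev, Matrix.transpose_nonsing_inv, Matrix.mul_assoc]

/-- Solved for the old inverse metric, so that substituting it into a contraction produces exactly
the factors J and Jᵀ needed next to the covariant slots, with no J⁻¹ left over. -/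
theorem mul_inv_cong {J : Mat4} (hJ : IsUnit J.det) (G : Mat4) :
    J * (cong J G)⁻¹ * Jᵀ = G⁻¹ := by
  rw [inv_cong]
  have h1 : J * J⁻¹ = 1 := Matrix.mul_nonsing_inv _ hJ
  have h2 : (J⁻¹)ᵀ * Jᵀ = 1 := by rw [← Matrix.transpose_mul, h1, Matrix.transpose_one]
  calc _ = (J * J⁻¹) * G⁻¹ * ((J⁻¹)ᵀ * Jᵀ) := by simp only [Matrix.mul_assoc]
    _ = _ := by rw [h1, h2, one_mul, mul_one]

theorem mul_cong {J : Mat4} (hJ : IsUnit J.det) (G S T : Mat4) :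
    mul (cong J G) (cong J S) (cong J T) = cong J (mul G S T) := by
  rw [mul, mul, ← mul_inv_cong hJ G]
  simp only [cong, Matrix.mul_assoc]

theorem tr_cong {J : Mat4} (hJ : IsUnit J.det) (G T : Mat4) :
    tr (cong J G) (cong J T) = tr G T := by
  rw [tr, tr, ← mul_inv_cong hJ G, Matrix.mul_assoc, Matrix.mul_assoc J, Matrix.trace_mul_comm J]
  simp only [cong, Matrix.mul_assoc]

theorem raise_cong {J : Mat4} (hJ : IsUnit J.det) (G T : Mat4) :
    J * raise (cong J G) (cong J T) * Jᵀ = raise G T := by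
  rw [raise, raise, ← mul_inv_cong hJ G]
  simp only [cong, Matrix.mul_assoc, Matrix.transpose_mul, Matrix.transpose_transpose]

theorem form2Inner_eq_trace (G X Y : Mat4) :
    form2Inner G X Y = (1 / 2) * (X * (raise G Y)ᵀ).trace := by
  simp only [form2Inner, Matrix.trace, Matrix.diag, Matrix.mul_apply, Matrix.transpose_apply]

theorem form2Inner_cong {J : Mat4} (hJ : IsUnit J.det) (G X Y : Mat4) :
    form2Inner (cong J G) (cong J X) (cong J Y) = form2Inner G X Y := by
  rw [form2Inner_eq_trace, form2Inner_eq_trace, ← raise_cong hJ G Y]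
  simp only [cong, Matrix.mul_assoc, Matrix.transpose_mul, Matrix.transpose_transpose]
  rw [Matrix.trace_mul_comm]
  simp only [Matrix.mul_assoc]

theorem sum_rot (f : Fin 4 → Fin 4 → Fin 4 → ℝ) :
    ∑ x, ∑ k, ∑ l, f x k l = ∑ k, ∑ l, ∑ x, f x k l := by
  rw [Finset.sum_comm]
  exact Finset.sum_congr rfl fun _ _ => Finset.sum_comm

theorem sum_comm_three {κ : Type*} [Fintype κ] (f : κ → Fin 4 → Fin 4 → Fin 4 → ℝ) :
    ∑ x, ∑ i, ∑ j, ∑ k, f x i j k = ∑ i, ∑ j, ∑ k, ∑ x, f x i j k := by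
  rw [Finset.sum_comm]
  refine Finset.sum_congr rfl fun _ _ => ?_
  rw [Finset.sum_comm]
  exact Finset.sum_congr rfl fun _ _ => Finset.sum_comm

theorem sum_comm_four {κ : Type*} [Fintype κ] (f : κ → Fin 4 → Fin 4 → Fin 4 → Fin 4 → ℝ) :
    ∑ x, ∑ i, ∑ j, ∑ k, ∑ l, f x i j k l = ∑ i, ∑ j, ∑ k, ∑ l, ∑ x, f x i j k l := by
  rw [Finset.sum_comm]
  exact Finset.sum_congr rfl fun _ _ => sum_comm_three _

theorem sum_comm_three_two (f : Fin 4 → Fin 4 → Fin 4 → Fin 4 → Fin 4 → ℝ) :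
    ∑ x, ∑ y, ∑ i, ∑ j, ∑ k, f x y i j k = ∑ i, ∑ j, ∑ k, ∑ x, ∑ y, f x y i j k :=
  (Finset.sum_congr rfl fun _ _ => sum_comm_three _).trans (sum_comm_three _)

theorem sum_comm_four_two (f : Fin 4 → Fin 4 → Fin 4 → Fin 4 → Fin 4 → Fin 4 → ℝ) :
    ∑ x, ∑ y, ∑ i, ∑ j, ∑ k, ∑ l, f x y i j k l = ∑ i, ∑ j, ∑ k, ∑ l, ∑ x, ∑ y, f x y i j k l :=
  (Finset.sum_congr rfl fun _ _ => sum_comm_four _).trans (sum_comm_four _)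

theorem sum_comm_four_three
    (f : Fin 4 → Fin 4 → Fin 4 → Fin 4 → Fin 4 → Fin 4 → Fin 4 → ℝ) :
    ∑ x, ∑ y, ∑ z, ∑ i, ∑ j, ∑ k, ∑ l, f x y z i j k l =
      ∑ i, ∑ j, ∑ k, ∑ l, ∑ x, ∑ y, ∑ z, f x y z i j k l :=
  (Finset.sum_congr rfl fun _ _ => sum_comm_four_two _).trans (sum_comm_four _)

/-- Orientation enters here: without the sign of det J the factor would be |det J|, and the volume
element would be a tensor only up to sign. -/
theorem sqrt_det_cong {J : Mat4} (hJ : 0 < J.det) (G : Mat4) :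
    Real.sqrt (-(cong J G).det) = J.det * Real.sqrt (-G.det) := by
  rw [det_cong, ← mul_neg, Real.sqrt_mul (sq_nonneg _), Real.sqrt_sq hJ.le]

theorem hodge_cong {J : Mat4} (hJ : 0 < J.det) (G A : Mat4) :
    hodge (cong J G) (cong J A) = cong J (hodge G A) := by
  have hJ' : IsUnit J.det := hJ.ne'.isUnit
  ext a b
  rw [cong_apply]
  simp only [hodge, Matrix.of_apply, vol, sqrt_det_cong hJ]
  set R := raise (cong J G) (cong J A) with hR
  have hr : ∀ c d, raise G A c d = ∑ k, ∑ l, J c k * J d l * R k l := by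
    intro c d
    rw [← raise_cong hJ' G A, ← hR]
    simpa [cong] using cong_apply Jᵀ R c d
  -- The factor det J released by the square root is absorbed into the Levi-Civita symbol, at the
  -- cost of one J for each index.
  have h1 : ∀ k l, J.det * Real.sqrt (-G.det) * levi a b k l * R k l =
      ∑ i, ∑ j, ∑ c, ∑ d, J i a * J j b * (Real.sqrt (-G.det) * levi i j c d *
        (J c k * J d l * R k l)) := by
    intro k l
    rw [mul_right_comm J.det, ← sum_levi_mul]
    simp only [Finset.sum_mul]
    refine Finset.sum_congr rfl fun _ _ => Finset.sum_congr rfl fun _ _ =>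
      Finset.sum_congr rfl fun _ _ => Finset.sum_congr rfl fun _ _ => by ring
  simp only [h1, hr, Finset.mul_sum]
  rw [sum_comm_four_two]
  refine Finset.sum_congr rfl fun _ _ => Finset.sum_congr rfl fun _ _ =>
    Finset.sum_congr rfl fun _ _ => Finset.sum_congr rfl fun _ _ =>
      Finset.sum_congr rfl fun _ _ => Finset.sum_congr rfl fun _ _ => by ring

/-- In matrix form, equivariance under a change of frame reduces to that of the raised form. -/
theorem doubleWedgeEnd_eq (G T X : Mat4) : doubleWedgeEnd G T X =
    (1 / 2 : ℝ) • (T * raise G X * Gᵀ + G * raise G X * Tᵀ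
      - T * (raise G X)ᵀ * Gᵀ - G * (raise G X)ᵀ * Tᵀ) := by
  ext a b
  simp only [doubleWedgeEnd, doubleWedge, Matrix.of_apply, Matrix.smul_apply, Matrix.sub_apply,
    Matrix.add_apply, Matrix.mul_apply, Matrix.transpose_apply, smul_eq_mul, Fin.sum_univ_four]
  ring

theorem doubleWedgeEnd_cong {J : Mat4} (hJ : IsUnit J.det) (G T X : Mat4) :
    doubleWedgeEnd (cong J G) (cong J T) (cong J X) = cong J (doubleWedgeEnd G T X) := by
  rw [doubleWedgeEnd_eq, doubleWedgeEnd_eq, ← raise_cong hJ G X]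
  simp only [cong_smul, cong_sub, cong_add]
  simp only [cong, Matrix.mul_assoc, Matrix.transpose_mul, Matrix.transpose_transpose]

theorem Q_cong {J : Mat4} (hJ : IsUnit J.det) (G T X : Mat4) :
    Q (cong J G) (cong J T) (cong J X) = cong J (Q G T X) := by
  simp only [Q, doubleWedgeEnd_cong hJ, mul_cong hJ, tr_cong hJ, cong_sub, cong_smul]

theorem QQ_cong {J : Mat4} (hJ : IsUnit J.det) (G T X : Mat4) :
    QQ (cong J G) (cong J T) (cong J X) = QQ G T X := by
  simp only [QQ, Q_cong hJ, form2Inner_cong hJ]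

theorem simpleForm_cong {J : Mat4} (hJ : IsUnit J.det) (G T X : Mat4) :
    simpleForm (cong J G) (cong J T) (cong J X) = cong J (simpleForm G T X) := by
  simp only [simpleForm, QQ_cong hJ, Q_cong hJ, cong_smul]

theorem tracelessSquare_cong {J : Mat4} (hJ : IsUnit J.det) (G A : Mat4) :
    tracelessSquare (cong J G) (cong J A) = cong J (tracelessSquare G A) := by
  simp only [tracelessSquare, mul_cong hJ, tr_cong hJ, cong_smul, cong_sub]

/-- The form `cos ψ A° + sin ψ *A°`, where `A° = F°[T]`. -/
def rotated (G T X : Mat4) (ψ : ℝ) : Mat4 :=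
  Real.cos ψ • simpleForm G T X + Real.sin ψ • hodge G (simpleForm G T X)

theorem rotated_cong {J : Mat4} (hJ : 0 < J.det) (G T X : Mat4) (ψ : ℝ) :
    rotated (cong J G) (cong J T) (cong J X) ψ = cong J (rotated G T X ψ) := by
  simp only [rotated, simpleForm_cong hJ.ne'.isUnit, hodge_cong hJ, cong_add, cong_smul]

/-! ### Covariant 3-tensors -/

/-- The components of a covariant 3-tensor in the frame with matrix `J`. -/
def pull (J : Mat4) (D : Fin 4 → Mat4) (c : Fin 4) : Mat4 := ∑ i, J i c • cong J (D i)

theorem pull_apply (J : Mat4) (D : Fin 4 → Mat4) (a b c : Fin 4) :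
    pull J D a b c = ∑ i, ∑ j, ∑ k, J i a * J j b * J k c * D i j k := by
  simp only [pull, Matrix.sum_apply, Matrix.smul_apply, cong_apply, smul_eq_mul, Finset.mul_sum]
  refine Finset.sum_congr rfl fun _ _ => Finset.sum_congr rfl fun _ _ =>
      Finset.sum_congr rfl fun _ _ => by ring

theorem pull_pull (J L : Mat4) (D : Fin 4 → Mat4) : pull J (pull L D) = pull (L * J) D := by
  funext c
  simp only [pull, cong_sum, cong_smul, cong_cong, Finset.smul_sum, smul_smul, Matrix.mul_apply,
    Finset.sum_smul]
  rw [Finset.sum_comm]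
  simp only [mul_comm]

theorem pull_one (D : Fin 4 → Mat4) : pull 1 D = D := by
  funext c
  simp [pull, cong_one, Matrix.one_apply]

/-- Permits a tensor equation of rank three to be checked in one convenient frame. -/
theorem pull_eq_zero {J : Mat4} (hJ : IsUnit J.det) {D : Fin 4 → Mat4} :
    pull J D = 0 ↔ D = 0 := by
  constructor
  · intro h
    have := congrArg (pull J⁻¹) h
    rw [pull_pull, Matrix.mul_nonsing_inv _ hJ, pull_one] at this
    rw [this]; funext c; simp [pull, cong]
  · rintro rfl; funext c; simp [pull, cong]

/-- The contraction `G^{cd} D_{cdb}`. -/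
def contract (G : Mat4) (D : Fin 4 → Mat4) (b : Fin 4) : ℝ :=
  ∑ c, ∑ d, G⁻¹ c d * D c d b

theorem contract_pull {J : Mat4} (hJ : IsUnit J.det) (G : Mat4) (D : Fin 4 → Mat4) (b : Fin 4) :
    contract (cong J G) (pull J D) b = ∑ k, J k b * contract G D k := by
  simp only [contract, pull_apply]
  set K := (cong J G)⁻¹ with hK
  have hr : ∀ i j, G⁻¹ i j = ∑ c, ∑ d, J i c * J j d * K c d := by
    intro i j
    rw [← mul_inv_cong hJ G, ← hK]
    simpa [cong] using cong_apply Jᵀ K i j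
  simp only [hr, Finset.mul_sum, Finset.sum_mul]
  rw [sum_comm_three_two]
  refine Eq.trans ?_ (sum_rot _).symm
  refine Finset.sum_congr rfl fun _ _ => Finset.sum_congr rfl fun _ _ =>
    Finset.sum_congr rfl fun _ _ => Finset.sum_congr rfl fun _ _ =>
      Finset.sum_congr rfl fun _ _ => by ring

/-- A transposition and a 3-cycle generate all permutations of three slots; together with `pull_rot`
this moves any permutation of the arguments inside `pull`. -/
theorem pull_swap (J : Mat4) (D : Fin 4 → Mat4) (a b c : Fin 4) :
    pull J D b a c = pull J (fun i => Matrix.of fun j k => D j i k) a b c := by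
  rw [pull_apply, pull_apply, Finset.sum_comm]
  refine Finset.sum_congr rfl fun _ _ => Finset.sum_congr rfl fun _ _ =>
    Finset.sum_congr rfl fun _ _ => by rw [Matrix.of_apply]; ring

theorem pull_rot (J : Mat4) (D : Fin 4 → Mat4) (a b c : Fin 4) :
    pull J D b c a = pull J (fun i => Matrix.of fun j k => D j k i) a b c := by
  rw [pull_apply, pull_apply]
  refine (sum_rot (fun k i j => J i b * J j c * J k a * D i j k)).symm.trans ?_
  refine Finset.sum_congr rfl fun _ _ => Finset.sum_congr rfl fun _ _ =>
    Finset.sum_congr rfl fun _ _ => by rw [Matrix.of_apply]; ring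

theorem pull_outer (J G : Mat4) (δ : Fin 4 → ℝ) (a b c : Fin 4) :
    cong J G a b * ∑ k, J k c * δ k =
      pull J (fun i => Matrix.of fun j k => G i j * δ k) a b c := by
  simp only [pull_apply, cong_apply, Matrix.of_apply, Finset.sum_mul]
  simp only [Finset.mul_sum]
  refine Finset.sum_congr rfl fun _ _ => Finset.sum_congr rfl fun _ _ =>
    Finset.sum_congr rfl fun _ _ => by ring

/-- The tensor whose vanishing is the conformal Killing equation, as a function of the components
`D` of the covariant derivative. -/
def ckTensor (G : Mat4) (D : Fin 4 → Mat4) (a : Fin 4) : Mat4 := Matrix.of fun b c =>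
  symmetrize (fun i j k => 3 * D i j k - G i j * contract G D k) a b c

/-- The tensor whose vanishing is the conformal Killing-Yano equation, as a function of the
components `D` of the covariant derivative. -/
def ckyTensor (G : Mat4) (D : Fin 4 → Mat4) (a : Fin 4) : Mat4 := Matrix.of fun b m =>
  (1 / 2) * (D a b m + D b a m) - (G a b * ((1 / 3) * contract G D m)
        - (1 / 2) * ((1 / 3) * contract G D a * G b m + (1 / 3) * contract G D b * G a m))

theorem symmetrize_pull (J : Mat4) (T : Fin 4 → Mat4) (a b c : Fin 4) :
    symmetrize (fun i j k => pull J T i j k) a b c =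
      pull J (fun i => Matrix.of fun j k => symmetrize (fun i j k => T i j k) i j k) a b c := by
  simp only [symmetrize]
  rw [pull_rot J T a b c, pull_rot J T b c a, pull_rot J _ a b c, pull_swap J T a b c,
    pull_swap J T b c a, pull_rot J _ a b c, pull_swap J T c a b, pull_rot J _ b c a,
    pull_rot J _ a b c]
  simp only [pull_apply, Matrix.of_apply, ← Finset.sum_add_distrib, Finset.mul_sum]
  refine Finset.sum_congr rfl fun _ _ => Finset.sum_congr rfl fun _ _ =>
    Finset.sum_congr rfl fun _ _ => by ring

theorem ckTensor_pull {J : Mat4} (hJ : IsUnit J.det) (G : Mat4) (D : Fin 4 → Mat4) :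
    ckTensor (cong J G) (pull J D) = pull J (ckTensor G D) := by
  funext a
  ext b c
  have h : ∀ i j k, 3 * pull J D i j k - cong J G i j * contract (cong J G) (pull J D) k =
      pull J (fun i => Matrix.of fun j k => 3 * D i j k - G i j * contract G D k) i j k := by
    intro i j k
    rw [contract_pull hJ, pull_outer]
    simp only [pull_apply, Matrix.of_apply, ← Finset.sum_sub_distrib, Finset.mul_sum]
    refine Finset.sum_congr rfl fun _ _ => Finset.sum_congr rfl fun _ _ =>
      Finset.sum_congr rfl fun _ _ => by ring
  simp only [ckTensor, Matrix.of_apply, h]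
  rw [symmetrize_pull]
  rfl

theorem ckyTensor_pull {J : Mat4} (hJ : IsUnit J.det) (G : Mat4) (D : Fin 4 → Mat4) :
    ckyTensor (cong J G) (pull J D) = pull J (ckyTensor G D) := by
  funext a
  ext b m
  have h1 := pull_outer J G (contract G D) a b m
  have h2 := pull_outer J G (contract G D) b m a
  have h3 := pull_outer J G (contract G D) a m b
  rw [pull_rot J _ a b m] at h2
  rw [pull_swap J _ m a b, pull_rot J _ b m a, pull_rot J _ a b m, mul_comm] at h3
  rw [mul_comm] at h2
  simp only [ckyTensor, Matrix.of_apply, contract_pull hJ]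
  rw [pull_swap J D a b m, mul_left_comm, h1, mul_assoc (1 / 3 : ℝ), h2, mul_assoc (1 / 3 : ℝ), h3]
  simp only [pull_apply, Matrix.of_apply, ← Finset.sum_add_distrib, ← Finset.sum_sub_distrib,
    Finset.mul_sum]
  refine Finset.sum_congr rfl fun _ _ => Finset.sum_congr rfl fun _ _ =>
    Finset.sum_congr rfl fun _ _ => by simp only [ckyTensor, Matrix.of_apply]; ring

/-- The 1-form `Ψ` as a function of the components `D` of the covariant derivative of `P`. -/
def rainichForm (G P : Mat4) (D : Fin 4 → Mat4) (d : Fin 4) : ℝ :=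
  (1 / tr G (mul G P P)) *
    ∑ a, ∑ b, ∑ c, vol G a b c d *
      ∑ a', ∑ b', ∑ c', G⁻¹ a a' * G⁻¹ b b' * G⁻¹ c c' *
        ∑ m, ∑ n, D a' b' m * G⁻¹ m n * P n c'

/-- Raising all three indices is itself a `pull`, along the transposed inverse metric, so the
transformation law follows from `pull_pull`. -/
theorem rainichForm_eq (G P : Mat4) (D : Fin 4 → Mat4) (d : Fin 4) :
    rainichForm G P D d = (1 / tr G (mul G P P)) *
      ∑ a, ∑ b, ∑ c, vol G a b c d * pull (G⁻¹)ᵀ (fun i => mul G (D i) P) a b c := by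
  have h : ∀ a b c, ∑ m, ∑ n, D a b m * G⁻¹ m n * P n c = mul G (D a) P b c := by
    intro a b c
    simp only [mul, Matrix.mul_apply, Finset.sum_mul]
    exact Finset.sum_comm
  simp only [rainichForm, pull_apply, Matrix.transpose_apply, h]

theorem rainichForm_pull {J : Mat4} (hJ : 0 < J.det) (G P : Mat4) (D : Fin 4 → Mat4)
    (d : Fin 4) : rainichForm (cong J G) (cong J P) (pull J D) d =
      ∑ l, J l d * rainichForm G P D l := by
  have hJ' : IsUnit J.det := hJ.ne'.isUnit
  have hm : (fun i => mul (cong J G) (pull J D i) (cong J P)) =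
      pull J (fun i => mul G (D i) P) := by
    funext i
    simp only [pull, ← mul_cong hJ']
    simp only [mul, Finset.sum_mul, Matrix.smul_mul]
  -- The raised tensor is contravariant: its old components come from the new ones by Jᵀ in the role
  -- of the frame matrix.
  have hN : pull (G⁻¹)ᵀ (fun i => mul G (D i) P) = pull Jᵀ (pull ((cong J G)⁻¹)ᵀ
      (fun i => mul (cong J G) (pull J D i) (cong J P))) := by
    rw [hm, pull_pull, pull_pull, ← mul_inv_cong hJ' G]
    simp only [Matrix.transpose_mul, Matrix.transpose_transpose, Matrix.mul_assoc]
  simp only [rainichForm_eq, mul_cong hJ', tr_cong hJ']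
  rw [hN]
  generalize pull ((cong J G)⁻¹)ᵀ (fun i => mul (cong J G) (pull J D i) (cong J P)) = N
  simp only [pull_apply, Matrix.transpose_apply, vol, sqrt_det_cong hJ]
  have h1 : ∀ a b c, J.det * Real.sqrt (-G.det) * levi a b c d * N a b c =
      ∑ i, ∑ j, ∑ k, ∑ l, J l d * (Real.sqrt (-G.det) * levi i j k l *
        (J i a * J j b * J k c * N a b c)) := by
    intro a b c
    rw [mul_right_comm J.det, ← sum_levi_mul]
    simp only [Finset.sum_mul]
    refine Finset.sum_congr rfl fun _ _ => Finset.sum_congr rfl fun _ _ =>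
      Finset.sum_congr rfl fun _ _ => Finset.sum_congr rfl fun _ _ => by ring
  simp only [h1]
  rw [sum_comm_four_three]
  simp only [Finset.mul_sum]
  refine Eq.trans ?_ (sum_comm_three _).symm
  refine Finset.sum_congr rfl fun _ _ => Finset.sum_congr rfl fun _ _ =>
    Finset.sum_congr rfl fun _ _ => Finset.sum_congr rfl fun _ _ => Finset.sum_congr rfl fun _ _ =>
      Finset.sum_congr rfl fun _ _ => Finset.sum_congr rfl fun _ _ => by ring

/-! ### The derivative of the traceless square -/

/-- The derivative of the traceless square at `A` in the direction `D`. -/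
def tracelessSquareDeriv (G A D : Mat4) : Mat4 :=
  mul G D A + mul G A D - ((1 / 4) * tr G (mul G D A + mul G A D)) • G

theorem tr_add (G S T : Mat4) : tr G (S + T) = tr G S + tr G T := by
  simp [tr, mul_add]

theorem tr_smul (G : Mat4) (r : ℝ) (T : Mat4) : tr G (r • T) = r * tr G T := by
  simp [tr]

theorem tracelessSquareDeriv_cong {J : Mat4} (hJ : IsUnit J.det) (G A D : Mat4) :
    tracelessSquareDeriv (cong J G) (cong J A) (cong J D) =
      cong J (tracelessSquareDeriv G A D) := by
  simp only [tracelessSquareDeriv, mul_cong hJ, tr_cong hJ, cong_smul, cong_sub, ← cong_add]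

theorem tracelessSquareDeriv_sum (G A : Mat4) (D : Fin 4 → Mat4) (r : Fin 4 → ℝ) :
    tracelessSquareDeriv G A (∑ i, r i • D i) = ∑ i, r i • tracelessSquareDeriv G A (D i) := by
  have hl : ∀ X Y : Mat4, tracelessSquareDeriv G A (X + Y) =
      tracelessSquareDeriv G A X + tracelessSquareDeriv G A Y := by
    intro X Y
    simp only [tracelessSquareDeriv, mul, add_mul, mul_add, tr_add, add_smul]
    abel
  have hs : ∀ (t : ℝ) (X : Mat4), tracelessSquareDeriv G A (t • X) =
      t • tracelessSquareDeriv G A X := by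
    intro t X
    simp only [tracelessSquareDeriv, mul, Matrix.smul_mul, Matrix.mul_smul, ← smul_add, tr_smul,
      smul_sub, smul_smul]
    congr 2
    ring
  simp only [Fin.sum_univ_four, hl, hs]

theorem tracelessSquareDeriv_pull {J : Mat4} (hJ : IsUnit J.det) (G A : Mat4)
    (D : Fin 4 → Mat4) :
    (fun c => tracelessSquareDeriv (cong J G) (cong J A) (pull J D c)) =
      pull J (fun c => tracelessSquareDeriv G A (D c)) := by
  funext c
  simp only [pull, tracelessSquareDeriv_sum, tracelessSquareDeriv_cong hJ]

/-! ### The differential of the angle of the invariants -/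

/-- `(u dv - v du) / (u² + v²)` for `u = (A, A)` and `v = (A, *A)`, as a function of the covariant
derivative `D` of `A`. -/
def angleForm (G A : Mat4) (D : Fin 4 → Mat4) (d : Fin 4) : ℝ :=
  (form2Inner G A A * (2 * form2Inner G (D d) (hodge G A))
    - form2Inner G A (hodge G A) * (2 * form2Inner G (D d) A))
    / (form2Inner G A A ^ 2 + form2Inner G A (hodge G A) ^ 2)

theorem form2Inner_sum (G Y : Mat4) (D : Fin 4 → Mat4) (r : Fin 4 → ℝ) :
    form2Inner G (∑ i, r i • D i) Y = ∑ i, r i * form2Inner G (D i) Y := by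
  simp only [form2Inner_eq_trace, Finset.sum_mul, Matrix.smul_mul, Matrix.trace_sum,
    Matrix.trace_smul, smul_eq_mul, Finset.mul_sum]
  exact Finset.sum_congr rfl fun _ _ => by ring

theorem angleForm_pull {J : Mat4} (hJ : 0 < J.det) (G A : Mat4) (D : Fin 4 → Mat4) (d : Fin 4) :
    angleForm (cong J G) (cong J A) (pull J D) d = ∑ l, J l d * angleForm G A D l := by
  simp only [angleForm, hodge_cong hJ, form2Inner_cong hJ.ne'.isUnit, pull, form2Inner_sum]
  simp only [Fin.sum_univ_four]
  ring

/-! ### Evaluation in an adapted frame -/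

/-- The Minkowski metric. -/
def eta : Mat4 := !![-1, 0, 0, 0; 0, 1, 0, 0; 0, 0, 1, 0; 0, 0, 0, 1]

/-- The 2-form with the given components. -/
def skewMat (a b c d e f : ℝ) : Mat4 :=
  !![0, a, b, c; -a, 0, d, e; -b, -d, 0, f; -c, -e, -f, 0]

theorem eta_mul_eta : eta * eta = 1 := by
  ext i j
  fin_cases i <;> fin_cases j <;> simp [eta, Matrix.mul_apply, Fin.sum_univ_four]

theorem eta_inv : eta⁻¹ = eta := Matrix.inv_eq_right_inv eta_mul_eta

theorem eta_transpose : etaᵀ = eta := by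
  ext i j
  fin_cases i <;> fin_cases j <;> simp [eta]

theorem det_eta : eta.det = -1 := by
  rw [det_four]; simp [eta]

theorem eq_skewMat {A : Mat4} (hA : ∀ i j, A i j = -A j i) :
    A = skewMat (A 0 1) (A 0 2) (A 0 3) (A 1 2) (A 1 3) (A 2 3) := by
  have h0 : ∀ i, A i i = 0 := fun i => by linarith [hA i i]
  ext i j
  fin_cases i <;> fin_cases j <;>
    first | exact h0 _ | exact hA _ _ | rfl

theorem raise_eta_skewMat (a b c d e f : ℝ) :
    raise eta (skewMat a b c d e f) = skewMat (-a) (-b) (-c) d e f := by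
  rw [raise, eta_inv, eta_transpose]
  ext i j
  fin_cases i <;> fin_cases j <;>
    simp [eta, skewMat, Matrix.mul_apply, Fin.sum_univ_four]

/-- Free indices are encoded by indicator functions, so that the 24-term expansion `sum_levi`
applies; `sum_levi_three` serves the same purpose with one free index. -/
theorem sum_levi_two (X : Mat4) (a b : Fin 4) :
    ∑ c, ∑ d, levi a b c d * X c d = ∑ i, ∑ j, ∑ c, ∑ d, levi i j c d *
      (if i = a then if j = b then X c d else 0 else 0) := by
  simp

theorem hodge_eta_skewMat (a b c d e f : ℝ) :
    hodge eta (skewMat a b c d e f) = skewMat f (-e) d (-c) b (-a) := by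
  ext i j
  simp only [hodge, Matrix.of_apply, raise_eta_skewMat, vol, det_eta, neg_neg, Real.sqrt_one,
    one_mul]
  rw [sum_levi_two, sum_levi]
  fin_cases i <;> fin_cases j <;> simp [skewMat] <;> ring

theorem form2Inner_eta_skewMat (a b c d e f a' b' c' d' e' f' : ℝ) :
    form2Inner eta (skewMat a b c d e f) (skewMat a' b' c' d' e' f') =
      -(a * a') - b * b' - c * c' + d * d' + e * e' + f * f' := by
  rw [form2Inner, raise_eta_skewMat]
  simp [skewMat, Fin.sum_univ_four]
  ring

theorem mul_eta_apply (S T : Mat4) (i j : Fin 4) : mul eta S T i j =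
    -(S i 0 * T 0 j) + S i 1 * T 1 j + S i 2 * T 2 j + S i 3 * T 3 j := by
  rw [mul, eta_inv]
  simp [eta, Matrix.mul_apply, Fin.sum_univ_four]

theorem tr_eta (T : Mat4) : tr eta T = -T 0 0 + T 1 1 + T 2 2 + T 3 3 := by
  rw [tr, eta_inv]
  simp only [Matrix.trace, Matrix.diag, Matrix.mul_apply, Fin.sum_univ_four]
  simp [eta]

theorem contract_eta (D : Fin 4 → Mat4) (b : Fin 4) :
    contract eta D b = -D 0 0 b + D 1 1 b + D 2 2 b + D 3 3 b := by
  rw [contract, eta_inv]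
  simp [eta, Fin.sum_univ_four]

/-- The normal form `s diag(-1, 1, -1, -1)` of a traceless square. -/
def squareForm (s : ℝ) : Mat4 := !![-s, 0, 0, 0; 0, s, 0, 0; 0, 0, -s, 0; 0, 0, 0, -s]

theorem tracelessSquare_eta (α β : ℝ) :
    tracelessSquare eta (skewMat α 0 0 0 0 β) = squareForm ((α ^ 2 + β ^ 2) / 2) := by
  rw [tracelessSquare, tr_eta]
  ext i j
  simp only [Matrix.sub_apply, Matrix.smul_apply, mul_eta_apply]
  fin_cases i <;> fin_cases j <;> simp [skewMat, squareForm, eta] <;> ring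

/-- The combination β a - α f is absent: the direction *A = (β, 0, 0, 0, 0, -α) is in the kernel,
being the infinitesimal duality rotation. When α² + β² ≠ 0 the kernel is spanned by it. -/
theorem tracelessSquareDeriv_eta (α β a b c d e f : ℝ) :
    tracelessSquareDeriv eta (skewMat α 0 0 0 0 β) (skewMat a b c d e f) =
      !![-(α * a + β * f), 0, α * d - β * c, α * e + β * b;
         0, α * a + β * f, α * b - β * e, α * c + β * d;
         α * d - β * c, α * b - β * e, -(α * a + β * f), 0;
         α * e + β * b, α * c + β * d, 0, -(α * a + β * f)] := by
  rw [tracelessSquareDeriv, tr_eta]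
  ext i j
  simp only [Matrix.sub_apply, Matrix.add_apply, Matrix.smul_apply, mul_eta_apply]
  fin_cases i <;> fin_cases j <;> simp [skewMat, eta] <;> ring

theorem tr_eta_squareForm (s : ℝ) :
    tr eta (mul eta (squareForm s) (squareForm s)) = 4 * s ^ 2 := by
  rw [tr_eta]
  simp only [mul_eta_apply]
  simp [squareForm]
  ring

theorem sum_levi_three (X : Fin 4 → Fin 4 → Fin 4 → ℝ) (d : Fin 4) :
    ∑ a, ∑ b, ∑ c, levi a b c d * X a b c = ∑ a, ∑ b, ∑ c, ∑ l, levi a b c l *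
      (if l = d then X a b c else 0) := by
  simp

theorem pull_eta (N : Fin 4 → Mat4) (a b c : Fin 4) :
    pull eta N a b c = eta a a * eta b b * eta c c * N a b c := by
  rw [pull_apply]
  fin_cases a <;> fin_cases b <;> fin_cases c <;> simp [eta, Fin.sum_univ_four]

theorem rainichForm_eta (s : ℝ) (D : Fin 4 → Mat4) (d : Fin 4) :
    rainichForm eta (squareForm s) D d = (1 / (4 * s ^ 2)) *
      ∑ a, ∑ b, ∑ c, ∑ l, levi a b c l *
        (if l = d then eta a a * eta b b * eta c c * (D a b c * (eta c c * squareForm s c c))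
          else 0) := by
  have h : ∀ a b c, mul eta (D a) (squareForm s) b c =
      D a b c * (eta c c * squareForm s c c) := by
    intro a b c
    rw [mul_eta_apply]
    fin_cases c <;> simp [squareForm, eta]
  rw [rainichForm_eq, eta_inv, eta_transpose, tr_eta_squareForm]
  simp only [vol, det_eta, neg_neg, Real.sqrt_one, one_mul, pull_eta, h]
  rw [sum_levi_three]

-- The equation says that ∇A is the sum of its totally skew part and its trace part. These account
-- for 4 + 4 of the 24 components, leaving sixteen independent conditions, listed here in solved
-- form.
set_option maxHeartbeats 2000000 in
theorem ckyTensor_eta_eq_zero_iff (a b c d e f : Fin 4 → ℝ) :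
    ckyTensor eta (fun i => skewMat (a i) (b i) (c i) (d i) (e i) (f i)) = 0 ↔
    a 0 = d 2 ∧ a 0 = e 3 ∧ a 1 = b 2 ∧ a 1 = c 3 ∧ d 1 = -b 0 ∧ f 3 = b 0 ∧ e 1 = -c 0 ∧ f 2 = -c 0 ∧
    b 1 = -d 0 ∧ c 1 = -e 0 ∧ a 2 = d 0 ∧ a 3 = e 0 ∧ c 2 = -f 0 ∧ b 3 = f 0 ∧ e 2 = -f 1 ∧ d 3 = f 1 := by
  constructor
  · intro H
    have H' : ∀ i j k, ckyTensor eta (fun i => skewMat (a i) (b i) (c i) (d i) (e i) (f i)) i j k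
      = 0 := fun i j k => by rw [H]; rfl
    simp only [ckyTensor, Matrix.of_apply, contract_eta] at H'
    have e001 := H' 0 0 1
    have e002 := H' 0 0 2
    have e003 := H' 0 0 3
    have e012 := H' 0 1 2
    have e013 := H' 0 1 3
    have e021 := H' 0 2 1
    have e022 := H' 0 2 2
    have e023 := H' 0 2 3
    have e031 := H' 0 3 1
    have e032 := H' 0 3 2
    have e110 := H' 1 1 0
    have e112 := H' 1 1 2
    have e113 := H' 1 1 3
    have e122 := H' 1 2 2
    have e123 := H' 1 2 3
    have e132 := H' 1 3 2
    simp [skewMat, eta] at e001 e002 e003 e012 e013 e021 e022 e023 e031 e032 e110 e112 e113 e122 e123 e132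
    refine ⟨?_, ?_, ?_, ?_, ?_, ?_, ?_, ?_, ?_, ?_, ?_, ?_, ?_, ?_, ?_, ?_⟩ <;> linarith
  · rintro ⟨h1, h2, h3, h4, h5, h6, h7, h8, h9, h10, h11, h12, h13, h14, h15, h16⟩
    funext i
    ext j k
    simp only [ckyTensor, Matrix.of_apply, contract_eta]
    fin_cases i <;> fin_cases j <;> fin_cases k <;> simp [skewMat, eta] <;> linarith

set_option maxHeartbeats 2000000 in
theorem ckTensor_eta_eq_zero (α β : ℝ) (a b c d e f : Fin 4 → ℝ)
    (h : a 0 = d 2 ∧ a 0 = e 3 ∧ a 1 = b 2 ∧ a 1 = c 3 ∧ d 1 = -b 0 ∧ f 3 = b 0 ∧ e 1 = -c 0 ∧ f 2 = -c 0 ∧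
    b 1 = -d 0 ∧ c 1 = -e 0 ∧ a 2 = d 0 ∧ a 3 = e 0 ∧ c 2 = -f 0 ∧ b 3 = f 0 ∧ e 2 = -f 1 ∧ d 3 = f 1) :
    ckTensor eta (fun i => tracelessSquareDeriv eta (skewMat α 0 0 0 0 β)
        (skewMat (a i) (b i) (c i) (d i) (e i) (f i))) = 0 := by
  obtain ⟨h1, h2, h3, h4, h5, h6, h7, h8, h9, h10, h11, h12, h13, h14, h15, h16⟩ := h
  simp only [tracelessSquareDeriv_eta]
  funext i
  ext j k
  simp only [ckTensor, symmetrize, Matrix.of_apply, contract_eta]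
  fin_cases i <;> fin_cases j <;> fin_cases k <;>
    simp [eta, ← h1, ← h2, ← h3, ← h4, h5, h6, h7, h8, h9, h10, h11, h12, h13, h14, h15, h16] <;>
    ring

/-- The conformal Killing equation alone does not see β a - α f; the hypotheses `r0` to `r3`, which
express the equality of the Rainich form with the angle form, supply it for each direction of
differentiation. -/
theorem eq_of_ckTensor_eta_eq_zero (α β : ℝ) (h : α ^ 2 + β ^ 2 ≠ 0) (a b c d e f : Fin 4 → ℝ)
    (H : ckTensor eta (fun i => tracelessSquareDeriv eta (skewMat α 0 0 0 0 β)
        (skewMat (a i) (b i) (c i) (d i) (e i) (f i))) = 0)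
    (r0 : 2 * (β * a 0 - α * f 0) + (-(α * c 2) - β * d 2 + α * b 3 - β * e 3) = 0)
    (r1 : 2 * (β * a 1 - α * f 1) + (-(β * b 2) - α * e 2 - β * c 3 + α * d 3) = 0)
    (r2 : 2 * (β * a 2 - α * f 2) + (-(α * c 0) - β * d 0 + β * b 1 + α * e 1) = 0)
    (r3 : 2 * (β * a 3 - α * f 3) + (α * b 0 - β * e 0 + β * c 1 - α * d 1) = 0) :
    a 0 = d 2 ∧ a 0 = e 3 ∧ a 1 = b 2 ∧ a 1 = c 3 ∧ d 1 = -b 0 ∧ f 3 = b 0 ∧ e 1 = -c 0 ∧ f 2 = -c 0 ∧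
    b 1 = -d 0 ∧ c 1 = -e 0 ∧ a 2 = d 0 ∧ a 3 = e 0 ∧ c 2 = -f 0 ∧ b 3 = f 0 ∧ e 2 = -f 1 ∧ d 3 = f 1 := by
  have H' : ∀ i j k, ckTensor eta (fun i => tracelessSquareDeriv eta (skewMat α 0 0 0 0 β)
        (skewMat (a i) (b i) (c i) (d i) (e i) (f i))) i j k = 0 := fun i j k => by rw [H]; rfl
  simp only [tracelessSquareDeriv_eta, ckTensor, symmetrize, Matrix.of_apply, contract_eta] at H'
  have h000 : -2 * α * a 0 - 2 * β * f 0 - β * c 2 + α * d 2 + β * b 3 + α * e 3 = 0 := by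
    rw [← H' 0 0 0]; simp [eta]; ring
  have h001 : (-2 / 3) * α * a 1 - 2 / 3 * β * f 1 + 1 / 3 * α * b 2 - 1 / 3 * β * e 2
      + 1 / 3 * α * c 3 + 1 / 3 * β * d 3 = 0 := by
    rw [← H' 0 0 1]; simp [eta]; ring
  have h002 : (-5 / 3) * β * c 0 + 5 / 3 * α * d 0 + 1 / 3 * α * b 1 - 1 / 3 * β * e 1
      - 4 / 3 * α * a 2 - 4 / 3 * β * f 2 = 0 := by
    rw [← H' 0 0 2]; simp [eta]; ring
  have h003 : 5 / 3 * β * b 0 + 5 / 3 * α * e 0 + 1 / 3 * α * c 1 + 1 / 3 * β * d 1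
      - 4 / 3 * α * a 3 - 4 / 3 * β * f 3 = 0 := by
    rw [← H' 0 0 3]; simp [eta]; ring
  have h012 : α * b 0 - β * e 0 - β * c 1 + α * d 1 = 0 := by
    rw [← H' 0 1 2]; simp [eta]; ring
  have h013 : α * c 0 + β * d 0 + β * b 1 + α * e 1 = 0 := by
    rw [← H' 0 1 3]; simp [eta]; ring
  have h022 : (-4 / 3) * α * a 0 - 4 / 3 * β * f 0 - 5 / 3 * β * c 2 + 5 / 3 * α * d 2
      - 1 / 3 * β * b 3 - 1 / 3 * α * e 3 = 0 := by
    rw [← H' 0 2 2]; simp [eta]; ring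
  have h023 : β * b 2 + α * e 2 - β * c 3 + α * d 3 = 0 := by
    rw [← H' 0 2 3]; simp [eta]; ring
  have h112 : (-1 / 3) * β * c 0 + 1 / 3 * α * d 0 + 5 / 3 * α * b 1 - 5 / 3 * β * e 1
      + 4 / 3 * α * a 2 + 4 / 3 * β * f 2 = 0 := by
    rw [← H' 1 1 2]; simp [eta]; ring
  have h113 : 1 / 3 * β * b 0 + 1 / 3 * α * e 0 + 5 / 3 * α * c 1 + 5 / 3 * β * d 1
      + 4 / 3 * α * a 3 + 4 / 3 * β * f 3 = 0 := by
    rw [← H' 1 1 3]; simp [eta]; ring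
  have h122 : (-4 / 3) * α * a 1 - 4 / 3 * β * f 1 + 5 / 3 * α * b 2 - 5 / 3 * β * e 2
      - 1 / 3 * α * c 3 - 1 / 3 * β * d 3 = 0 := by
    rw [← H' 1 2 2]; simp [eta]; ring
  have h123 : α * c 2 + β * d 2 + α * b 3 - β * e 3 = 0 := by
    rw [← H' 1 2 3]; simp [eta]; ring
  -- Multiplied by α² + β², each difference of the two sides is a combination of the twelve
  -- components above and the four relations `r`, with coefficients linear in α and β.
  refine ⟨?_, ?_, ?_, ?_, ?_, ?_, ?_, ?_, ?_, ?_, ?_, ?_, ?_, ?_, ?_, ?_⟩ <;>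
    refine sub_eq_zero.1 ((mul_eq_zero.1 ?_).resolve_left h)
  · linear_combination (-1 / 6) * α * h000 - 1 / 2 * α * h022 - 1 / 2 * β * h123 + 1 / 2 * β * r0
  · linear_combination (-5 / 6) * α * h000 + 1 / 2 * α * h022 + 1 / 2 * β * h123 + 1 / 2 * β * r0
  · linear_combination (-1 / 2) * α * h001 - 1 / 2 * β * h023 - 1 / 2 * α * h122 + 1 / 2 * β * r1
  · linear_combination (-5 / 2) * α * h001 + 1 / 2 * β * h023 + 1 / 2 * α * h122 + 1 / 2 * β * r1
  · linear_combination 1 / 2 * β * h003 + α * h012 + 1 / 2 * β * h113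
  · linear_combination (-5 / 8) * β * h003 - 1 / 2 * α * h012 + 1 / 8 * β * h113 - 1 / 2 * α * r3
  · linear_combination (-1 / 2) * β * h002 + α * h013 - 1 / 2 * β * h112
  · linear_combination (-5 / 8) * β * h002 + 1 / 2 * α * h013 + 1 / 8 * β * h112 - 1 / 2 * α * r2
  · linear_combination 1 / 2 * α * h002 + β * h013 + 1 / 2 * α * h112
  · linear_combination 1 / 2 * α * h003 - β * h012 + 1 / 2 * α * h113
  · linear_combination (-5 / 8) * α * h002 - 1 / 2 * β * h013 + 1 / 8 * α * h112 + 1 / 2 * β * r2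
  · linear_combination (-5 / 8) * α * h003 + 1 / 2 * β * h012 + 1 / 8 * α * h113 + 1 / 2 * β * r3
  · linear_combination (-1 / 6) * β * h000 - 1 / 2 * β * h022 + 1 / 2 * α * h123 - 1 / 2 * α * r0
  · linear_combination 5 / 6 * β * h000 - 1 / 2 * β * h022 + 1 / 2 * α * h123 + 1 / 2 * α * r0
  · linear_combination (-1 / 2) * β * h001 + 1 / 2 * α * h023 - 1 / 2 * β * h122 - 1 / 2 * α * r1
  · linear_combination 5 / 2 * β * h001 + 1 / 2 * α * h023 - 1 / 2 * β * h122 + 1 / 2 * α * r1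

/-- The heart of the theorem, reduced to linear algebra on ∇A in the adapted frame. What remains is
to make the Rainich form explicit and recognise the relations used in `eq_of_ckTensor_eta_eq_zero`.
-/
theorem core_eta (α β : ℝ) (h : α ^ 2 + β ^ 2 ≠ 0) (a b c d e f : Fin 4 → ℝ) :
    ckyTensor eta (fun i => skewMat (a i) (b i) (c i) (d i) (e i) (f i)) = 0 ↔
      ckTensor eta (fun i => tracelessSquareDeriv eta (skewMat α 0 0 0 0 β)
        (skewMat (a i) (b i) (c i) (d i) (e i) (f i))) = 0 ∧
      ∀ l, rainichForm eta (squareForm ((α ^ 2 + β ^ 2) / 2))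
        (fun i => tracelessSquareDeriv eta (skewMat α 0 0 0 0 β)
          (skewMat (a i) (b i) (c i) (d i) (e i) (f i))) l =
        angleForm eta (skewMat α 0 0 0 0 β)
          (fun i => skewMat (a i) (b i) (c i) (d i) (e i) (f i)) l := by
  have hr : ∀ l, (α ^ 2 + β ^ 2) * (rainichForm eta (squareForm ((α ^ 2 + β ^ 2) / 2))
        (fun i => tracelessSquareDeriv eta (skewMat α 0 0 0 0 β)
          (skewMat (a i) (b i) (c i) (d i) (e i) (f i))) l -
        angleForm eta (skewMat α 0 0 0 0 β)
          (fun i => skewMat (a i) (b i) (c i) (d i) (e i) (f i)) l) =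
      2 * (β * a l - α * f l) + ![-(α * c 2) - β * d 2 + α * b 3 - β * e 3,
        -(β * b 2) - α * e 2 - β * c 3 + α * d 3, -(α * c 0) - β * d 0 + β * b 1 + α * e 1,
        α * b 0 - β * e 0 + β * c 1 - α * d 1] l := by
    intro l
    rw [rainichForm_eta, angleForm, hodge_eta_skewMat]
    simp only [form2Inner_eta_skewMat, tracelessSquareDeriv_eta]
    rw [sum_levi]
    -- In this frame u = β² - α² and v = -2αβ, that is, u + iv = -(α + iβ)².
    have h2 : (-(α * α) - 0 * 0 - 0 * 0 + 0 * 0 + 0 * 0 + β * β) ^ 2 +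
      (-(α * β) - 0 * -0 - 0 * 0 + 0 * -0 + 0 * 0 + β * -α) ^ 2 = (α ^ 2 + β ^ 2) ^ 2 := by ring
    rw [h2]
    fin_cases l <;> simp [eta, squareForm] <;> field_simp <;> ring
  have hr' : (∀ l, rainichForm eta (squareForm ((α ^ 2 + β ^ 2) / 2))
        (fun i => tracelessSquareDeriv eta (skewMat α 0 0 0 0 β)
          (skewMat (a i) (b i) (c i) (d i) (e i) (f i))) l =
        angleForm eta (skewMat α 0 0 0 0 β)
          (fun i => skewMat (a i) (b i) (c i) (d i) (e i) (f i)) l) ↔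
      ∀ l, 2 * (β * a l - α * f l) + ![-(α * c 2) - β * d 2 + α * b 3 - β * e 3,
        -(β * b 2) - α * e 2 - β * c 3 + α * d 3, -(α * c 0) - β * d 0 + β * b 1 + α * e 1,
        α * b 0 - β * e 0 + β * c 1 - α * d 1] l = 0 := by
    refine forall_congr' fun l => ?_
    rw [← hr l, mul_eq_zero, or_iff_right h, sub_eq_zero]
  rw [hr', ckyTensor_eta_eq_zero_iff]
  constructor
  · intro H
    refine ⟨ckTensor_eta_eq_zero α β a b c d e f H, ?_⟩
    obtain ⟨h1, h2, h3, h4, h5, h6, h7, h8, h9, h10, h11, h12, h13, h14, h15, h16⟩ := H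
    intro l
    fin_cases l <;>
      simp [← h1, ← h2, ← h3, ← h4, h5, h6, h7, h8, h9, h10, h11, h12, h13, h14, h15, h16] <;>
      ring
  · rintro ⟨H, r⟩
    exact eq_of_ckTensor_eta_eq_zero α β h a b c d e f H (r 0) (r 1) (r 2) (r 3)

/-! ### Adapted frames -/

/-- The eigenvalues are ±μ because S² = μ², and a sum of three of them equals -μ ≠ 0 only if μ
occurs once and -μ twice. -/
theorem exists_orthogonal_diagonal {S : Matrix (Fin 3) (Fin 3) ℝ} (hS : Sᵀ = S) {μ : ℝ}
    (hμ : μ ≠ 0) (hsq : S * S = (μ ^ 2) • (1 : Matrix (Fin 3) (Fin 3) ℝ)) (htr : S.trace = -μ) :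
    ∃ U : Matrix (Fin 3) (Fin 3) ℝ, Uᵀ * U = 1 ∧
      Uᵀ * S * U = Matrix.diagonal ![μ, -μ, -μ] := by
  have hH : S.IsHermitian := by rw [Matrix.IsHermitian, Matrix.conjTranspose_eq_transpose_of_trivial, hS]
  obtain ⟨V, ev, hV, hD⟩ : ∃ (V : Matrix (Fin 3) (Fin 3) ℝ) (ev : Fin 3 → ℝ), Vᵀ * V = 1 ∧
      Vᵀ * S * V = Matrix.diagonal ev := by
    have h1 : (hH.eigenvectorUnitary : Matrix (Fin 3) (Fin 3) ℝ)ᵀ * hH.eigenvectorUnitary = 1 := by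
      have := Unitary.coe_star_mul_self hH.eigenvectorUnitary
      rwa [Matrix.star_eq_conjTranspose, Matrix.conjTranspose_eq_transpose_of_trivial] at this
    refine ⟨hH.eigenvectorUnitary.1, hH.eigenvalues, h1, ?_⟩
    have h2 := hH.spectral_theorem
    rw [Unitary.conjStarAlgAut_apply, Matrix.star_eq_conjTranspose,
      Matrix.conjTranspose_eq_transpose_of_trivial] at h2
    set V : Matrix (Fin 3) (Fin 3) ℝ := hH.eigenvectorUnitary.1
    calc Vᵀ * S * V = (Vᵀ * V) * Matrix.diagonal (RCLike.ofReal ∘ hH.eigenvalues) * (Vᵀ * V) := by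
          conv_lhs => rw [h2]
          simp only [Matrix.mul_assoc]
      _ = _ := by rw [h1, one_mul, mul_one]; rfl
  have hV' : V * Vᵀ = 1 := mul_eq_one_comm.1 hV
  have hev : ∀ i, ev i = μ ∨ ev i = -μ := by
    intro i
    have : Matrix.diagonal ev * Matrix.diagonal ev = (μ ^ 2) • (1 : Matrix (Fin 3) (Fin 3) ℝ) := by
      calc Matrix.diagonal ev * Matrix.diagonal ev = Vᵀ * (S * (V * Vᵀ) * S) * V := by
            rw [← hD]; simp only [Matrix.mul_assoc]
        _ = _ := by rw [hV', mul_one, hsq, Matrix.mul_smul, Matrix.smul_mul, mul_one, hV]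
    have h := congrFun (congrFun this i) i
    simp at h
    exact sq_eq_sq_iff_eq_or_eq_neg.1 (by rw [← h]; ring)
  have hsum : ev 0 + ev 1 + ev 2 = -μ := by
    have : (Matrix.diagonal ev).trace = -μ := by
      rw [← hD, Matrix.trace_mul_comm, ← Matrix.mul_assoc, hV', one_mul, htr]
    rw [← this, Matrix.trace_diagonal, Fin.sum_univ_three]
  -- Reorder the eigenbasis so that the simple eigenvalue comes first.
  obtain ⟨σ, hσ⟩ : ∃ σ : Equiv.Perm (Fin 3), ev ∘ σ = ![μ, -μ, -μ] := by
    have key : (ev 0 = μ ∧ ev 1 = -μ ∧ ev 2 = -μ) ∨ (ev 0 = -μ ∧ ev 1 = μ ∧ ev 2 = -μ) ∨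
        (ev 0 = -μ ∧ ev 1 = -μ ∧ ev 2 = μ) := by
      rcases hev 0 with h0 | h0 <;> rcases hev 1 with h1 | h1 <;> rcases hev 2 with h2 | h2 <;>
        simp only [h0, h1, h2, true_and, and_true, true_or, or_true] <;> exfalso <;> apply hμ <;>
        rw [h0, h1, h2] at hsum <;> linarith
    rcases key with ⟨h0, h1, h2⟩ | ⟨h0, h1, h2⟩ | ⟨h0, h1, h2⟩
    · refine ⟨1, ?_⟩
      funext i; fin_cases i <;> simp [h0, h1, h2]
    · refine ⟨Equiv.swap 0 1, ?_⟩
      funext i; fin_cases i <;> simp [h0, h1, h2, Equiv.swap_apply_def]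
    · refine ⟨Equiv.swap 0 2, ?_⟩
      funext i; fin_cases i <;> simp [h0, h1, h2, Equiv.swap_apply_def]
  refine ⟨V.submatrix id σ, ?_, ?_⟩
  · rw [Matrix.transpose_submatrix, ← Matrix.submatrix_mul _ _ σ id σ Function.bijective_id, hV,
      Matrix.submatrix_one _ σ.injective]
  · rw [Matrix.transpose_submatrix, ← Matrix.submatrix_id_id S,
      ← Matrix.submatrix_mul _ _ σ id id Function.bijective_id,
      ← Matrix.submatrix_mul _ _ σ id σ Function.bijective_id, hD, ← hσ,
      Matrix.submatrix_diagonal _ _ σ.injective]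

/-- The block diagonal matrix with blocks of sizes 1 and 3. -/
def block (r : ℝ) (S : Matrix (Fin 3) (Fin 3) ℝ) : Mat4 :=
  Matrix.of (Fin.cons (Fin.cons r fun _ => 0) fun i => Fin.cons 0 fun j => S i j)

theorem block_mul (r t : ℝ) (S T : Matrix (Fin 3) (Fin 3) ℝ) :
    block r S * block t T = block (r * t) (S * T) := by
  ext i j
  refine Fin.cases ?_ (fun i => ?_) i <;> refine Fin.cases ?_ (fun j => ?_) j <;>
    simp [block, Matrix.mul_apply, Fin.sum_univ_succ]

theorem block_transpose (r : ℝ) (S : Matrix (Fin 3) (Fin 3) ℝ) :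
    (block r S)ᵀ = block r Sᵀ := by
  ext i j
  refine Fin.cases ?_ (fun i => ?_) i <;> refine Fin.cases ?_ (fun j => ?_) j <;> simp [block]

theorem block_eta : block (-1) 1 = eta := by
  ext i j
  fin_cases i <;> fin_cases j <;> simp [block, eta] <;> rfl

theorem block_squareForm (μ : ℝ) :
    block (-μ) (Matrix.diagonal ![μ, -μ, -μ]) = squareForm μ := by
  ext i j
  fin_cases i <;> fin_cases j <;> simp [block, squareForm] <;> rfl

/-- The Lorentz boost with first column `(t, w)`. -/
def boost (t x y z : ℝ) : Mat4 :=
  !![t, x, y, z;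
     x, 1 + x * x / (1 + t), x * y / (1 + t), x * z / (1 + t);
     y, x * y / (1 + t), 1 + y * y / (1 + t), y * z / (1 + t);
     z, x * z / (1 + t), y * z / (1 + t), 1 + z * z / (1 + t)]

theorem boost_transpose (t x y z : ℝ) : (boost t x y z)ᵀ = boost t x y z := by
  ext i j
  fin_cases i <;> fin_cases j <;> rfl

theorem cong_boost {t x y z : ℝ} (ht : 0 < t) (h : t ^ 2 = 1 + x ^ 2 + y ^ 2 + z ^ 2) :
    cong (boost t x y z) eta = eta := by
  have h1 : 1 + t ≠ 0 := by positivity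
  rw [cong, boost_transpose]
  ext i j
  have e : (boost t x y z * eta * boost t x y z) i j = mul eta (boost t x y z) (boost t x y z) i j := by
    rw [mul, eta_inv]
  rw [e, mul_eta_apply]
  have hx : x ^ 2 = t ^ 2 - 1 - y ^ 2 - z ^ 2 := by linarith
  fin_cases i <;> fin_cases j <;> simp [boost, eta] <;> field_simp <;> ring_nf <;>
    simp only [hx, show x ^ 3 = x * x ^ 2 by ring, show x ^ 4 = x ^ 2 * x ^ 2 by ring] <;> ring

/-- The vector w = (0, P₀₂, -P₀₁, 0) is spatial and P w has no time component, so c |w|² = |P w|² ≥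
0. If w = 0, the basis vector e₁ does the same. -/
theorem pos_of_square_eq {P : Mat4} (hP : Pᵀ = P) {c : ℝ} (hsq : mul eta P P = c • eta)
    (hc : c ≠ 0) : 0 < c := by
  have hs : ∀ i j, P i j = P j i := fun i j => congrFun (congrFun hP j) i
  have h := fun i j => congrFun (congrFun hsq i) j
  simp only [mul_eta_apply, Matrix.smul_apply, smul_eq_mul] at h
  have h11 := h 1 1
  have h22 := h 2 2
  have h12 := h 1 2
  simp [eta] at h11 h22 h12
  rw [hs 1 0] at h11 h12
  rw [hs 2 0] at h22
  rw [hs 1 2] at h11 h12 h22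
  rw [hs 1 3] at h11 h12
  rw [hs 2 3] at h22
  refine lt_of_le_of_ne ?_ hc.symm
  by_cases h0 : P 0 1 ^ 2 + P 0 2 ^ 2 = 0
  · have h1 : P 0 1 = 0 := by nlinarith [sq_nonneg (P 0 1), sq_nonneg (P 0 2)]
    rw [h1] at h11
    nlinarith [sq_nonneg (P 1 1), sq_nonneg (P 2 1), sq_nonneg (P 3 1)]
  · have h1 : 0 < P 0 1 ^ 2 + P 0 2 ^ 2 := lt_of_le_of_ne (by positivity) (Ne.symm h0)
    have h2 : c * (P 0 1 ^ 2 + P 0 2 ^ 2) = (P 0 2 * P 1 1 - P 0 1 * P 2 1) ^ 2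
        + (P 0 2 * P 2 1 - P 0 1 * P 2 2) ^ 2 + (P 0 2 * P 3 1 - P 0 1 * P 3 2) ^ 2 := by
      linear_combination (-P 0 2 ^ 2) * h11 - P 0 1 ^ 2 * h22 + 2 * P 0 1 * P 0 2 * h12
    have h3 : 0 ≤ c * (P 0 1 ^ 2 + P 0 2 ^ 2) := by rw [h2]; positivity
    exact nonneg_of_mul_nonneg_left h3 h1

/-- With μ² = c, the endomorphism K = η⁻¹P/μ is a self-adjoint involution, hence an isometry, and e₀
+ K e₀ is fixed by K. If the sign of μ makes K e₀ future-directed, this vector is time-like, and the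
boost carrying e₀ to its normalisation is the required frame. -/
theorem exists_boost_eigenvector {P : Mat4} (hP : Pᵀ = P) {c : ℝ} (hsq : mul eta P P = c • eta)
    (hc : c ≠ 0) : ∃ (L : Mat4) (μ : ℝ), cong L eta = eta ∧ μ ^ 2 = c ∧
      ∀ i, cong L P i 0 = μ * eta i 0 := by
  have hc' := pos_of_square_eq hP hsq hc
  obtain ⟨μ, hμ, hμP⟩ : ∃ μ : ℝ, μ ^ 2 = c ∧ P 0 0 / μ ≤ 0 := by
    rcases le_total (P 0 0) 0 with h | h
    · exact ⟨Real.sqrt c, Real.sq_sqrt hc'.le, div_nonpos_of_nonpos_of_nonneg h (Real.sqrt_nonneg c)⟩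
    · refine ⟨-Real.sqrt c, by rw [neg_sq, Real.sq_sqrt hc'.le], ?_⟩
      exact div_nonpos_of_nonneg_of_nonpos h (neg_nonpos.2 (Real.sqrt_nonneg c))
  have hμ0 : μ ≠ 0 := by rintro rfl; apply hc; rw [← hμ]; ring
  obtain ⟨q, hq⟩ : ∃ q : Fin 4 → ℝ, ∀ i, P i 0 = μ * q i :=
    ⟨fun i => P i 0 / μ, fun i => by field_simp⟩
  have hq0 : q 0 ≤ 0 := by rwa [hq, mul_div_cancel_left₀ _ hμ0] at hμP
  have hs : ∀ i j, P i j = P j i := fun i j => congrFun (congrFun hP j) i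
  have h := fun i => congrFun (congrFun hsq i) 0
  simp only [mul_eta_apply, Matrix.smul_apply, smul_eq_mul, ← hμ] at h
  have hw : ∀ i, -(P i 0 * q 0) + P i 1 * q 1 + P i 2 * q 2 + P i 3 * q 3 = μ * eta i 0 := by
    intro i
    have h1 := h i
    rw [hq 0, hq 1, hq 2, hq 3] at h1
    apply mul_left_cancel₀ hμ0
    linear_combination h1
  have hn : -(q 0) ^ 2 + q 1 ^ 2 + q 2 ^ 2 + q 3 ^ 2 = -1 := by
    -- `hn` says that K e₀ = (-q₀, q₁, q₂, q₃) is a unit time-like vector.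
    have h1 := hw 0
    rw [hs 0 1, hs 0 2, hs 0 3, hq 0, hq 1, hq 2, hq 3] at h1
    simp [eta] at h1
    apply mul_left_cancel₀ hμ0
    linear_combination h1
  -- The vector e₀ + K e₀ is (k, q₁, q₂, q₃), of squared norm -2k; hence the normalising factor r =
  -- √(2k). The choice of sign q₀ ≤ 0 makes k positive.
  set k := 1 - q 0 with hk
  have hk1 : 0 < k := by linarith
  set r := Real.sqrt (2 * k) with hr
  have hr2 : r ^ 2 = 2 * k := Real.sq_sqrt (by positivity)
  have hr0 : 0 < r := Real.sqrt_pos.2 (by positivity)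
  have hL := cong_boost (t := k / r) (x := q 1 / r) (y := q 2 / r) (z := q 3 / r)
    (by positivity) (by field_simp; rw [hr2, hk]; linear_combination -hn)
  refine ⟨_, μ, hL, hμ, fun i => ?_⟩
  set L := boost (k / r) (q 1 / r) (q 2 / r) (q 3 / r) with hLdef
  have hPL : ∀ j, (P * L) j 0 = μ * (eta * L) j 0 := by
    intro j
    have h1 := hw j
    have hqj := hq j
    simp only [Matrix.mul_apply, Fin.sum_univ_four]
    rw [show L 0 0 = k / r from rfl, show L 1 0 = q 1 / r from rfl,
      show L 2 0 = q 2 / r from rfl, show L 3 0 = q 3 / r from rfl]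
    have h2 : P j 0 * k + P j 1 * q 1 + P j 2 * q 2 + P j 3 * q 3 =
        μ * (eta j 0 * k + eta j 1 * q 1 + eta j 2 * q 2 + eta j 3 * q 3) := by
      have : q j + eta j 0 = eta j 0 * k + eta j 1 * q 1 + eta j 2 * q 2 + eta j 3 * q 3 := by
        rw [hk]
        fin_cases j <;> simp [eta]
        ring
      rw [← this, hk]
      linear_combination h1 + hqj
    field_simp
    linear_combination h2
  calc cong L P i 0 = (Lᵀ * (P * L)) i 0 := by rw [cong, Matrix.mul_assoc]
    _ = μ * (Lᵀ * (eta * L)) i 0 := by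
      simp only [Matrix.mul_apply (M := Lᵀ), hPL, Finset.mul_sum]
      exact Finset.sum_congr rfl fun _ _ => by ring
    _ = μ * eta i 0 := by rw [← Matrix.mul_assoc]; exact congrArg (fun M : Mat4 => μ * M i 0) hL

/-- After the boost, P splits into -μ and a symmetric 3×3 block with square μ² and, since P is
traceless, trace -μ. A spatial rotation or reflection diagonalises the block without disturbing the
metric. -/
theorem exists_lorentz_frame {P : Mat4} (hP : Pᵀ = P) (htr : tr eta P = 0) {c : ℝ}
    (hsq : mul eta P P = c • eta) (hc : c ≠ 0) :
    ∃ (L : Mat4) (s : ℝ), cong L eta = eta ∧ cong L P = squareForm s ∧ s ≠ 0 := by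
  obtain ⟨L, μ, hL, hμ, hcol⟩ := exists_boost_eigenvector hP hsq hc
  have hμ0 : μ ≠ 0 := by rintro rfl; apply hc; rw [← hμ]; ring
  have hLdet : IsUnit L.det := by
    have h := congrArg Matrix.det hL
    rw [det_cong, det_eta] at h
    refine isUnit_iff_ne_zero.2 fun h0 => ?_
    rw [h0] at h; norm_num at h
  set P' := cong L P with hP'
  have hs : ∀ i j, P' i j = P' j i := by
    intro i j
    have : P'ᵀ = P' := by rw [hP', cong_transpose, hP]
    exact congrFun (congrFun this j) i
  have hz : ∀ i : Fin 3, eta i.succ 0 = 0 := fun i => by fin_cases i <;> simp [eta]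
  have hblock : P' = block (-μ) (Matrix.of fun i j => P' i.succ j.succ) := by
    ext i j
    refine Fin.cases ?_ (fun i => ?_) i <;> refine Fin.cases ?_ (fun j => ?_) j
    · rw [hcol]; simp [block, eta]
    · rw [hs, hcol, hz, mul_zero]; rfl
    · rw [hcol, hz, mul_zero]; rfl
    · simp [block]
  set S : Matrix (Fin 3) (Fin 3) ℝ := Matrix.of fun i j => P' i.succ j.succ with hS
  have hsq' : mul eta P' P' = c • eta := by
    have := mul_cong hLdet eta P P
    rw [hL, hsq, cong_smul, hL] at this
    exact this
  have htr' : tr eta P' = 0 := by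
    have := tr_cong hLdet eta P
    rwa [hL, htr] at this
  have hSS : S * S = (μ ^ 2) • (1 : Matrix (Fin 3) (Fin 3) ℝ) := by
    rw [mul, eta_inv, hblock, ← block_eta, block_mul, block_mul] at hsq'
    ext i j
    have := congrFun (congrFun hsq' i.succ) j.succ
    simpa [block, hμ] using this
  have hStr : S.trace = -μ := by
    rw [tr, eta_inv, hblock, ← block_eta, block_mul] at htr'
    simp [Matrix.trace, block, Fin.sum_univ_succ] at htr'
    simp only [Matrix.trace, Matrix.diag, Fin.sum_univ_succ]
    simp
    linarith
  obtain ⟨U, hU, hUS⟩ := exists_orthogonal_diagonal (S := S)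
    (by ext i j; exact hs _ _) hμ0 hSS hStr
  have h1 : ∀ r T, cong (block 1 U) (block r T) = block r (Uᵀ * T * U) := by
    intro r T
    rw [cong, block_transpose, block_mul, block_mul, one_mul, mul_one]
  refine ⟨L * block 1 U, μ, ?_, ?_, hμ0⟩
  · rw [← cong_cong, hL, ← block_eta, h1, mul_one, hU]
  · rw [← cong_cong, ← hP', hblock, h1, hUS, block_squareForm]

/-- `G` is a Lorentzian scalar product of signature `(-+++)`. -/
def IsLorentz (G : Mat4) : Prop := ∃ J : Mat4, cong J G = eta

theorem det_ne_zero_of_cong_eq_eta {J G : Mat4} (h : cong J G = eta) : J.det ≠ 0 := by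
  intro h0
  have h1 := congrArg Matrix.det h
  rw [det_cong, det_eta, h0] at h1
  norm_num at h1

theorem IsLorentz.cong {G J : Mat4} (h : IsLorentz G) (hJ : IsUnit J.det) :
    IsLorentz (cong J G) := by
  obtain ⟨L, hL⟩ := h
  refine ⟨J⁻¹ * L, ?_⟩
  rw [cong_cong, ← Matrix.mul_assoc, Matrix.mul_nonsing_inv _ hJ, one_mul, hL]

theorem IsLorentz.det_neg {G : Mat4} (h : IsLorentz G) : G.det < 0 := by
  obtain ⟨J, hJ⟩ := h
  have h0 := det_ne_zero_of_cong_eq_eta hJ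
  have h1 := congrArg Matrix.det hJ
  rw [det_cong, det_eta] at h1
  have : 0 < J.det ^ 2 := by positivity
  nlinarith

theorem IsLorentz.symm {G : Mat4} (h : IsLorentz G) : Gᵀ = G := by
  obtain ⟨J, hJ⟩ := h
  refine cong_injective (det_ne_zero_of_cong_eq_eta hJ).isUnit ?_
  rw [← cong_transpose, hJ, eta_transpose]

theorem exists_adapted_frame {G P : Mat4} (hG : IsLorentz G) (hP : Pᵀ = P) (htr : tr G P = 0)
    {c : ℝ} (hsq : mul G P P = c • G) (hc : c ≠ 0) :
    ∃ (J : Mat4) (s : ℝ), 0 < J.det ∧ cong J G = eta ∧ cong J P = squareForm s ∧ s ≠ 0 := by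
  obtain ⟨J₀, hJ₀⟩ := hG
  have hu := (det_ne_zero_of_cong_eq_eta hJ₀).isUnit
  obtain ⟨L, s, hL, hLP, hs⟩ := exists_lorentz_frame (P := cong J₀ P) (c := c)
    (by rw [cong_transpose, hP]) (by rw [← hJ₀, tr_cong hu, htr])
    (by rw [← hJ₀, mul_cong hu, hsq, cong_smul]) hc
  have hJ : cong (J₀ * L) G = eta := by rw [← cong_cong, hJ₀, hL]
  have hJP : cong (J₀ * L) P = squareForm s := by rw [← cong_cong, hLP]
  -- Reversing the last frame vector corrects the orientation and preserves both diagonal forms.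
  rcases lt_or_gt_of_ne (det_ne_zero_of_cong_eq_eta hJ) with h | h
  · refine ⟨J₀ * L * Matrix.diagonal ![1, 1, 1, -1], s, ?_, ?_, ?_, hs⟩
    · rw [Matrix.det_mul, Matrix.det_diagonal]
      simp [Fin.prod_univ_four]
      simpa using h
    · rw [← cong_cong, hJ]
      ext i j
      fin_cases i <;> fin_cases j <;> simp [cong, eta]
    · rw [← cong_cong, hJP]
      ext i j
      fin_cases i <;> fin_cases j <;> simp [cong, squareForm]
  · exact ⟨J₀ * L, s, h, hJ, hJP, hs⟩

/-! ### Pointwise theory of regular 2-forms -/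

/-- The two scalar invariants of `A` do not vanish simultaneously. -/
def Regular (G A : Mat4) : Prop :=
  ¬ (form2Inner G A A = 0 ∧ form2Inner G A (hodge G A) = 0)

theorem eq_skewMat_of_transpose {A : Mat4} (hA : Aᵀ = -A) :
    A = skewMat (A 0 1) (A 0 2) (A 0 3) (A 1 2) (A 1 3) (A 2 3) :=
  eq_skewMat fun i j => by
    have := congrFun (congrFun hA j) i
    simpa using this

theorem skewMat_transpose (a b c d e f : ℝ) :
    (skewMat a b c d e f)ᵀ = -skewMat a b c d e f := by
  ext i j
  fin_cases i <;> fin_cases j <;> simp [skewMat]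

theorem smul_skewMat (r a b c d e f : ℝ) :
    r • skewMat a b c d e f = skewMat (r * a) (r * b) (r * c) (r * d) (r * e) (r * f) := by
  ext i j
  fin_cases i <;> fin_cases j <;> simp [skewMat]

theorem add_skewMat (a b c d e f a' b' c' d' e' f' : ℝ) :
    skewMat a b c d e f + skewMat a' b' c' d' e' f' =
      skewMat (a + a') (b + b') (c + c') (d + d') (e + e') (f + f') := by
  ext i j
  fin_cases i <;> fin_cases j <;> simp [skewMat] <;> ring

theorem sub_skewMat (a b c d e f a' b' c' d' e' f' : ℝ) :
    skewMat a b c d e f - skewMat a' b' c' d' e' f' =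
      skewMat (a - a') (b - b') (c - c') (d - d') (e - e') (f - f') := by
  ext i j
  fin_cases i <;> fin_cases j <;> simp [skewMat] <;> ring

theorem tracelessSquare_eta_skewMat (a b c d e f : ℝ) :
    tracelessSquare eta (skewMat a b c d e f) =
      !![-(a ^ 2 + b ^ 2 + c ^ 2 + d ^ 2 + e ^ 2 + f ^ 2) / 2, -(b * d) - c * e, a * d - c * f,
          a * e + b * f;
        -(b * d) - c * e, (a ^ 2 - b ^ 2 - c ^ 2 - d ^ 2 - e ^ 2 + f ^ 2) / 2, a * b - e * f,
          a * c + d * f;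
        a * d - c * f, a * b - e * f, (b ^ 2 - a ^ 2 - c ^ 2 - d ^ 2 - f ^ 2 + e ^ 2) / 2,
          b * c - d * e;
        a * e + b * f, a * c + d * f, b * c - d * e,
          (c ^ 2 - a ^ 2 - b ^ 2 - e ^ 2 - f ^ 2 + d ^ 2) / 2] := by
  rw [tracelessSquare, tr_eta]
  ext i j
  simp only [Matrix.sub_apply, Matrix.smul_apply, mul_eta_apply]
  fin_cases i <;> fin_cases j <;> simp [skewMat, eta] <;> ring

/-- The Rainich identity: the traceless square squares to (u² + v²)/4 times the metric. Regularity
of A is thus exactly what makes this factor nonzero. -/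
theorem mul_tracelessSquare_eta_skewMat (a b c d e f : ℝ) :
    mul eta (tracelessSquare eta (skewMat a b c d e f))
        (tracelessSquare eta (skewMat a b c d e f)) =
      (((-a ^ 2 - b ^ 2 - c ^ 2 + d ^ 2 + e ^ 2 + f ^ 2) ^ 2 +
        (2 * (a * f - b * e + c * d)) ^ 2) / 4) • eta := by
  rw [tracelessSquare_eta_skewMat]
  ext i j
  rw [mul_eta_apply]
  fin_cases i <;> fin_cases j <;> simp [eta] <;> ring

theorem tr_tracelessSquare {G : Mat4} (hG : IsLorentz G) (A : Mat4) :
    tr G (tracelessSquare G A) = 0 := by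
  obtain ⟨J, hJ⟩ := hG
  have hu := (det_ne_zero_of_cong_eq_eta hJ).isUnit
  rw [← tr_cong hu, ← tracelessSquare_cong hu, hJ, tracelessSquare, tr_eta]
  simp only [Matrix.sub_apply, Matrix.smul_apply, tr_eta, smul_eq_mul]
  simp [eta]
  ring

theorem tracelessSquare_transpose {G A : Mat4} (hG : Gᵀ = G) (hA : Aᵀ = -A) :
    (tracelessSquare G A)ᵀ = tracelessSquare G A := by
  simp [tracelessSquare, mul, Matrix.transpose_nonsing_inv, hG, hA, Matrix.mul_assoc]

theorem IsLorentz.exists_frame {G : Mat4} (hG : IsLorentz G) :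
    ∃ J : Mat4, 0 < J.det ∧ CKY.cong J G = eta := by
  obtain ⟨J, hJ⟩ := hG
  rcases lt_or_gt_of_ne (det_ne_zero_of_cong_eq_eta hJ) with h | h
  · refine ⟨J * Matrix.diagonal ![1, 1, 1, -1], ?_, ?_⟩
    · rw [Matrix.det_mul, Matrix.det_diagonal]
      simp [Fin.prod_univ_four]
      simpa using h
    · rw [← cong_cong, hJ]
      ext i j
      fin_cases i <;> fin_cases j <;> simp [CKY.cong, eta]
  · exact ⟨J, h, hJ⟩

/-- A commutes with its traceless square, so in a frame diagonalising the latter it preserves both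
eigenplanes. Its mixed components therefore vanish, leaving only the 01 and 23 components. -/
theorem exists_form_frame {G A : Mat4} (hG : IsLorentz G) (hA : Aᵀ = -A) (hreg : Regular G A) :
    ∃ (J : Mat4) (α β : ℝ), 0 < J.det ∧ cong J G = eta ∧ cong J A = skewMat α 0 0 0 0 β ∧
      α ^ 2 + β ^ 2 ≠ 0 := by
  obtain ⟨c, hc, hsq⟩ : ∃ c : ℝ, c ≠ 0 ∧
      mul G (tracelessSquare G A) (tracelessSquare G A) = c • G := by
    obtain ⟨J, hJ0, hJ⟩ := hG.exists_frame
    have hu := hJ0.ne'.isUnit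
    have hs := eq_skewMat_of_transpose (A := cong J A) (by rw [cong_transpose, hA, cong_neg])
    have h := mul_tracelessSquare_eta_skewMat (cong J A 0 1) (cong J A 0 2) (cong J A 0 3)
      (cong J A 1 2) (cong J A 1 3) (cong J A 2 3)
    rw [← hs, ← hJ, tracelessSquare_cong hu, mul_cong hu, ← cong_smul] at h
    refine ⟨_, fun h0 => hreg ?_, cong_injective hu h⟩
    have h1 : -(cong J A 0 1) ^ 2 - cong J A 0 2 ^ 2 - cong J A 0 3 ^ 2 + cong J A 1 2 ^ 2 +
        cong J A 1 3 ^ 2 + cong J A 2 3 ^ 2 = 0 := by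
      nlinarith [sq_nonneg (2 * (cong J A 0 1 * cong J A 2 3 - cong J A 0 2 * cong J A 1 3 +
        cong J A 0 3 * cong J A 1 2)), sq_nonneg (-(cong J A 0 1) ^ 2 - cong J A 0 2 ^ 2 -
        cong J A 0 3 ^ 2 + cong J A 1 2 ^ 2 + cong J A 1 3 ^ 2 + cong J A 2 3 ^ 2)]
    have h2 : 2 * (cong J A 0 1 * cong J A 2 3 - cong J A 0 2 * cong J A 1 3 +
        cong J A 0 3 * cong J A 1 2) = 0 := by
      rw [h1] at h0
      nlinarith
    rw [← form2Inner_cong hu, ← form2Inner_cong hu G A (hodge G A), ← hodge_cong hJ0, hJ, hs,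
      hodge_eta_skewMat, form2Inner_eta_skewMat, form2Inner_eta_skewMat]
    exact ⟨by linear_combination h1, by linear_combination -h2⟩
  obtain ⟨J, s, hJ, hJG, hJP, hs⟩ := exists_adapted_frame hG
    (tracelessSquare_transpose hG.symm hA) (tr_tracelessSquare hG A) hsq hc
  have hu := hJ.ne'.isUnit
  -- The traceless square is a polynomial in A.
  have hcomm : mul G A (tracelessSquare G A) = mul G (tracelessSquare G A) A := by
    have h1 : G⁻¹ * G = 1 := Matrix.nonsing_inv_mul _ hG.det_neg.ne.isUnit
    have h2 : G * G⁻¹ = 1 := Matrix.mul_nonsing_inv _ hG.det_neg.ne.isUnit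
    simp only [tracelessSquare, mul, Matrix.mul_sub, Matrix.sub_mul, Matrix.mul_smul,
      Matrix.smul_mul, Matrix.mul_assoc, h1, Matrix.mul_one]
    rw [← Matrix.mul_assoc G, h2, Matrix.one_mul]
  have hcomm' := congrArg (cong J) hcomm
  rw [← mul_cong hu, ← mul_cong hu, hJG, hJP] at hcomm'
  have hS := eq_skewMat_of_transpose (A := cong J A) (by rw [cong_transpose, hA, cong_neg])
  have h := fun i j => congrFun (congrFun hcomm' i) j
  rw [hS] at h
  simp only [mul_eta_apply] at h
  have h02 := h 0 2
  have h03 := h 0 3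
  have h12 := h 1 2
  have h13 := h 1 3
  simp [squareForm, skewMat] at h02 h03 h12 h13
  have k02 : cong J A 0 2 = 0 := by apply mul_left_cancel₀ hs; linarith
  have k03 : cong J A 0 3 = 0 := by apply mul_left_cancel₀ hs; linarith
  have k12 : cong J A 1 2 = 0 := by apply mul_left_cancel₀ hs; linarith
  have k13 : cong J A 1 3 = 0 := by apply mul_left_cancel₀ hs; linarith
  rw [k02, k03, k12, k13] at hS
  refine ⟨J, _, _, hJ, hJG, hS, fun h0 => hs ?_⟩
  rw [← tracelessSquare_cong hu, hJG, hS, tracelessSquare_eta, h0] at hJP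
  have := congrFun (congrFun hJP 1) 1
  simpa [squareForm] using this.symm

theorem forall_sum_mul_eq_iff {J : Mat4} (hJ : J.det ≠ 0) (p q : Fin 4 → ℝ) :
    (∀ d, ∑ l, J l d * p l = ∑ l, J l d * q l) ↔ ∀ l, p l = q l := by
  constructor
  · intro h l
    have h1 : Jᵀ *ᵥ (p - q) = 0 := by
      funext d
      simp only [Matrix.mulVec, dotProduct, Matrix.transpose_apply, Pi.sub_apply, mul_sub,
        Finset.sum_sub_distrib, h d, sub_self, Pi.zero_apply]
    have h2 := Matrix.eq_zero_of_mulVec_eq_zero (by rwa [Matrix.det_transpose]) h1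
    exact sub_eq_zero.1 (congrFun h2 l)
  · intro h d
    simp only [h]

/-- At a point, a regular 2-form satisfies the conformal Killing-Yano equation if and only if its
traceless square satisfies the conformal Killing equation and has as Rainich form the differential
of the angle of the invariants. -/
theorem ckyTensor_eq_zero_iff {G A : Mat4} (hG : IsLorentz G) (hA : Aᵀ = -A)
    (hreg : Regular G A) {D : Fin 4 → Mat4} (hD : ∀ c, (D c)ᵀ = -D c) :
    ckyTensor G D = 0 ↔ ckTensor G (fun c => tracelessSquareDeriv G A (D c)) = 0 ∧
      ∀ l, rainichForm G (tracelessSquare G A) (fun c => tracelessSquareDeriv G A (D c)) l =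
        angleForm G A D l := by
  obtain ⟨J, α, β, hJ, hJG, hJA, hαβ⟩ := exists_form_frame hG hA hreg
  have hu := hJ.ne'.isUnit
  have hD' : ∀ c, (pull J D c)ᵀ = -pull J D c := by
    intro c
    simp only [pull, Matrix.transpose_sum, Matrix.transpose_smul, cong_transpose, hD, cong_neg,
      smul_neg, Finset.sum_neg_distrib]
  rw [← pull_eq_zero hu, ← ckyTensor_pull hu, ← pull_eq_zero hu (D := ckTensor _ _),
    ← ckTensor_pull hu, ← forall_sum_mul_eq_iff hJ.ne']
  simp only [← rainichForm_pull hJ, ← angleForm_pull hJ, ← tracelessSquareDeriv_pull hu,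
    ← tracelessSquare_cong hu, hJG, hJA, tracelessSquare_eta]
  have hS : pull J D = fun i => skewMat (pull J D i 0 1) (pull J D i 0 2) (pull J D i 0 3)
      (pull J D i 1 2) (pull J D i 1 3) (pull J D i 2 3) := by
    funext i
    exact eq_skewMat_of_transpose (hD' i)
  rw [hS]
  exact core_eta α β hαβ _ _ _ _ _ _

/-- The algebraic conditions at a point. -/
structure AlgebraicAt (G P : Mat4) : Prop where
  trace : tr G P = 0
  square : (4 : ℝ) • mul G P P = tr G (mul G P P) • G
  square_ne : tr G (mul G P P) ≠ 0
  timelike : ∀ v : Fin 4 → ℝ, v ⬝ᵥ G *ᵥ v < 0 → v ⬝ᵥ P *ᵥ v < 0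

theorem dotProduct_cong (J T : Mat4) (v : Fin 4 → ℝ) :
    v ⬝ᵥ cong J T *ᵥ v = (J *ᵥ v) ⬝ᵥ T *ᵥ (J *ᵥ v) := by
  rw [cong, ← Matrix.mulVec_mulVec, ← Matrix.mulVec_mulVec, Matrix.dotProduct_mulVec,
    Matrix.vecMul_transpose]

theorem dotProduct_eta (v : Fin 4 → ℝ) :
    v ⬝ᵥ eta *ᵥ v = -v 0 ^ 2 + v 1 ^ 2 + v 2 ^ 2 + v 3 ^ 2 := by
  simp [dotProduct, Matrix.mulVec, Fin.sum_univ_four, eta]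
  ring

theorem dotProduct_squareForm (s : ℝ) (v : Fin 4 → ℝ) :
    v ⬝ᵥ squareForm s *ᵥ v = s * (-v 0 ^ 2 + v 1 ^ 2 - v 2 ^ 2 - v 3 ^ 2) := by
  simp [dotProduct, Matrix.mulVec, Fin.sum_univ_four, squareForm]
  ring

theorem mul_eta_squareForm (s : ℝ) :
    mul eta (squareForm s) (squareForm s) = (s ^ 2) • eta := by
  ext i j
  rw [mul_eta_apply]
  fin_cases i <;> fin_cases j <;> simp [eta, squareForm] <;> ring

/-- In the adapted frame s = (α² + β²)/2 > 0, and P(v, v) ≤ s g(v, v) because the two differ by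
-2s(v₂² + v₃²). -/
theorem algebraicAt_tracelessSquare {G A : Mat4} (hG : IsLorentz G) (hA : Aᵀ = -A)
    (hreg : Regular G A) : AlgebraicAt G (tracelessSquare G A) := by
  obtain ⟨J, α, β, hJ, hJG, hJA, hαβ⟩ := exists_form_frame hG hA hreg
  have hu := hJ.ne'.isUnit
  have hP : cong J (tracelessSquare G A) = squareForm ((α ^ 2 + β ^ 2) / 2) := by
    rw [← tracelessSquare_cong hu, hJG, hJA, tracelessSquare_eta]
  have hs : 0 < (α ^ 2 + β ^ 2) / 2 :=
    div_pos (lt_of_le_of_ne (by positivity) hαβ.symm) two_pos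
  have htr : tr G (mul G (tracelessSquare G A) (tracelessSquare G A)) =
      4 * ((α ^ 2 + β ^ 2) / 2) ^ 2 := by
    rw [← tr_cong hu, ← mul_cong hu, hP, hJG, tr_eta_squareForm]
  refine ⟨tr_tracelessSquare hG A, ?_, ?_, ?_⟩
  · apply cong_injective hu
    rw [htr, cong_smul, cong_smul, ← mul_cong hu, hP, hJG, mul_eta_squareForm, smul_smul]
  · rw [htr]; positivity
  · intro v hv
    have hv' : v = J *ᵥ (J⁻¹ *ᵥ v) := by
      rw [Matrix.mulVec_mulVec, Matrix.mul_nonsing_inv _ hu, Matrix.one_mulVec]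
    rw [hv', ← dotProduct_cong] at hv ⊢
    rw [hJG, dotProduct_eta] at hv
    rw [hP, dotProduct_squareForm]
    generalize J⁻¹ *ᵥ v = w at hv ⊢
    refine mul_neg_of_pos_of_neg hs ?_
    nlinarith [sq_nonneg (w 2), sq_nonneg (w 3)]

/-- The time-like condition is needed only at the first frame vector: there P takes the value -s,
which fixes the sign of s. -/
theorem AlgebraicAt.exists_frame {G P : Mat4} (h : AlgebraicAt G P) (hG : IsLorentz G)
    (hP : Pᵀ = P) : ∃ (J : Mat4) (s : ℝ), 0 < J.det ∧ cong J G = eta ∧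
      cong J P = squareForm s ∧ 0 < s := by
  obtain ⟨J, s, hJ, hJG, hJP, hs⟩ := exists_adapted_frame hG hP h.trace
    (c := tr G (mul G P P) / 4)
    (by rw [div_eq_inv_mul, mul_smul, ← h.square, smul_smul]; norm_num)
    (div_ne_zero h.square_ne four_ne_zero)
  refine ⟨J, s, hJ, hJG, hJP, ?_⟩
  have := h.timelike (J *ᵥ Pi.single 0 1)
  rw [← dotProduct_cong, ← dotProduct_cong, hJG, hJP, dotProduct_eta, dotProduct_squareForm] at this
  simp at this
  exact this

theorem AlgebraicAt.tr_pos {G P : Mat4} (h : AlgebraicAt G P) (hG : IsLorentz G)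
    (hP : Pᵀ = P) : 0 < tr G (mul G P P) := by
  obtain ⟨J, s, hJ, hJG, hJP, hs⟩ := h.exists_frame hG hP
  have hu := hJ.ne'.isUnit
  rw [← tr_cong hu, ← mul_cong hu, hJG, hJP, tr_eta_squareForm]
  positivity

theorem doubleWedgeEnd_eta (s a b c d e f : ℝ) :
    doubleWedgeEnd eta (-squareForm s) (skewMat a b c d e f) =
      skewMat (-(2 * s * a)) 0 0 0 0 (2 * s * f) := by
  rw [doubleWedgeEnd_eq, raise_eta_skewMat]
  have h1 : (squareForm s)ᵀ = squareForm s := by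
    ext i j
    fin_cases i <;> fin_cases j <;> simp [squareForm]
  rw [Matrix.transpose_neg, h1, eta_transpose, skewMat_transpose]
  ext i j
  simp only [Matrix.smul_apply, Matrix.sub_apply, Matrix.add_apply, Matrix.neg_apply,
    Matrix.mul_apply, Fin.sum_univ_four]
  fin_cases i <;> fin_cases j <;> simp [eta, squareForm, skewMat] <;> ring

/-- On 2-forms, -P∧g has eigenvalue -2s on e⁰∧e¹, 2s on e²∧e³ and 0 on the mixed ones, and √(tr P²)
= 2s. The polynomial x - x²/(2s) kills 2s and 0 and sends -2s to -4s, so Q projects onto e⁰∧e¹. -/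
theorem Q_eta {s : ℝ} (hs : 0 < s) (a b c d e f : ℝ) :
    Q eta (-squareForm s) (skewMat a b c d e f) = skewMat (-(4 * s * a)) 0 0 0 0 0 := by
  have h : tr eta (mul eta (-squareForm s) (-squareForm s)) = (2 * s) ^ 2 := by
    have : mul eta (-squareForm s) (-squareForm s) = mul eta (squareForm s) (squareForm s) := by
      simp [mul]
    rw [this, tr_eta_squareForm]; ring
  rw [Q, h, Real.sqrt_sq (by positivity), doubleWedgeEnd_eta, doubleWedgeEnd_eta, smul_skewMat,
    sub_skewMat]
  congr 1 <;> field_simp <;> ring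

/-- The sign is positive because e⁰∧e¹ has negative square norm; so nonvanishing of Q(X, X) is the
same as positivity. -/
theorem QQ_eta {s : ℝ} (hs : 0 < s) (a b c d e f : ℝ) :
    QQ eta (-squareForm s) (skewMat a b c d e f) = 4 * s * a ^ 2 := by
  rw [QQ, Q_eta hs, form2Inner_eta_skewMat]
  ring

/-- The properties of `cos ψ A° + sin ψ *A°` at a point. -/
theorem AlgebraicAt.rotated {G P X : Mat4} (h : AlgebraicAt G P) (hG : IsLorentz G)
    (hP : Pᵀ = P) (hX : Xᵀ = -X) (hQ : QQ G (-P) X ≠ 0) (ψ : ℝ) :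
    0 < QQ G (-P) X ∧ (CKY.rotated G (-P) X ψ)ᵀ = -CKY.rotated G (-P) X ψ ∧
    tracelessSquare G (CKY.rotated G (-P) X ψ) = P ∧
    form2Inner G (CKY.rotated G (-P) X ψ) (CKY.rotated G (-P) X ψ) =
      -Real.sqrt (tr G (mul G P P)) * Real.cos (2 * ψ) ∧
    form2Inner G (CKY.rotated G (-P) X ψ) (hodge G (CKY.rotated G (-P) X ψ)) =
      Real.sqrt (tr G (mul G P P)) * Real.sin (2 * ψ) := by
  obtain ⟨J, s, hJ, hJG, hJP, hs⟩ := h.exists_frame hG hP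
  have hu := hJ.ne'.isUnit
  obtain ⟨x, b, c, d, e, f, hXs⟩ : ∃ x b c d e f, cong J X = skewMat x b c d e f :=
    ⟨_, _, _, _, _, _, eq_skewMat_of_transpose (by rw [cong_transpose, hX, cong_neg])⟩
  have hq : QQ G (-P) X = 4 * s * x ^ 2 := by
    rw [← QQ_cong hu, hJG, cong_neg, hJP, hXs, QQ_eta hs]
  have hq0 : 0 < QQ G (-P) X := by
    refine lt_of_le_of_ne ?_ hQ.symm
    rw [hq]; positivity
  have htr : Real.sqrt (tr G (mul G P P)) = 2 * s := by
    rw [← tr_cong hu, ← mul_cong hu, hJG, hJP, tr_eta_squareForm,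
      show 4 * s ^ 2 = (2 * s) ^ 2 by ring, Real.sqrt_sq (by positivity)]
  -- A° = α e⁰∧e¹ and *A° = -α e²∧e³. Dividing by √(2 Q(X, X)) gives α² = 16s²x²/(8sx²) = 2s,
  -- independent of X.
  obtain ⟨α, hα, hr⟩ : ∃ α : ℝ, α ^ 2 = 2 * s ∧ cong J (CKY.rotated G (-P) X ψ) =
      skewMat (α * Real.cos ψ) 0 0 0 0 (-(α * Real.sin ψ)) := by
    refine ⟨-(4 * s * x) / Real.sqrt (2 * QQ G (-P) X), ?_, ?_⟩
    · rw [div_pow, Real.sq_sqrt (by positivity), hq]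
      have : x ≠ 0 := by
        intro h0; rw [hq, h0] at hq0; simp at hq0
      field_simp
      ring
    · rw [← rotated_cong hJ, CKY.rotated, simpleForm, QQ_cong hu, hJG, cong_neg, hJP, hXs, Q_eta hs,
        smul_skewMat, hodge_eta_skewMat, smul_skewMat, smul_skewMat, add_skewMat]
      congr 1 <;> ring
  have hcs := Real.sin_sq_add_cos_sq ψ
  refine ⟨hq0, ?_, ?_, ?_, ?_⟩
  · apply cong_injective hu
    rw [← cong_transpose, cong_neg, hr, skewMat_transpose]
  · apply cong_injective hu
    rw [← tracelessSquare_cong hu, hJG, hr, tracelessSquare_eta, hJP]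
    congr 1
    linear_combination (1 / 2) * (Real.sin ψ ^ 2 + Real.cos ψ ^ 2) * hα + s * hcs
  · rw [← form2Inner_cong hu, hJG, hr, form2Inner_eta_skewMat, htr, Real.cos_two_mul']
    linear_combination (Real.sin ψ ^ 2 - Real.cos ψ ^ 2) * hα
  · rw [← form2Inner_cong hu, ← hodge_cong hJ, hJG, hr, hodge_eta_skewMat, form2Inner_eta_skewMat,
      htr, Real.sin_two_mul]
    linear_combination 2 * Real.sin ψ * Real.cos ψ * hα

theorem AlgebraicAt.exists_QQ_ne_zero {G P : Mat4} (h : AlgebraicAt G P) (hG : IsLorentz G)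
    (hP : Pᵀ = P) : ∃ X : Mat4, Xᵀ = -X ∧ QQ G (-P) X ≠ 0 := by
  obtain ⟨J, s, hJ, hJG, hJP, hs⟩ := h.exists_frame hG hP
  have hu := hJ.ne'.isUnit
  refine ⟨cong J⁻¹ (skewMat 1 0 0 0 0 0), ?_, ?_⟩
  · rw [cong_transpose, skewMat_transpose, cong_neg]
  · rw [← QQ_cong hu, cong_cong, Matrix.nonsing_inv_mul _ hu, cong_one, hJG, cong_neg, hJP,
      QQ_eta hs]
    positivity

theorem regular_of_invariants {G A : Mat4} {r θ : ℝ} (hr : r ≠ 0)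
    (hu : form2Inner G A A = -r * Real.cos θ)
    (hv : form2Inner G A (hodge G A) = r * Real.sin θ) : Regular G A := by
  rintro ⟨h1, h2⟩
  rw [hu] at h1
  rw [hv] at h2
  have hc : Real.cos θ = 0 := by simpa [hr] using h1
  have hs : Real.sin θ = 0 := by simpa [hr] using h2
  have := Real.sin_sq_add_cos_sq θ
  rw [hc, hs] at this
  norm_num at this

open Filter Topology

/-! ### Partial derivatives -/

theorem differentiableAt_of_smooth {f : E4 → ℝ} {y : E4} (hf : ContDiffAt ℝ ∞ f y) :
    DifferentiableAt ℝ f y := hf.differentiableAt (by simp)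

theorem pd_congr {f h : E4 → ℝ} {y : E4} (hfh : f =ᶠ[𝓝 y] h) (c : Fin 4) :
    pd c f y = pd c h y := by
  rw [pd, pd, hfh.fderiv_eq]

theorem pd_const (c : Fin 4) (r : ℝ) (y : E4) : pd c (fun _ => r) y = 0 := by
  simp [pd]

theorem pd_add (c : Fin 4) {f h : E4 → ℝ} {y : E4} (hf : DifferentiableAt ℝ f y)
    (hh : DifferentiableAt ℝ h y) : pd c (fun z => f z + h z) y = pd c f y + pd c h y := by
  simp [pd, fderiv_fun_add hf hh]

theorem pd_neg (c : Fin 4) (f : E4 → ℝ) (y : E4) : pd c (fun z => -f z) y = -pd c f y := by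
  simp [pd, fderiv_fun_neg]

theorem pd_sub (c : Fin 4) {f h : E4 → ℝ} {y : E4} (hf : DifferentiableAt ℝ f y)
    (hh : DifferentiableAt ℝ h y) : pd c (fun z => f z - h z) y = pd c f y - pd c h y := by
  simp [pd, fderiv_fun_sub hf hh]

theorem pd_mul (c : Fin 4) {f h : E4 → ℝ} {y : E4} (hf : DifferentiableAt ℝ f y)
    (hh : DifferentiableAt ℝ h y) :
    pd c (fun z => f z * h z) y = pd c f y * h y + f y * pd c h y := by
  simp [pd, fderiv_fun_mul hf hh]
  ring

theorem pd_sum {ι : Type*} (s : Finset ι) (c : Fin 4) {f : ι → E4 → ℝ} {y : E4}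
    (hf : ∀ i ∈ s, DifferentiableAt ℝ (f i) y) :
    pd c (fun z => ∑ i ∈ s, f i z) y = ∑ i ∈ s, pd c (f i) y := by
  simp [pd, fderiv_fun_sum hf]

theorem pd_prod (c : Fin 4) {f : Fin 4 → E4 → ℝ} {y : E4}
    (hf : ∀ i, DifferentiableAt ℝ (f i) y) :
    pd c (fun z => ∏ i, f i z) y = ∑ i, (∏ j ∈ Finset.univ.erase i, f j y) * pd c (f i) y := by
  simp [pd, fderiv_finsetProd fun i _ => hf i]

theorem smooth_pd (c : Fin 4) {f : E4 → ℝ} {y : E4} (hf : ContDiffAt ℝ ∞ f y) :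
    ContDiffAt ℝ ∞ (pd c f) y :=
  (hf.fderiv_right (m := ∞) (by simp)).clm_apply contDiffAt_const

theorem pd_pd_comm (a b : Fin 4) {f : E4 → ℝ} {y : E4} (hf : ContDiffAt ℝ ∞ f y) :
    pd a (pd b f) y = pd b (pd a f) y := by
  have h1 : DifferentiableAt ℝ (fderiv ℝ f) y :=
    (hf.fderiv_right (m := ∞) (by simp)).differentiableAt (by simp)
  have h2 : IsSymmSndFDerivAt ℝ f y := hf.isSymmSndFDerivAt (by
    rw [minSmoothness_of_isRCLikeNormedField]; exact WithTop.coe_le_coe.2 le_top)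
  have h3 : ∀ a b, pd a (pd b f) y = fderiv ℝ (fderiv ℝ f) y (EuclideanSpace.single a 1)
      (EuclideanSpace.single b 1) := by
    intro a b
    have : pd b f = fun z => fderiv ℝ f z (EuclideanSpace.single b 1) := rfl
    rw [pd, this, fderiv_clm_apply h1 (differentiableAt_const _)]
    simp
  rw [h3, h3, h2]

theorem fderiv_eq_sum_pd (f : E4 → ℝ) (y v : E4) : fderiv ℝ f y v = ∑ i, v i * pd i f y := by
  have hv : v = ∑ i, v i • EuclideanSpace.single i (1 : ℝ) := by
    ext j
    simp [Finset.sum_apply, Pi.single_apply]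
  conv_lhs => rw [hv]
  simp [pd]

/-! ### Smooth matrix-valued functions -/

/-- The entries of `F` are smooth at `y`. -/
def SmoothMat (F : E4 → Mat4) (y : E4) : Prop :=
  ∀ i j, ContDiffAt ℝ ∞ (fun z => F z i j) y

namespace SmoothMat

variable {F H : E4 → Mat4} {y : E4}

theorem diff (hF : SmoothMat F y) (i j : Fin 4) : DifferentiableAt ℝ (fun z => F z i j) y :=
  differentiableAt_of_smooth (hF i j)

theorem congr (hF : SmoothMat F y) (h : H =ᶠ[𝓝 y] F) : SmoothMat H y := fun i j =>
  (hF i j).congr_of_eventuallyEq (h.mono fun z hz => by simp only [hz])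

theorem const (M : Mat4) : SmoothMat (fun _ => M) y := fun _ _ => contDiffAt_const

theorem add (hF : SmoothMat F y) (hH : SmoothMat H y) : SmoothMat (fun z => F z + H z) y :=
  fun i j => (hF i j).add (hH i j)

theorem neg (hF : SmoothMat F y) : SmoothMat (fun z => -F z) y :=
  fun i j => (hF i j).neg

theorem sub (hF : SmoothMat F y) (hH : SmoothMat H y) : SmoothMat (fun z => F z - H z) y :=
  fun i j => (hF i j).sub (hH i j)

theorem smul {f : E4 → ℝ} (hf : ContDiffAt ℝ ∞ f y) (hH : SmoothMat H y) :
    SmoothMat (fun z => f z • H z) y :=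
  fun i j => hf.mul (hH i j)

theorem transpose (hF : SmoothMat F y) : SmoothMat (fun z => (F z)ᵀ) y :=
  fun i j => hF j i

theorem mul (hF : SmoothMat F y) (hH : SmoothMat H y) : SmoothMat (fun z => F z * H z) y := by
  intro i j
  simp only [Matrix.mul_apply]
  exact ContDiffAt.sum fun k _ => (hF i k).mul (hH k j)

theorem trace (hF : SmoothMat F y) : ContDiffAt ℝ ∞ (fun z => (F z).trace) y := by
  simp only [Matrix.trace, Matrix.diag]
  exact ContDiffAt.sum fun k _ => hF k k

theorem det (hF : SmoothMat F y) : ContDiffAt ℝ ∞ (fun z => (F z).det) y := by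
  simp only [Matrix.det_apply']
  exact ContDiffAt.sum fun σ _ => contDiffAt_const.mul (contDiffAt_prod fun i _ => hF _ _)

theorem inv (hF : SmoothMat F y) (h0 : (F y).det ≠ 0) : SmoothMat (fun z => (F z)⁻¹) y := by
  intro i j
  simp only [Matrix.inv_def, Ring.inverse_eq_inv', Matrix.smul_apply, smul_eq_mul,
    Matrix.adjugate_apply]
  refine (hF.det.inv h0).mul (SmoothMat.det (F := fun z => (F z).updateRow j (Pi.single i 1)) ?_)
  intro k l
  by_cases hk : k = j
  · subst hk
    simp only [Matrix.updateRow_self]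
    exact contDiffAt_const
  · simp only [Matrix.updateRow_ne hk]
    exact hF k l

end SmoothMat

/-- The entrywise partial derivative of a matrix-valued function. -/
def pdMat (c : Fin 4) (F : E4 → Mat4) (y : E4) : Mat4 :=
  Matrix.of fun i j => pd c (fun z => F z i j) y

section

variable {F H : E4 → Mat4} {y : E4} (c : Fin 4)

theorem pdMat_congr (h : F =ᶠ[𝓝 y] H) : pdMat c F y = pdMat c H y := by
  ext i j
  exact pd_congr (h.mono fun z hz => by simp only [hz]) c

theorem pdMat_const (M : Mat4) : pdMat c (fun _ => M) y = 0 := by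
  ext i j
  exact pd_const c _ y

theorem pdMat_sub (hF : SmoothMat F y) (hH : SmoothMat H y) :
    pdMat c (fun z => F z - H z) y = pdMat c F y - pdMat c H y := by
  ext i j
  exact pd_sub c (hF.diff i j) (hH.diff i j)

theorem pdMat_smul {f : E4 → ℝ} (hf : ContDiffAt ℝ ∞ f y) (hH : SmoothMat H y) :
    pdMat c (fun z => f z • H z) y = pd c f y • H y + f y • pdMat c H y := by
  ext i j
  exact pd_mul c (differentiableAt_of_smooth hf) (hH.diff i j)

theorem pdMat_transpose : pdMat c (fun z => (F z)ᵀ) y = (pdMat c F y)ᵀ := rfl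

theorem pdMat_mul (hF : SmoothMat F y) (hH : SmoothMat H y) :
    pdMat c (fun z => F z * H z) y = pdMat c F y * H y + F y * pdMat c H y := by
  ext i j
  simp only [pdMat, Matrix.of_apply, Matrix.mul_apply, Matrix.add_apply,
    ← Finset.sum_add_distrib]
  rw [pd_sum _ c fun k _ => (hF.diff i k).fun_mul (hH.diff k j)]
  exact Finset.sum_congr rfl fun k _ => pd_mul c (hF.diff i k) (hH.diff k j)

theorem pd_trace (hF : SmoothMat F y) :
    pd c (fun z => (F z).trace) y = (pdMat c F y).trace := by
  simp only [Matrix.trace, Matrix.diag]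
  exact pd_sum _ c fun k _ => hF.diff k k

theorem pdMat_inv (hF : SmoothMat F y) (h0 : (F y).det ≠ 0) :
    pdMat c (fun z => (F z)⁻¹) y = -((F y)⁻¹ * pdMat c F y * (F y)⁻¹) := by
  have h1 : (fun z => (F z)⁻¹ * F z) =ᶠ[𝓝 y] fun _ => 1 := by
    filter_upwards [hF.det.continuousAt.eventually_ne h0] with z hz
    exact Matrix.nonsing_inv_mul _ hz.isUnit
  have h2 := pdMat_congr c h1
  rw [pdMat_const, pdMat_mul c (hF.inv h0) hF] at h2
  have h3 : F y * (F y)⁻¹ = 1 := Matrix.mul_nonsing_inv _ h0.isUnit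
  calc pdMat c (fun z => (F z)⁻¹) y
      = (pdMat c (fun z => (F z)⁻¹) y * F y + (F y)⁻¹ * pdMat c F y) * (F y)⁻¹
        - (F y)⁻¹ * pdMat c F y * (F y)⁻¹ := by
        rw [add_mul, Matrix.mul_assoc (pdMat c (fun z => (F z)⁻¹) y), h3, mul_one]; abel
    _ = _ := by rw [h2, zero_mul, zero_sub]

/-- Jacobi's formula: differentiating one column at a time gives the determinants of Cramer's rule,
whose sum is the trace with the adjugate. -/
theorem pd_det (hF : SmoothMat F y) :
    pd c (fun z => (F z).det) y = ((F y).adjugate * pdMat c F y).trace := by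
  have hd : ∀ σ : Equiv.Perm (Fin 4), DifferentiableAt ℝ (fun z => ∏ i, F z (σ i) i) y :=
    fun σ => differentiableAt_of_smooth (contDiffAt_prod fun i _ => hF (σ i) i)
  simp only [Matrix.det_apply']
  rw [pd_sum _ c fun σ _ => (differentiableAt_const _).fun_mul (hd σ)]
  have h1 : ∀ σ : Equiv.Perm (Fin 4),
      pd c (fun z => ((Equiv.Perm.sign σ : ℤ) : ℝ) * ∏ i, F z (σ i) i) y =
      ∑ i, ((Equiv.Perm.sign σ : ℤ) : ℝ) *
        ∏ j, (F y).updateCol i (fun k => pdMat c F y k i) (σ j) j := by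
    intro σ
    rw [pd_mul c (differentiableAt_const _) (hd σ), pd_const, zero_mul, zero_add, pd_prod c fun i => hF.diff _ _, Finset.mul_sum]
    refine Finset.sum_congr rfl fun i _ => ?_
    congr 1
    rw [← Finset.prod_erase_mul _ _ (Finset.mem_univ i)]
    congr 1
    · refine Finset.prod_congr rfl fun j hj => ?_
      rw [Matrix.updateCol_ne (Finset.ne_of_mem_erase hj)]
    · rw [Matrix.updateCol_self]; rfl
  simp only [h1]
  rw [Finset.sum_comm]
  simp only [← Matrix.det_apply', ← Matrix.cramer_apply, Matrix.cramer_eq_adjugate_mulVec]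
  rfl

end

/-! ### The Levi-Civita connection -/

/-- The matrix `(Γ_c)^k_j` of Christoffel symbols. -/
def chr (G : E4 → Mat4) (y : E4) (c : Fin 4) : Mat4 := Matrix.of fun k j => christoffel G y k c j

/-- The matrix of the covariant derivative `∇_c T`. -/
def covMat (G T : E4 → Mat4) (y : E4) (c : Fin 4) : Mat4 := Matrix.of (covD G T y c)

theorem covMat_eq (G T : E4 → Mat4) (y : E4) (c : Fin 4) :
    covMat G T y c = pdMat c T y - (chr G y c)ᵀ * T y - T y * chr G y c := by
  ext a b
  simp only [covMat, covD, pdMat, chr, Matrix.of_apply, Matrix.sub_apply, Matrix.mul_apply,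
    Matrix.transpose_apply]
  congr 1
  exact Finset.sum_congr rfl fun _ _ => mul_comm _ _

theorem ckEq_iff (G P : E4 → Mat4) (y : E4) :
    CKEq G P y ↔ ckTensor (G y) (covMat G P y) = 0 := by
  constructor
  · intro h
    funext a
    ext b c
    exact h a b c
  · intro h a b c
    exact congrFun (congrFun (congrFun h a) b) c

theorem ckyEq_iff (G A : E4 → Mat4) (y : E4) :
    CKYEq G A y ↔ ckyTensor (G y) (covMat G A y) = 0 := by
  constructor
  · intro h
    funext a
    ext b c
    exact sub_eq_zero.2 (h a b c)
  · intro h a b c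
    exact sub_eq_zero.1 (congrFun (congrFun (congrFun h a) b) c)

theorem rainich_eq (G P : E4 → Mat4) (y : E4) :
    rainich G P y = rainichForm (G y) (P y) (covMat G P y) := rfl

/-- `G` is a smooth metric near `y`. -/
structure MetricAt (G : E4 → Mat4) (y : E4) : Prop where
  smooth : SmoothMat G y
  symm : ∀ᶠ z in 𝓝 y, (G z)ᵀ = G z
  det_neg : (G y).det < 0

namespace MetricAt

variable {G : E4 → Mat4} {y : E4}

theorem det_ne (hG : MetricAt G y) : (G y).det ≠ 0 := hG.det_neg.ne

theorem pd_symm (hG : MetricAt G y) (c i j : Fin 4) :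
    pd c (fun z => G z i j) y = pd c (fun z => G z j i) y :=
  pd_congr (hG.symm.mono fun _ hz => congrFun (congrFun hz j) i) c

theorem lower_chr (hG : MetricAt G y) (c l j : Fin 4) : (G y * chr G y c) l j =
    (1 / 2) * (pd c (fun z => G z j l) y + pd j (fun z => G z c l) y
      - pd l (fun z => G z c j) y) := by
  have h : chr G y c = (G y)⁻¹ * Matrix.of fun l j => (1 / 2) *
      (pd c (fun z => G z j l) y + pd j (fun z => G z c l) y - pd l (fun z => G z c j) y) := by
    ext k j
    simp only [chr, christoffel, Matrix.of_apply, Matrix.mul_apply, Finset.mul_sum]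
    exact Finset.sum_congr rfl fun _ _ => by ring
  rw [h, ← Matrix.mul_assoc, Matrix.mul_nonsing_inv _ hG.det_ne.isUnit, one_mul]
  rfl

theorem transpose_chr_mul (hG : MetricAt G y) (L : Mat4) (i j : Fin 4) :
    (Lᵀ * G y) i j = (G y * L) j i := by
  have : (G y * L)ᵀ = Lᵀ * G y := by rw [Matrix.transpose_mul, hG.symm.self_of_nhds]
  rw [← this]; rfl

theorem pdMat_eq (hG : MetricAt G y) (c : Fin 4) :
    pdMat c G y = (chr G y c)ᵀ * G y + G y * chr G y c := by
  ext i j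
  rw [Matrix.add_apply, hG.transpose_chr_mul, hG.lower_chr, hG.lower_chr]
  simp only [pdMat, Matrix.of_apply]
  rw [hG.pd_symm i c j, hG.pd_symm j c i, hG.pd_symm c j i, hG.pd_symm i j c, hG.pd_symm j i c]
  ring

/-- Metric compatibility, transferred to the inverse metric; it makes every contraction commute with
∇. -/
theorem pdMat_inv_eq (hG : MetricAt G y) (c : Fin 4) :
    pdMat c (fun z => (G z)⁻¹) y = -((G y)⁻¹ * (chr G y c)ᵀ) - chr G y c * (G y)⁻¹ := by
  have h1 : (G y)⁻¹ * G y = 1 := Matrix.nonsing_inv_mul _ hG.det_ne.isUnit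
  have h2 : G y * (G y)⁻¹ = 1 := Matrix.mul_nonsing_inv _ hG.det_ne.isUnit
  rw [pdMat_inv c hG.smooth hG.det_ne, hG.pdMat_eq]
  rw [mul_add, add_mul, ← Matrix.mul_assoc (G y)⁻¹ (G y), h1, one_mul, Matrix.mul_assoc,
    Matrix.mul_assoc _ (G y), h2, mul_one]
  abel

/-- The Levi-Civita connection is the unique torsion-free metric connection. -/
theorem eq_chr (hG : MetricAt G y) {L : Fin 4 → Mat4}
    (h1 : ∀ c, pdMat c G y = (L c)ᵀ * G y + G y * L c) (h2 : ∀ c k j, L c k j = L j k c)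
    (c : Fin 4) : L c = chr G y c := by
  have h3 : ∀ l c j, (G y * L c) l j = (G y * L j) l c := by
    intro l c j
    simp only [Matrix.mul_apply, h2 c _ j]
  have h4 : ∀ c i j, pd c (fun z => G z i j) y = (G y * L c) j i + (G y * L c) i j := by
    intro c i j
    have := congrFun (congrFun (h1 c) i) j
    rwa [Matrix.add_apply, hG.transpose_chr_mul] at this
  have h5 : G y * L c = G y * chr G y c := by
    ext l j
    rw [hG.lower_chr, h4, h4, h4, h3 j l c, h3 c l j, h3 l j c]
    ring
  have h6 := congrArg ((G y)⁻¹ * ·) h5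
  simpa only [← Matrix.mul_assoc, Matrix.nonsing_inv_mul _ hG.det_ne.isUnit, one_mul] using h6

theorem chr_symm (hG : MetricAt G y) (c k j : Fin 4) : chr G y c k j = chr G y j k c := by
  simp only [chr, christoffel, Matrix.of_apply]
  congr 1
  refine Finset.sum_congr rfl fun l _ => ?_
  rw [hG.pd_symm l c j]
  ring

variable {S T : E4 → Mat4}

theorem covMat_mul (hG : MetricAt G y) (hS : SmoothMat S y) (hT : SmoothMat T y) (c : Fin 4) :
    covMat G (fun z => mul (G z) (S z) (T z)) y c =
      mul (G y) (covMat G S y c) (T y) + mul (G y) (S y) (covMat G T y c) := by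
  simp only [covMat_eq, mul]
  rw [pdMat_mul c (hS.mul (hG.smooth.inv hG.det_ne)) hT,
    pdMat_mul c hS (hG.smooth.inv hG.det_ne), hG.pdMat_inv_eq]
  noncomm_ring

theorem covMat_smul_self (hG : MetricAt G y) {f : E4 → ℝ} (hf : ContDiffAt ℝ ∞ f y) (c : Fin 4) :
    covMat G (fun z => f z • G z) y c = pd c f y • G y := by
  rw [covMat_eq, pdMat_smul c hf hG.smooth, hG.pdMat_eq]
  simp only [smul_add, Matrix.mul_smul, Matrix.smul_mul]
  abel

theorem covMat_sub (hS : SmoothMat S y) (hT : SmoothMat T y) (c : Fin 4) :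
    covMat G (fun z => S z - T z) y c = covMat G S y c - covMat G T y c := by
  simp only [covMat_eq]
  rw [pdMat_sub c hS hT]
  noncomm_ring

theorem smooth_mul (hG : MetricAt G y) (hS : SmoothMat S y) (hT : SmoothMat T y) :
    SmoothMat (fun z => mul (G z) (S z) (T z)) y :=
  (hS.mul (hG.smooth.inv hG.det_ne)).mul hT

theorem smooth_tr (hG : MetricAt G y) (hT : SmoothMat T y) :
    ContDiffAt ℝ ∞ (fun z => tr (G z) (T z)) y :=
  ((hG.smooth.inv hG.det_ne).mul hT).trace

theorem pd_tr (hG : MetricAt G y) (hT : SmoothMat T y) (c : Fin 4) :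
    pd c (fun z => tr (G z) (T z)) y = tr (G y) (covMat G T y c) := by
  simp only [tr]
  rw [pd_trace c ((hG.smooth.inv hG.det_ne).mul hT), pdMat_mul c (hG.smooth.inv hG.det_ne) hT,
    hG.pdMat_inv_eq, covMat_eq]
  have h : ((chr G y c) * ((G y)⁻¹ * T y)).trace = ((G y)⁻¹ * (T y * chr G y c)).trace := by
    rw [Matrix.trace_mul_comm, Matrix.mul_assoc]
  simp only [sub_mul, mul_sub, neg_mul, Matrix.trace_add, Matrix.trace_sub, Matrix.trace_neg,
    Matrix.mul_assoc, h]
  ring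

/-- The chain rule for ∇, valid because the metric and its inverse are parallel. It lets the
pointwise algebra speak about ∇P. -/
theorem covMat_tracelessSquare (hG : MetricAt G y) (hT : SmoothMat T y) (c : Fin 4) :
    covMat G (fun z => tracelessSquare (G z) (T z)) y c =
      tracelessSquareDeriv (G y) (T y) (covMat G T y c) := by
  have hm := hG.smooth_mul hT hT
  have hf : ContDiffAt ℝ ∞ (fun z => (1 / 4) * tr (G z) (mul (G z) (T z) (T z))) y :=
    contDiffAt_const.mul (hG.smooth_tr hm)
  simp only [tracelessSquare, tracelessSquareDeriv]
  rw [covMat_sub hm (SmoothMat.smul hf hG.smooth), hG.covMat_mul hT hT, hG.covMat_smul_self hf,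
    pd_mul c (differentiableAt_const _) (differentiableAt_of_smooth (hG.smooth_tr hm)),
    pd_const, zero_mul, zero_add, hG.pd_tr hm, hG.covMat_mul hT hT]

theorem covMat_congr (h : S =ᶠ[𝓝 y] T) (c : Fin 4) : covMat G S y c = covMat G T y c := by
  rw [covMat_eq, covMat_eq, pdMat_congr c h, h.eq_of_nhds]

theorem covMat_transpose (h : ∀ᶠ z in 𝓝 y, (T z)ᵀ = -T z) (c : Fin 4) :
    (covMat G T y c)ᵀ = -covMat G T y c := by
  have h1 : pdMat c (fun z => (T z)ᵀ) y = pdMat c (fun z => -T z) y := pdMat_congr c h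
  have h2 : pdMat c (fun z => -T z) y = -pdMat c T y := by
    ext i j
    exact pd_neg c _ y
  rw [covMat_eq, Matrix.transpose_sub, Matrix.transpose_sub, ← pdMat_transpose, h1, h2,
    Matrix.transpose_mul, Matrix.transpose_mul, Matrix.transpose_transpose, h.self_of_nhds]
  noncomm_ring

end MetricAt

/-! ### The invariants of a 2-form in a coordinate domain -/

/-- The polarization of twice the Pfaffian. -/
def pf (X Y : Mat4) : ℝ :=
  X 0 1 * Y 2 3 + X 2 3 * Y 0 1 - X 0 2 * Y 1 3 - X 1 3 * Y 0 2 + X 0 3 * Y 1 2 + X 1 2 * Y 0 3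

theorem pf_cong (J : Mat4) {X Y : Mat4} (hX : Xᵀ = -X) (hY : Yᵀ = -Y) :
    pf (cong J X) (cong J Y) = J.det * pf X Y := by
  rw [eq_skewMat_of_transpose hX, eq_skewMat_of_transpose hY, det_four]
  simp only [pf, cong_apply, Fin.sum_univ_four]
  simp [skewMat]
  ring

/-- The infinitesimal form of `pf_cong`: det J is replaced by the trace. -/
theorem pf_derivation (L : Mat4) {A : Mat4} (hA : Aᵀ = -A) :
    2 * pf (Lᵀ * A + A * L) A = L.trace * pf A A := by
  rw [eq_skewMat_of_transpose hA]
  simp only [pf, Matrix.trace, Matrix.diag, Matrix.add_apply, Matrix.mul_apply,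
    Matrix.transpose_apply, Fin.sum_univ_four]
  simp [skewMat]
  ring

/-- Both sides transform alike under oriented changes of frame, so an orthonormal frame suffices.
The formula reduces differentiating (A, *A) to the quadratic polynomial `pf` and the density √(-det
g). -/
theorem form2Inner_hodge {G X Y : Mat4} (hG : IsLorentz G) (hX : Xᵀ = -X) (hY : Yᵀ = -Y) :
    form2Inner G X (hodge G Y) = -(pf X Y / Real.sqrt (-G.det)) := by
  obtain ⟨J, hJ, hJG⟩ := hG.exists_frame
  have hu := hJ.ne'.isUnit
  have h1 := sqrt_det_cong hJ G
  rw [hJG, det_eta, neg_neg, Real.sqrt_one] at h1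
  have h0 : Real.sqrt (-G.det) ≠ 0 := fun h => by rw [h] at h1; simp at h1
  have h2 := pf_cong J hX hY
  rw [← form2Inner_cong hu, ← hodge_cong hJ, hJG]
  have hX' := eq_skewMat_of_transpose (A := cong J X) (by rw [cong_transpose, hX, cong_neg])
  have hY' := eq_skewMat_of_transpose (A := cong J Y) (by rw [cong_transpose, hY, cong_neg])
  have h3 : form2Inner eta (cong J X) (hodge eta (cong J Y)) = -pf (cong J X) (cong J Y) := by
    rw [hX', hY', hodge_eta_skewMat, form2Inner_eta_skewMat]
    simp [pf, skewMat]
    ring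
  rw [h3, h2]
  field_simp
  linear_combination pf X Y * h1

theorem form2Inner_eq_tr {G X Y : Mat4} (hG : Gᵀ = G) (hY : Yᵀ = -Y) :
    form2Inner G X Y = -(1 / 2) * tr G (mul G X Y) := by
  have hK : (G⁻¹)ᵀ = G⁻¹ := by rw [Matrix.transpose_nonsing_inv, hG]
  rw [form2Inner_eq_trace, raise, tr, mul, hK]
  simp only [Matrix.transpose_mul, hK, hY]
  rw [Matrix.trace_mul_comm G⁻¹ (X * G⁻¹ * Y)]
  simp [Matrix.mul_assoc]

/-- Locally θ is the differential of arg(u + iv). Differentiating θ (u² + v²) = u dv - v du and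
using the symmetry of second derivatives avoids choosing a branch of the argument. -/
theorem pd_angle_comm {u v : E4 → ℝ} {θ : Fin 4 → E4 → ℝ} {y : E4} (hu : ContDiffAt ℝ ∞ u y)
    (hv : ContDiffAt ℝ ∞ v y) (h0 : u y ^ 2 + v y ^ 2 ≠ 0)
    (hθ : ∀ c, θ c =ᶠ[𝓝 y] fun z => (u z * pd c v z - v z * pd c u z) / (u z ^ 2 + v z ^ 2))
    (a b : Fin 4) : pd a (θ b) y = pd b (θ a) y := by
  have hn : ContDiffAt ℝ ∞ (fun z => u z ^ 2 + v z ^ 2) y := (hu.pow 2).add (hv.pow 2)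
  have hm : ∀ c, ContDiffAt ℝ ∞ (fun z => u z * pd c v z - v z * pd c u z) y := fun c =>
    (hu.mul (smooth_pd c hv)).sub (hv.mul (smooth_pd c hu))
  have hθs : ∀ c, ContDiffAt ℝ ∞ (θ c) y := fun c =>
    ((hm c).div hn h0).congr_of_eventuallyEq (hθ c)
  have d := fun {f : E4 → ℝ} (hf : ContDiffAt ℝ ∞ f y) => differentiableAt_of_smooth hf
  have hn' : ∀ c, pd c (fun z => u z ^ 2 + v z ^ 2) y =
      2 * (u y * pd c u y + v y * pd c v y) := by
    intro c
    simp only [sq]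
    rw [pd_add c (d (hu.mul hu)) (d (hv.mul hv)), pd_mul c (d hu) (d hu), pd_mul c (d hv) (d hv)]
    ring
  have hm' : ∀ c e, pd c (fun z => u z * pd e v z - v z * pd e u z) y =
      pd c u y * pd e v y + u y * pd c (pd e v) y - pd c v y * pd e u y
        - v y * pd c (pd e u) y := by
    intro c e
    rw [pd_sub c (d (hu.mul (smooth_pd e hv))) (d (hv.mul (smooth_pd e hu))),
      pd_mul c (d hu) (d (smooth_pd e hv)), pd_mul c (d hv) (d (smooth_pd e hu))]
    ring
  have key : ∀ c e, pd c (θ e) y * (u y ^ 2 + v y ^ 2) +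
      θ e y * (2 * (u y * pd c u y + v y * pd c v y)) =
      pd c u y * pd e v y + u y * pd c (pd e v) y - pd c v y * pd e u y
        - v y * pd c (pd e u) y := by
    intro c e
    rw [← hm', ← hn', ← pd_mul c (d (hθs e)) (d hn)]
    refine pd_congr ?_ c
    filter_upwards [hθ e, hn.continuousAt.eventually_ne h0] with z hz hz0
    rw [hz, div_mul_cancel₀ _ hz0]
  have hval : ∀ c, θ c y * (u y ^ 2 + v y ^ 2) = u y * pd c v y - v y * pd c u y := fun c => by
    rw [(hθ c).eq_of_nhds, div_mul_cancel₀ _ h0]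
  have hab := key a b
  have hba := key b a
  rw [pd_pd_comm b a hv, pd_pd_comm b a hu] at hba
  -- Two factors u² + v² are needed: one clears the denominator of dθ, the other that of the
  -- remaining terms in θ.
  apply mul_right_cancel₀ h0
  apply mul_right_cancel₀ h0
  linear_combination (u y ^ 2 + v y ^ 2) * hab - (u y ^ 2 + v y ^ 2) * hba
    - 2 * (u y * pd a u y + v y * pd a v y) * hval b
    + 2 * (u y * pd b u y + v y * pd b v y) * hval a

/-- `G` is a smooth Lorentzian metric and `A` a smooth 2-form near `y`. -/
structure FormAt (G A : E4 → Mat4) (y : E4) : Prop where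
  smooth_metric : SmoothMat G y
  lorentz : ∀ᶠ z in 𝓝 y, IsLorentz (G z)
  smooth : SmoothMat A y
  skew : ∀ᶠ z in 𝓝 y, (A z)ᵀ = -A z

namespace FormAt

variable {G A : E4 → Mat4} {y : E4}

theorem metric (h : FormAt G A y) : MetricAt G y where
  smooth := h.smooth_metric
  symm := h.lorentz.mono fun _ hz => hz.symm
  det_neg := h.lorentz.self_of_nhds.det_neg

theorem inner_eq (h : FormAt G A y) : (fun z => form2Inner (G z) (A z) (A z)) =ᶠ[𝓝 y]
    fun z => -(1 / 2) * tr (G z) (mul (G z) (A z) (A z)) := by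
  filter_upwards [h.lorentz, h.skew] with z hz hA
  exact form2Inner_eq_tr hz.symm hA

theorem inner_hodge_eq (h : FormAt G A y) :
    (fun z => form2Inner (G z) (A z) (hodge (G z) (A z))) =ᶠ[𝓝 y]
      fun z => -(pf (A z) (A z) / Real.sqrt (-(G z).det)) := by
  filter_upwards [h.lorentz, h.skew] with z hz hA
  exact form2Inner_hodge hz hA hA

theorem smooth_inner (h : FormAt G A y) :
    ContDiffAt ℝ ∞ (fun z => form2Inner (G z) (A z) (A z)) y :=
  (contDiffAt_const.mul (h.metric.smooth_tr (h.metric.smooth_mul h.smooth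
    h.smooth))).congr_of_eventuallyEq h.inner_eq

theorem smooth_sqrt (h : FormAt G A y) : ContDiffAt ℝ ∞ (fun z => Real.sqrt (-(G z).det)) y :=
  h.smooth_metric.det.neg.sqrt (neg_ne_zero.2 h.metric.det_ne)

theorem sqrt_ne (h : FormAt G A y) : Real.sqrt (-(G y).det) ≠ 0 :=
  (Real.sqrt_pos.2 (neg_pos.2 h.metric.det_neg)).ne'

theorem smooth_pf (h : FormAt G A y) : ContDiffAt ℝ ∞ (fun z => pf (A z) (A z)) y := by
  have s := h.smooth
  exact ((((((s 0 1).mul (s 2 3)).add ((s 2 3).mul (s 0 1))).sub ((s 0 2).mul (s 1 3))).sub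
    ((s 1 3).mul (s 0 2))).add ((s 0 3).mul (s 1 2))).add ((s 1 2).mul (s 0 3))

theorem smooth_inner_hodge (h : FormAt G A y) :
    ContDiffAt ℝ ∞ (fun z => form2Inner (G z) (A z) (hodge (G z) (A z))) y :=
  (h.smooth_pf.div h.smooth_sqrt h.sqrt_ne).neg.congr_of_eventuallyEq h.inner_hodge_eq

theorem covMat_transpose (h : FormAt G A y) (c : Fin 4) :
    (covMat G A y c)ᵀ = -covMat G A y c := MetricAt.covMat_transpose h.skew c

theorem pd_inner (h : FormAt G A y) (c : Fin 4) :
    pd c (fun z => form2Inner (G z) (A z) (A z)) y =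
      2 * form2Inner (G y) (covMat G A y c) (A y) := by
  have hm := h.metric.smooth_mul h.smooth h.smooth
  rw [pd_congr h.inner_eq,
    pd_mul c (differentiableAt_const _) (differentiableAt_of_smooth (h.metric.smooth_tr hm)),
    pd_const, zero_mul, zero_add, h.metric.pd_tr hm, h.metric.covMat_mul h.smooth h.smooth,
    tr_add, form2Inner_eq_tr h.lorentz.self_of_nhds.symm h.skew.self_of_nhds]
  have : tr (G y) (mul (G y) (A y) (covMat G A y c)) =
      tr (G y) (mul (G y) (covMat G A y c) (A y)) := by
    simp only [tr, mul, Matrix.mul_assoc]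
    rw [← Matrix.mul_assoc (G y)⁻¹ (A y), Matrix.trace_mul_comm, Matrix.mul_assoc]
  rw [this]
  ring

/-- Obtained by differentiating the square of √(-det g) and applying Jacobi's formula with ∂g
expressed through Γ. -/
theorem pd_sqrt (h : FormAt G A y) (c : Fin 4) :
    pd c (fun z => Real.sqrt (-(G z).det)) y =
      (chr G y c).trace * Real.sqrt (-(G y).det) := by
  have hd := differentiableAt_of_smooth h.smooth_sqrt
  have h1 : (fun z => Real.sqrt (-(G z).det) * Real.sqrt (-(G z).det)) =ᶠ[𝓝 y]
      fun z => -(G z).det := by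
    filter_upwards [h.lorentz] with z hz
    exact Real.mul_self_sqrt (neg_pos.2 hz.det_neg).le
  have h2 := pd_congr h1 c
  rw [pd_mul c hd hd, pd_neg, pd_det c h.smooth_metric, h.metric.pdMat_eq] at h2
  have h3 : ((G y).adjugate * ((chr G y c)ᵀ * G y + G y * chr G y c)).trace =
      2 * (G y).det * (chr G y c).trace := by
    rw [mul_add, Matrix.trace_add, ← Matrix.mul_assoc, ← Matrix.mul_assoc,
      Matrix.adjugate_mul, Matrix.trace_mul_comm, ← Matrix.mul_assoc, Matrix.mul_adjugate]
    simp
    ring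
  rw [h3] at h2
  have h4 : Real.sqrt (-(G y).det) * Real.sqrt (-(G y).det) = -(G y).det := h1.eq_of_nhds
  apply mul_left_cancel₀ h.sqrt_ne
  linear_combination (1 / 2) * h2 - (chr G y c).trace * h4

theorem pd_pf (h : FormAt G A y) (c : Fin 4) :
    pd c (fun z => pf (A z) (A z)) y =
      2 * pf (covMat G A y c) (A y) + (chr G y c).trace * pf (A y) (A y) := by
  have h1 : pd c (fun z => pf (A z) (A z)) y = 2 * pf (pdMat c A y) (A y) := by
    have s := h.smooth
    have d := fun i j => h.smooth.diff i j
    have m := fun i j k l => (d i j).fun_mul (d k l)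
    simp only [pf]
    rw [pd_add c (((((m 0 1 2 3).fun_add (m 2 3 0 1)).fun_sub (m 0 2 1 3)).fun_sub
        (m 1 3 0 2)).fun_add (m 0 3 1 2)) (m 1 2 0 3),
      pd_add c ((((m 0 1 2 3).fun_add (m 2 3 0 1)).fun_sub (m 0 2 1 3)).fun_sub
        (m 1 3 0 2)) (m 0 3 1 2),
      pd_sub c (((m 0 1 2 3).fun_add (m 2 3 0 1)).fun_sub (m 0 2 1 3)) (m 1 3 0 2),
      pd_sub c ((m 0 1 2 3).fun_add (m 2 3 0 1)) (m 0 2 1 3),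
      pd_add c (m 0 1 2 3) (m 2 3 0 1)]
    simp only [pd_mul c (d _ _) (d _ _), pdMat, Matrix.of_apply]
    ring
  rw [h1, ← pf_derivation _ h.skew.self_of_nhds, ← mul_add]
  have h2 : pdMat c A y = covMat G A y c + ((chr G y c)ᵀ * A y + A y * chr G y c) := by
    rw [covMat_eq]; abel
  have h3 : ∀ X Y Z : Mat4, pf (X + Y) Z = pf X Z + pf Y Z := by
    intro X Y Z
    simp only [pf, Matrix.add_apply]
    ring
  rw [h2, h3]

/-- The terms tr Γ from the Pfaffian and from √(-det g) cancel; this is where the parallelism of the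
volume element is used. -/
theorem pd_inner_hodge (h : FormAt G A y) (c : Fin 4) :
    pd c (fun z => form2Inner (G z) (A z) (hodge (G z) (A z))) y =
      2 * form2Inner (G y) (covMat G A y c) (hodge (G y) (A y)) := by
  rw [form2Inner_hodge h.lorentz.self_of_nhds (h.covMat_transpose c) h.skew.self_of_nhds]
  have hw := differentiableAt_of_smooth h.smooth_sqrt
  have hv := differentiableAt_of_smooth h.smooth_inner_hodge
  have h1 : (fun z => form2Inner (G z) (A z) (hodge (G z) (A z)) * Real.sqrt (-(G z).det))
      =ᶠ[𝓝 y] fun z => -pf (A z) (A z) := by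
    filter_upwards [h.inner_hodge_eq, h.smooth_sqrt.continuousAt.eventually_ne h.sqrt_ne] with z hz h0
    rw [hz, neg_mul, div_mul_cancel₀ _ h0]
  have h2 := pd_congr h1 c
  have h3 : form2Inner (G y) (A y) (hodge (G y) (A y)) * Real.sqrt (-(G y).det) =
    -pf (A y) (A y) := h1.eq_of_nhds
  rw [pd_mul c hv hw, pd_neg, h.pd_pf, h.pd_sqrt] at h2
  have h0 := h.sqrt_ne
  apply mul_right_cancel₀ h0
  rw [mul_neg, neg_mul, mul_assoc, div_mul_cancel₀ _ h0]
  linear_combination h2 - (chr G y c).trace * h3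

theorem angleForm_eq (h : FormAt G A y) (c : Fin 4) :
    angleForm (G y) (A y) (covMat G A y) c =
      (form2Inner (G y) (A y) (A y) * pd c (fun z => form2Inner (G z) (A z) (hodge (G z) (A z))) y
        - form2Inner (G y) (A y) (hodge (G y) (A y)) *
          pd c (fun z => form2Inner (G z) (A z) (A z)) y) /
      (form2Inner (G y) (A y) (A y) ^ 2 + form2Inner (G y) (A y) (hodge (G y) (A y)) ^ 2) := by
  rw [h.pd_inner, h.pd_inner_hodge, angleForm]

theorem sq_add_sq_ne (hreg : Regular (G y) (A y)) :
    form2Inner (G y) (A y) (A y) ^ 2 + form2Inner (G y) (A y) (hodge (G y) (A y)) ^ 2 ≠ 0 := by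
  intro h0
  apply hreg
  constructor
  · nlinarith [sq_nonneg (form2Inner (G y) (A y) (A y)),
      sq_nonneg (form2Inner (G y) (A y) (hodge (G y) (A y)))]
  · nlinarith [sq_nonneg (form2Inner (G y) (A y) (A y)),
      sq_nonneg (form2Inner (G y) (A y) (hodge (G y) (A y)))]

theorem pd_angleForm_comm (h : ∀ᶠ z in 𝓝 y, FormAt G A z) (hreg : Regular (G y) (A y))
    (a b : Fin 4) : pd a (fun z => angleForm (G z) (A z) (covMat G A z) b) y =
      pd b (fun z => angleForm (G z) (A z) (covMat G A z) a) y :=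
  have h0 : FormAt G A y := Filter.Eventually.self_of_nhds h
  pd_angle_comm (θ := fun c z => angleForm (G z) (A z) (covMat G A z) c) h0.smooth_inner
    h0.smooth_inner_hodge (sq_add_sq_ne hreg)
    (fun c => Filter.Eventually.mono h fun _ hz => hz.angleForm_eq c) a b

variable {P : E4 → Mat4}

/-- A regular 2-form satisfies the conformal Killing-Yano equation if and only if its traceless
square satisfies the conformal Killing equation and its Rainich form is the differential of the
angle of the invariants. -/
theorem ckyEq_iff (h : FormAt G A y) (hreg : Regular (G y) (A y))
    (hP : P =ᶠ[𝓝 y] fun z => tracelessSquare (G z) (A z)) :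
    CKYEq G A y ↔ CKEq G P y ∧
      ∀ l, rainich G P y l = angleForm (G y) (A y) (covMat G A y) l := by
  have hc : covMat G P y = fun c => tracelessSquareDeriv (G y) (A y) (covMat G A y c) := by
    funext c
    rw [MetricAt.covMat_congr hP, h.metric.covMat_tracelessSquare h.smooth]
  rw [CKY.ckyEq_iff, ckEq_iff, rainich_eq, hc, hP.eq_of_nhds]
  exact ckyTensor_eq_zero_iff h.lorentz.self_of_nhds h.skew.self_of_nhds hreg h.covMat_transpose

/-- The point (u, v) has polar angle π - 2ψ up to the sign of r; the modulus drops out of the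
differential. -/
theorem angleForm_eq_of_invariants (h : FormAt G A y) {r ψ : E4 → ℝ} (hr : ContDiffAt ℝ ∞ r y)
    (hψ : ContDiffAt ℝ ∞ ψ y) (h0 : r y ≠ 0)
    (hu : (fun z => form2Inner (G z) (A z) (A z)) =ᶠ[𝓝 y] fun z => -r z * Real.cos (2 * ψ z))
    (hv : (fun z => form2Inner (G z) (A z) (hodge (G z) (A z))) =ᶠ[𝓝 y]
      fun z => r z * Real.sin (2 * ψ z)) (c : Fin 4) :
    angleForm (G y) (A y) (covMat G A y) c = -2 * pd c ψ y := by
  have hψd := differentiableAt_of_smooth hψ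
  have hrd := differentiableAt_of_smooth hr
  have h2 : HasFDerivAt (fun z => 2 * ψ z) ((2 : ℝ) • fderiv ℝ ψ y) y :=
    hψd.hasFDerivAt.const_mul 2
  have hcos : pd c (fun z => Real.cos (2 * ψ z)) y = -(Real.sin (2 * ψ y) * (2 * pd c ψ y)) := by
    simp [pd, h2.cos.fderiv]
  have hsin : pd c (fun z => Real.sin (2 * ψ z)) y = Real.cos (2 * ψ y) * (2 * pd c ψ y) := by
    simp [pd, h2.sin.fderiv]
  have hs := Real.sin_sq_add_cos_sq (2 * ψ y)
  rw [h.angleForm_eq, pd_congr hu, pd_congr hv, pd_mul c hrd.fun_neg h2.cos.differentiableAt,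
    pd_mul c hrd h2.sin.differentiableAt, pd_neg, hcos, hsin, hu.eq_of_nhds, hv.eq_of_nhds]
  have hn : (-r y * Real.cos (2 * ψ y)) ^ 2 + (r y * Real.sin (2 * ψ y)) ^ 2 = r y ^ 2 := by
    linear_combination r y ^ 2 * hs
  rw [hn, div_eq_iff (pow_ne_zero 2 h0)]
  linear_combination (-2 * r y ^ 2 * pd c ψ y) * hs

end FormAt

/-! ### Changes of coordinates -/

/-- The Jacobian matrix of `φ`. -/
def jac (φ : E4 → E4) (y : E4) : Mat4 :=
  Matrix.of fun i j => fderiv ℝ φ y (EuclideanSpace.single j 1) i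

section

variable {φ : E4 → E4} {y : E4}

theorem jac_eq_pd (hφ : DifferentiableAt ℝ φ y) (i j : Fin 4) :
    jac φ y i j = pd j (fun z => φ z i) y := by
  have h := ((EuclideanSpace.proj i : E4 →L[ℝ] ℝ).hasFDerivAt.comp y hφ.hasFDerivAt).fderiv
  have h' : fderiv ℝ (fun z => φ z i) y =
      ((EuclideanSpace.proj i : E4 →L[ℝ] ℝ)).comp (fderiv ℝ φ y) := h
  rw [pd, h']
  rfl

theorem jac_eventuallyEq (hφ : ContDiffAt ℝ ∞ φ y) (i j : Fin 4) :
    (fun z => jac φ z i j) =ᶠ[𝓝 y] pd j fun z => φ z i := by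
  have h1 : ∀ᶠ z in 𝓝 y, ContDiffAt ℝ 1 φ z :=
    (hφ.of_le (m := 1) (by exact_mod_cast le_top)).eventually (by simp)
  filter_upwards [h1] with z hz
  exact jac_eq_pd (hz.differentiableAt (by simp)) i j

theorem smooth_coord (hφ : ContDiffAt ℝ ∞ φ y) (i : Fin 4) :
    ContDiffAt ℝ ∞ (fun z => φ z i) y :=
  contDiffAt_euclidean.1 hφ i

theorem smooth_jac (hφ : ContDiffAt ℝ ∞ φ y) : SmoothMat (jac φ) y := fun i j =>
  (smooth_pd j (smooth_coord hφ i)).congr_of_eventuallyEq (jac_eventuallyEq hφ i j)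

theorem pdMat_jac_comm (hφ : ContDiffAt ℝ ∞ φ y) (c i j : Fin 4) :
    pdMat c (jac φ) y i j = pdMat j (jac φ) y i c := by
  simp only [pdMat, Matrix.of_apply]
  rw [pd_congr (jac_eventuallyEq hφ i j), pd_congr (jac_eventuallyEq hφ i c),
    pd_pd_comm _ _ (smooth_coord hφ i)]

theorem pd_comp (hφ : ContDiffAt ℝ ∞ φ y) {f : E4 → ℝ} (hf : DifferentiableAt ℝ f (φ y))
    (c : Fin 4) : pd c (fun z => f (φ z)) y = ∑ k, jac φ y k c * pd k f (φ y) := by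
  have h := fderiv_fun_comp y hf (hφ.differentiableAt (by simp))
  have h' : fderiv ℝ (fun z => f (φ z)) y = (fderiv ℝ f (φ y)).comp (fderiv ℝ φ y) := h
  rw [pd, h', ContinuousLinearMap.comp_apply, fderiv_eq_sum_pd]
  rfl

theorem SmoothMat.comp {T : E4 → Mat4} (hT : SmoothMat T (φ y)) (hφ : ContDiffAt ℝ ∞ φ y) :
    SmoothMat (fun z => T (φ z)) y := fun i j => (hT i j).comp y hφ

theorem pdMat_comp (hφ : ContDiffAt ℝ ∞ φ y) {T : E4 → Mat4} (hT : SmoothMat T (φ y))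
    (c : Fin 4) : pdMat c (fun z => T (φ z)) y = ∑ k, jac φ y k c • pdMat k T (φ y) := by
  ext i j
  simp only [pdMat, Matrix.of_apply, Matrix.sum_apply, Matrix.smul_apply, smul_eq_mul]
  exact pd_comp hφ (hT.diff i j) c

theorem pdMat_cong_jac (hφ : ContDiffAt ℝ ∞ φ y) {T T' : E4 → Mat4} (hT' : SmoothMat T' (φ y))
    (hT : T =ᶠ[𝓝 y] fun z => cong (jac φ z) (T' (φ z))) (c : Fin 4) :
    pdMat c T y = (pdMat c (jac φ) y)ᵀ * T' (φ y) * jac φ y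
      + (jac φ y)ᵀ * (∑ k, jac φ y k c • pdMat k T' (φ y)) * jac φ y
      + (jac φ y)ᵀ * T' (φ y) * pdMat c (jac φ) y := by
  have hJ := smooth_jac hφ
  rw [pdMat_congr c hT]
  simp only [cong]
  rw [pdMat_mul c (hJ.transpose.mul (hT'.comp hφ)) hJ, pdMat_mul c hJ.transpose (hT'.comp hφ),
    pdMat_transpose, pdMat_comp hφ hT', add_mul]

variable {G G' T T' : E4 → Mat4}

/-- The transformed symbols are torsion-free, by the symmetry of the second derivatives of φ, and
metric, so uniqueness of the Levi-Civita connection identifies them without expanding the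
Christoffel formula. -/
theorem chr_cong_jac (hφ : ContDiffAt ℝ ∞ φ y) (h0 : (jac φ y).det ≠ 0) (hG : MetricAt G y)
    (hG' : MetricAt G' (φ y)) (h : G =ᶠ[𝓝 y] fun z => cong (jac φ z) (G' (φ z))) (c : Fin 4) :
    jac φ y * chr G y c =
      (∑ k, jac φ y k c • chr G' (φ y) k) * jac φ y + pdMat c (jac φ) y := by
  set J := jac φ y with hJ
  -- The candidate prescribed by the inhomogeneous transformation law.
  set L : Fin 4 → Mat4 := fun c =>
    J⁻¹ * ((∑ k, J k c • chr G' (φ y) k) * J + pdMat c (jac φ) y) with hL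
  have hJL : ∀ c, J * L c = (∑ k, J k c • chr G' (φ y) k) * J + pdMat c (jac φ) y := fun c => by
    rw [hL, ← Matrix.mul_assoc, Matrix.mul_nonsing_inv _ h0.isUnit, one_mul]
  have hsymm : ∀ c i j, (J * L c) i j = (J * L j) i c := by
    intro c i j
    rw [hJL, hJL, Matrix.add_apply, Matrix.add_apply, pdMat_jac_comm hφ c i j]
    congr 1
    simp only [Matrix.mul_apply, Matrix.sum_apply, Matrix.smul_apply, smul_eq_mul, Finset.sum_mul]
    rw [Finset.sum_comm]
    refine Finset.sum_congr rfl fun k _ => Finset.sum_congr rfl fun m _ => ?_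
    rw [hG'.chr_symm m i k]
    ring
  have htors : ∀ c k j, L c k j = L j k c := by
    intro c k j
    have hi : ∀ c, L c = J⁻¹ * (J * L c) := fun c => by
      rw [← Matrix.mul_assoc, Matrix.nonsing_inv_mul _ h0.isUnit, one_mul]
    rw [hi c, hi j, Matrix.mul_apply, Matrix.mul_apply]
    exact Finset.sum_congr rfl fun i _ => by rw [hsymm c i j]
  have hmet : ∀ c, pdMat c G y = (L c)ᵀ * G y + G y * L c := by
    intro c
    have e1 : (L c)ᵀ * Jᵀ = (J * L c)ᵀ := (Matrix.transpose_mul _ _).symm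
    have e2 : (L c)ᵀ * G y + G y * L c =
        ((L c)ᵀ * Jᵀ) * G' (φ y) * J + Jᵀ * G' (φ y) * (J * L c) := by
      rw [h.eq_of_nhds, cong, ← hJ]; noncomm_ring
    rw [e2, e1, hJL, pdMat_cong_jac hφ hG'.smooth h, ← hJ]
    have e3 : ∑ k, J k c • pdMat k G' (φ y) =
        (∑ k, J k c • chr G' (φ y) k)ᵀ * G' (φ y) + G' (φ y) * ∑ k, J k c • chr G' (φ y) k := by
      rw [Matrix.transpose_sum, Finset.sum_mul, Finset.mul_sum, ← Finset.sum_add_distrib]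
      refine Finset.sum_congr rfl fun k _ => ?_
      rw [hG'.pdMat_eq, smul_add, Matrix.transpose_smul, Matrix.smul_mul, Matrix.mul_smul]
    rw [e3, Matrix.transpose_add, Matrix.transpose_mul]
    noncomm_ring
  rw [← hG.eq_chr hmet htors c, hJL]

/-- The covariant derivative is a tensor. -/
theorem covMat_cong_jac (hφ : ContDiffAt ℝ ∞ φ y) (h0 : (jac φ y).det ≠ 0) (hG : MetricAt G y)
    (hG' : MetricAt G' (φ y)) (h : G =ᶠ[𝓝 y] fun z => cong (jac φ z) (G' (φ z)))
    (hT' : SmoothMat T' (φ y)) (hT : T =ᶠ[𝓝 y] fun z => cong (jac φ z) (T' (φ z))) :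
    covMat G T y = pull (jac φ y) (covMat G' T' (φ y)) := by
  funext c
  have hc := chr_cong_jac hφ h0 hG hG' h c
  have e2 : (chr G y c)ᵀ * T y + T y * chr G y c =
      (jac φ y * chr G y c)ᵀ * T' (φ y) * jac φ y
        + (jac φ y)ᵀ * T' (φ y) * (jac φ y * chr G y c) := by
    rw [hT.eq_of_nhds, cong, Matrix.transpose_mul]; noncomm_ring
  have e4 : pull (jac φ y) (covMat G' T' (φ y)) c = (jac φ y)ᵀ *
      (∑ k, jac φ y k c • covMat G' T' (φ y) k) * jac φ y := by
    simp only [pull, cong, Finset.mul_sum, Finset.sum_mul, Matrix.mul_smul, Matrix.smul_mul]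
  have e3 : ∑ k, jac φ y k c • covMat G' T' (φ y) k = ∑ k, jac φ y k c • pdMat k T' (φ y) -
      (∑ k, jac φ y k c • chr G' (φ y) k)ᵀ * T' (φ y)
        - T' (φ y) * ∑ k, jac φ y k c • chr G' (φ y) k := by
    rw [Matrix.transpose_sum, Finset.sum_mul, Finset.mul_sum, ← Finset.sum_sub_distrib,
      ← Finset.sum_sub_distrib]
    refine Finset.sum_congr rfl fun k _ => ?_
    rw [covMat_eq, smul_sub, smul_sub, Matrix.transpose_smul, Matrix.smul_mul, Matrix.mul_smul]
  rw [covMat_eq, sub_sub, e2, hc, pdMat_cong_jac hφ hT' hT, e4, e3, Matrix.transpose_add,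
    Matrix.transpose_mul]
  noncomm_ring

/-- The Rainich form is a 1-form. -/
theorem rainich_cong_jac (hφ : ContDiffAt ℝ ∞ φ y) (h0 : 0 < (jac φ y).det) (hG : MetricAt G y)
    (hG' : MetricAt G' (φ y)) (h : G =ᶠ[𝓝 y] fun z => cong (jac φ z) (G' (φ z)))
    (hT' : SmoothMat T' (φ y)) (hT : T =ᶠ[𝓝 y] fun z => cong (jac φ z) (T' (φ z))) (d : Fin 4) :
    rainich G T y d = ∑ l, jac φ y l d * rainich G' T' (φ y) l := by
  rw [rainich_eq, rainich_eq, covMat_cong_jac hφ h0.ne' hG hG' h hT' hT, h.eq_of_nhds,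
    hT.eq_of_nhds, rainichForm_pull h0]

end

/-! ### Components in charts -/

section Charts

variable {M : Type*} [TopologicalSpace M]

/-- The change of coordinates from the chart `e` to the chart `e'`. -/
def trans (e e' : OpenPartialHomeomorph M E4) (y : E4) : E4 := e' (e.symm y)

theorem det_jac (φ : E4 → E4) (y : E4) : (jac φ y).det = (fderiv ℝ φ y).det := by
  rw [ContinuousLinearMap.det, ← LinearMap.det_toMatrix (EuclideanSpace.basisFun (Fin 4) ℝ).toBasis]
  congr 1

theorem eventually_mem_source {e : OpenPartialHomeomorph M E4} {y : E4} (hy : y ∈ e.target)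
    {s : Set M} (hs : IsOpen s) (hys : e.symm y ∈ s) :
    ∀ᶠ z in 𝓝 y, z ∈ e.target ∧ e.symm z ∈ s :=
  (e.open_target.eventually_mem hy).and
    ((e.continuousAt_symm hy).eventually (hs.eventually_mem hys))

theorem jac_trans_self {e : OpenPartialHomeomorph M E4} {y : E4} (hy : y ∈ e.target) :
    jac (trans e e) y = 1 := by
  have h : trans e e =ᶠ[𝓝 y] id := by
    filter_upwards [e.open_target.mem_nhds hy] with z hz
    exact e.right_inv hz
  ext i j
  simp only [jac, Matrix.of_apply, h.fderiv_eq, fderiv_id]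
  simp [Matrix.one_apply]

variable [ChartedSpace E4 M]

theorem IsOrientedAtlas.det_pos (hM : IsOrientedAtlas M) {e e' : OpenPartialHomeomorph M E4}
    (he : e ∈ atlas E4 M) (he' : e' ∈ atlas E4 M) {y : E4} (hy : y ∈ e.target)
    (hy' : e.symm y ∈ e'.source) : 0 < (jac (trans e e') y).det := by
  rw [det_jac]
  exact hM e he e' he' y hy hy'

theorem contDiffAt_trans [IsManifold (𝓡 4) ∞ M] {e e' : OpenPartialHomeomorph M E4}
    (he : e ∈ atlas E4 M) (he' : e' ∈ atlas E4 M) {y : E4} (hy : y ∈ e.target)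
    (hy' : e.symm y ∈ e'.source) : ContDiffAt ℝ ∞ (trans e e') y := by
  have h1 := (contMDiffOn_symm_of_mem_maximalAtlas (I := 𝓡 4) (n := ∞)
    (IsManifold.subset_maximalAtlas he)).contMDiffAt (e.open_target.mem_nhds hy)
  have h2 := (contMDiffOn_of_mem_maximalAtlas (I := 𝓡 4) (n := ∞)
    (IsManifold.subset_maximalAtlas he')).contMDiffAt (e'.open_source.mem_nhds hy')
  exact contMDiffAt_iff_contDiffAt.1 (h2.comp y h1)

theorem jac_trans [IsManifold (𝓡 4) ∞ M] {e e' e'' : OpenPartialHomeomorph M E4}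
    (he : e ∈ atlas E4 M) (he' : e' ∈ atlas E4 M) (he'' : e'' ∈ atlas E4 M) {y : E4}
    (hy : y ∈ e.target) (hy' : e.symm y ∈ e'.source) (hy'' : e.symm y ∈ e''.source) :
    jac (trans e e'') y = jac (trans e' e'') (trans e e' y) * jac (trans e e') y := by
  have hs : e'.symm (trans e e' y) = e.symm y := e'.left_inv hy'
  have h1 := (contDiffAt_trans he he' hy hy').differentiableAt (by simp)
  have h2 := (contDiffAt_trans he' he'' (e'.map_source hy') (by rwa [← hs] at hy'')).differentiableAt
    (by simp)
  have h3 : trans e e'' =ᶠ[𝓝 y] trans e' e'' ∘ trans e e' := by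
    filter_upwards [eventually_mem_source hy e'.open_source hy'] with z hz
    simp only [trans, Function.comp, e'.left_inv hz.2]
  have h4 : fderiv ℝ (trans e e'') y =
      (fderiv ℝ (trans e' e'') (trans e e' y)).comp (fderiv ℝ (trans e e') y) := by
    rw [h3.fderiv_eq, fderiv_comp y h2 h1]
  ext i j
  simp only [jac, Matrix.of_apply, h4, Matrix.mul_apply, ContinuousLinearMap.comp_apply]
  have hv : fderiv ℝ (trans e e') y (EuclideanSpace.single j 1) =
      ∑ k, fderiv ℝ (trans e e') y (EuclideanSpace.single j 1) k •
        EuclideanSpace.single k (1 : ℝ) := by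
    ext l
    simp [Finset.sum_apply, Pi.single_apply]
  conv_lhs => rw [hv]
  simp [mul_comm]

/-- The differential of `e.symm` is, by definition, read in the preferred chart at the image point,
hence is the derivative of a transition map. -/
theorem coordVec_eq [IsManifold (𝓡 4) ∞ M] {e : OpenPartialHomeomorph M E4}
    (he : e ∈ atlas E4 M) {y : E4} (hy : y ∈ e.target) (i : Fin 4) :
    coordVec e y i =
      ∑ k, jac (trans e (chartAt E4 (e.symm y))) y k i • stdBasis (e.symm y) k := by
  have h1 : MDifferentiableAt (𝓡 4) (𝓡 4) e.symm y :=
    ((contMDiffOn_symm_of_mem_maximalAtlas (I := 𝓡 4) (n := ∞)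
      (IsManifold.subset_maximalAtlas he)).contMDiffAt
        (e.open_target.mem_nhds hy)).mdifferentiableAt (by simp)
  have h2 : coordVec e y i =
      fderiv ℝ (trans e (chartAt E4 (e.symm y))) y (EuclideanSpace.single i (1 : ℝ)) := by
    have h3 : (mfderiv (𝓡 4) (𝓡 4) e.symm y : E4 →L[ℝ] E4) =
        fderiv ℝ (trans e (chartAt E4 (e.symm y))) y := by
      refine h1.mfderiv.trans ?_
      simp only [writtenInExtChartAt, mfld_simps]
      exact congrFun (fderivWithin_univ (𝕜 := ℝ) (E := E4) (F := E4)) y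
    exact congrArg (fun f : E4 →L[ℝ] E4 => f (EuclideanSpace.single i (1 : ℝ))) h3
  rw [h2]
  have h3 : ∀ v : E4, v = ∑ k, v k • (EuclideanSpace.basisFun (Fin 4) ℝ).toBasis k := by
    intro v
    ext l
    simp [Finset.sum_apply, Pi.single_apply]
  exact h3 _

/-- Links the two kinds of components by a congruence, so that every equivariant pointwise statement
passes between the preferred chart and an arbitrary one. -/
theorem comp_eq [IsManifold (𝓡 4) ∞ M] {e : OpenPartialHomeomorph M E4}
    (he : e ∈ atlas E4 M) {y : E4} (hy : y ∈ e.target) (T : Tensor2 M) :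
    comp e T y = cong (jac (trans e (chartAt E4 (e.symm y))) y) (compAt T (e.symm y)) := by
  ext i j
  rw [cong_apply]
  simp only [comp, Matrix.of_apply, coordVec_eq he hy, map_sum, LinearMap.sum_apply, map_smul,
    LinearMap.smul_apply, smul_eq_mul, compAt, Finset.mul_sum, mul_assoc]
  rw [Finset.sum_comm]
  exact Finset.sum_congr rfl fun _ _ => Finset.sum_congr rfl fun _ _ => mul_left_comm _ _ _

theorem comp_trans [IsManifold (𝓡 4) ∞ M] {e e' : OpenPartialHomeomorph M E4}
    (he : e ∈ atlas E4 M) (he' : e' ∈ atlas E4 M) {y : E4} (hy : y ∈ e.target)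
    (hy' : e.symm y ∈ e'.source) (T : Tensor2 M) :
    comp e T y = cong (jac (trans e e') y) (comp e' T (trans e e' y)) := by
  have hs : e'.symm (trans e e' y) = e.symm y := e'.left_inv hy'
  rw [comp_eq he hy, comp_eq he' (y := trans e e' y) (e'.map_source hy'), cong_cong, hs,
    jac_trans he he' (chart_mem_atlas E4 _) hy hy' (mem_chart_source E4 _)]

theorem comp_trans_eventually [IsManifold (𝓡 4) ∞ M] {e e' : OpenPartialHomeomorph M E4}
    (he : e ∈ atlas E4 M) (he' : e' ∈ atlas E4 M) {y : E4} (hy : y ∈ e.target)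
    (hy' : e.symm y ∈ e'.source) (T : Tensor2 M) :
    comp e T =ᶠ[𝓝 y] fun z => cong (jac (trans e e') z) (comp e' T (trans e e' z)) := by
  filter_upwards [eventually_mem_source hy e'.open_source hy'] with z hz
  exact comp_trans he he' hz.1 hz.2 T

theorem eq_sum_compAt (T : Tensor2 M) (x : M) (u v : TangentSpace (𝓡 4) x) :
    T x u v = (stdBasis x).repr u ⬝ᵥ compAt T x *ᵥ (stdBasis x).repr v := by
  conv_lhs => rw [← (stdBasis x).sum_repr u, ← (stdBasis x).sum_repr v]
  simp only [map_sum, LinearMap.sum_apply, map_smul, LinearMap.smul_apply, smul_eq_mul,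
    dotProduct, Matrix.mulVec, compAt, Matrix.of_apply, Finset.mul_sum]
  rw [Finset.sum_comm]
  exact Finset.sum_congr rfl fun _ _ => Finset.sum_congr rfl fun _ _ => by ring

theorem SmoothOn.smoothMat {T : Tensor2 M} {W : Set M} (hT : SmoothOn T W) (hW : IsOpen W)
    {e : OpenPartialHomeomorph M E4} (he : e ∈ atlas E4 M) {y : E4} (hy : y ∈ e.target)
    (hyW : e.symm y ∈ W) : SmoothMat (comp e T) y := fun i j =>
  (hT e he i j).contDiffAt (eventually_mem_source hy hW hyW)

theorem compAt_toBilin (F : M → Mat4) (x : M) :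
    compAt (fun z => Matrix.toBilin (stdBasis z) (F z)) x = F x := by
  ext i j
  simp [compAt, Matrix.toBilin_apply, Finsupp.single_apply]

end Charts

/-! ### Smoothness -/

namespace MetricAt

variable {G T X Y : E4 → Mat4} {y : E4}

theorem smooth_raise (hG : MetricAt G y) (hX : SmoothMat X y) :
    SmoothMat (fun z => raise (G z) (X z)) y :=
  ((hG.smooth.inv hG.det_ne).mul hX).mul (hG.smooth.inv hG.det_ne).transpose

theorem smooth_vol (hG : MetricAt G y) (a b c d : Fin 4) :
    ContDiffAt ℝ ∞ (fun z => vol (G z) a b c d) y :=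
  (hG.smooth.det.neg.sqrt (neg_ne_zero.2 hG.det_ne)).mul contDiffAt_const

theorem smooth_hodge (hG : MetricAt G y) (hX : SmoothMat X y) :
    SmoothMat (fun z => hodge (G z) (X z)) y := fun a b =>
  contDiffAt_const.mul (ContDiffAt.sum fun c _ => ContDiffAt.sum fun d _ =>
    (hG.smooth_vol a b c d).mul (hG.smooth_raise hX c d))

theorem smooth_form2Inner (hG : MetricAt G y) (hX : SmoothMat X y) (hY : SmoothMat Y y) :
    ContDiffAt ℝ ∞ (fun z => form2Inner (G z) (X z) (Y z)) y :=
  contDiffAt_const.mul (ContDiffAt.sum fun a _ => ContDiffAt.sum fun b _ =>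
    (hX a b).mul (hG.smooth_raise hY a b))

theorem smooth_doubleWedgeEnd (hG : MetricAt G y) (hT : SmoothMat T y) (hX : SmoothMat X y) :
    SmoothMat (fun z => doubleWedgeEnd (G z) (T z) (X z)) y := fun a b =>
  contDiffAt_const.mul (ContDiffAt.sum fun m _ => ContDiffAt.sum fun n _ =>
    (((((hT a m).mul (hG.smooth b n)).add ((hT b n).mul (hG.smooth a m))).sub
      ((hT a n).mul (hG.smooth b m))).sub ((hT b m).mul (hG.smooth a n))).mul
        (hG.smooth_raise hX m n))

theorem smooth_Q (hG : MetricAt G y) (hT : SmoothMat T y) (hX : SmoothMat X y)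
    (h : 0 < tr (G y) (mul (G y) (T y) (T y))) : SmoothMat (fun z => Q (G z) (T z) (X z)) y := by
  have hD := hG.smooth_doubleWedgeEnd hT hX
  exact hD.sub (SmoothMat.smul (contDiffAt_const.div
    ((hG.smooth_tr (hG.smooth_mul hT hT)).sqrt h.ne') (Real.sqrt_pos.2 h).ne')
      (hG.smooth_doubleWedgeEnd hT hD))

theorem smooth_QQ (hG : MetricAt G y) (hT : SmoothMat T y) (hX : SmoothMat X y)
    (h : 0 < tr (G y) (mul (G y) (T y) (T y))) :
    ContDiffAt ℝ ∞ (fun z => QQ (G z) (T z) (X z)) y :=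
  hG.smooth_form2Inner (hG.smooth_Q hT hX h) hX

theorem smooth_rotated (hG : MetricAt G y) (hT : SmoothMat T y) (hX : SmoothMat X y)
    (h : 0 < tr (G y) (mul (G y) (T y) (T y))) (hQ : 0 < QQ (G y) (T y) (X y)) {ψ : E4 → ℝ}
    (hψ : ContDiffAt ℝ ∞ ψ y) : SmoothMat (fun z => rotated (G z) (T z) (X z) (ψ z)) y := by
  have h2 : 0 < 2 * QQ (G y) (T y) (X y) := by positivity
  have hs : SmoothMat (fun z => simpleForm (G z) (T z) (X z)) y :=
    SmoothMat.smul (contDiffAt_const.div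
      ((contDiffAt_const.mul (hG.smooth_QQ hT hX h)).sqrt h2.ne') (Real.sqrt_pos.2 h2).ne')
      (hG.smooth_Q hT hX h)
  exact (SmoothMat.smul hψ.cos hs).add (SmoothMat.smul hψ.sin (hG.smooth_hodge hs))

theorem smooth_covD (hG : MetricAt G y) (hT : SmoothMat T y) (c a b : Fin 4) :
    ContDiffAt ℝ ∞ (fun z => covD G T z c a b) y := by
  have hK := hG.smooth.inv hG.det_ne
  have hp := fun c i j => smooth_pd c (hG.smooth i j)
  have hΓ : ∀ k i j, ContDiffAt ℝ ∞ (fun z => christoffel G z k i j) y := fun k i j =>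
    contDiffAt_const.mul (ContDiffAt.sum fun l _ =>
      (hK k l).mul (((hp i j l).add (hp j i l)).sub (hp l i j)))
  exact ((smooth_pd c (hT a b)).sub (ContDiffAt.sum fun d _ => (hΓ d c a).mul (hT d b))).sub
    (ContDiffAt.sum fun d _ => (hΓ d c b).mul (hT a d))

theorem smooth_rainich (hG : MetricAt G y) (hT : SmoothMat T y)
    (h : tr (G y) (mul (G y) (T y) (T y)) ≠ 0) (d : Fin 4) :
    ContDiffAt ℝ ∞ (fun z => rainich G T z d) y := by
  have hK := hG.smooth.inv hG.det_ne
  exact (contDiffAt_const.div (hG.smooth_tr (hG.smooth_mul hT hT)) h).mul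
    (ContDiffAt.sum fun a _ => ContDiffAt.sum fun b _ => ContDiffAt.sum fun c _ =>
      (hG.smooth_vol a b c d).mul (ContDiffAt.sum fun a' _ => ContDiffAt.sum fun b' _ =>
        ContDiffAt.sum fun c' _ => (((hK a a').mul (hK b b')).mul (hK c c')).mul
          (ContDiffAt.sum fun m _ => ContDiffAt.sum fun n _ =>
            ((hG.smooth_covD hT a' b' m).mul (hK m n)).mul (hT n c'))))

end MetricAt

/-- A closed smooth 1-form on a convex open set is exact. -/
theorem exists_potential {s : Set E4} (hs : Convex ℝ s) (ho : IsOpen s) {θ : Fin 4 → E4 → ℝ}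
    (hθ : ∀ i, ∀ y ∈ s, ContDiffAt ℝ ∞ (θ i) y)
    (hc : ∀ y ∈ s, ∀ a b, pd a (θ b) y = pd b (θ a) y) :
    ∃ f : E4 → ℝ, ∀ y ∈ s, ContDiffAt ℝ ∞ f y ∧ ∀ i, pd i f y = θ i y := by
  let pr : Fin 4 → E4 →L[ℝ] ℝ := fun i => EuclideanSpace.proj i
  let w : E4 → E4 →L[ℝ] ℝ := fun y => ∑ i, θ i y • pr i
  have hw : ∀ y ∈ s, ContDiffAt ℝ ∞ w y := fun y hy =>
    ContDiffAt.sum fun i _ => (hθ i y hy).smul contDiffAt_const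
  have hwd : ∀ a ∈ s, ∀ u v : E4, fderiv ℝ w a u v = ∑ i, (fderiv ℝ (θ i) a u) * v i := by
    intro a ha u v
    have h1 : HasFDerivAt w (∑ i, (fderiv ℝ (θ i) a).smulRight (pr i)) a :=
      HasFDerivAt.fun_sum fun i _ =>
        (differentiableAt_of_smooth (hθ i a ha)).hasFDerivAt.smul_const (pr i)
    rw [h1.fderiv]
    simp [pr]
  -- The Poincaré lemma on a convex set; closedness of θ is the symmetry of the derivative of the
  -- field `w` of covectors.
  obtain ⟨f, hf⟩ := hs.exists_forall_hasFDerivAt_of_fderiv_symmetric (𝕜 := ℝ) ho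
    (show DifferentiableOn ℝ w s from fun y hy =>
      ((hw y hy).differentiableAt (by simp)).differentiableWithinAt) (by
      intro a ha u v
      rw [hwd a ha, hwd a ha]
      simp only [fderiv_eq_sum_pd (θ _) a, Finset.sum_mul]
      rw [Finset.sum_comm]
      refine Finset.sum_congr rfl fun i _ => Finset.sum_congr rfl fun j _ => ?_
      rw [hc a ha i j]
      ring)
  refine ⟨f, fun y hy => ⟨?_, fun i => ?_⟩⟩
  -- The potential is smooth because its derivative is the smooth field `w`.
  · have h1 : ContDiffOn ℝ (∞ + 1) f s := by
      rw [contDiffOn_succ_iff_fderiv_of_isOpen ho]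
      refine ⟨fun z hz => (hf z hz).differentiableAt.differentiableWithinAt, by simp, ?_⟩
      exact ContDiffOn.congr (fun z hz => (hw z hz).contDiffWithinAt) fun z hz => (hf z hz).fderiv
    exact (h1.of_le (by simp)).contDiffAt (ho.mem_nhds hy)
  · rw [pd, (hf y hy).fderiv]
    simp [w, pr]

/-! ### Tensor fields on an oriented Lorentzian manifold -/

theorem AlgebraicAt.cong {G P J : Mat4} (h : AlgebraicAt G P) (hJ : IsUnit J.det) :
    AlgebraicAt (cong J G) (CKY.cong J P) where
  trace := by rw [tr_cong hJ, h.trace]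
  square := by rw [mul_cong hJ, tr_cong hJ, ← cong_smul, ← cong_smul, h.square]
  square_ne := by rw [mul_cong hJ, tr_cong hJ]; exact h.square_ne
  timelike v hv := by
    rw [dotProduct_cong] at hv ⊢
    exact h.timelike _ hv

section Fields

variable {M : Type*} [TopologicalSpace M] [ChartedSpace E4 M]
  {g P A X : Tensor2 M} {W : Set M} {ψ : M → ℝ} {e : OpenPartialHomeomorph M E4} {y : E4}

theorem algebraicConditions_iff :
    AlgebraicConditions g P ↔ ∀ x, AlgebraicAt (compAt g x) (compAt P x) := by
  constructor
  · intro h x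
    refine ⟨h.trace x, h.square x, h.square_ne x, fun v hv => ?_⟩
    have hv' : (stdBasis x).repr ((stdBasis x).equivFun.symm v) = v := by
      ext i
      exact congrFun ((stdBasis x).equivFun.apply_symm_apply v) i
    have := h.timelike x ((stdBasis x).equivFun.symm v)
    rw [eq_sum_compAt, eq_sum_compAt, hv'] at this
    exact this hv
  · intro h
    refine ⟨fun x => (h x).trace, fun x => (h x).square, fun x => (h x).square_ne, fun x v hv => ?_⟩
    rw [eq_sum_compAt] at hv ⊢
    exact (h x).timelike _ hv

theorem IsLorentzMetric.lorentz_compAt (hg : IsLorentzMetric g) (x : M) :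
    IsLorentz (compAt g x) := by
  obtain ⟨b, hb⟩ := hg.signature x
  refine ⟨Matrix.of fun k i => (stdBasis x).repr (b i) k, ?_⟩
  ext i j
  have h := hb i j
  rw [eq_sum_compAt] at h
  have h1 : CKY.cong (Matrix.of fun k i => (stdBasis x).repr (b i) k) (compAt g x) i j =
      (stdBasis x).repr (b i) ⬝ᵥ compAt g x *ᵥ (stdBasis x).repr (b j) := by
    rw [cong_apply]
    simp only [dotProduct, Matrix.mulVec, Finset.mul_sum, Matrix.of_apply]
    exact Finset.sum_congr rfl fun _ _ => Finset.sum_congr rfl fun _ _ => by ring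
  rw [h1, h]
  fin_cases i <;> fin_cases j <;> simp [eta]

theorem IsSymmTensor.transpose_compAt (hP : IsSymmTensor P) (x : M) :
    (compAt P x)ᵀ = compAt P x := by
  ext i j
  exact hP.symm x _ _

theorem IsTwoFormOn.transpose_compAt (hA : IsTwoFormOn W A) {x : M} (hx : x ∈ W) :
    (compAt A x)ᵀ = -compAt A x := by
  ext i j
  exact hA.skew x hx _ _

theorem compAt_rotatedForm (x : M) : compAt (rotatedForm g P X ψ) x =
    rotated (compAt g x) (-compAt P x) (compAt X x) (ψ x) :=
  compAt_toBilin _ x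

theorem IsOrientedAtlas.comp_pos (hM : IsOrientedAtlas M) (he : e ∈ atlas E4 M)
    (hy : y ∈ e.target) : 0 < (jac (trans e (chartAt E4 (e.symm y))) y).det :=
  hM.det_pos he (chart_mem_atlas E4 _) hy (mem_chart_source E4 _)

theorem IsSymmTensor.smoothMat (hP : IsSymmTensor P) (he : e ∈ atlas E4 M) (hy : y ∈ e.target) :
    SmoothMat (comp e P) y :=
  hP.smooth.smoothMat isOpen_univ he hy (Set.mem_univ _)

theorem IsLocallyTracelessSquareOfCKY.algebraicConditions
    (h : IsLocallyTracelessSquareOfCKY g P) (hg : IsLorentzMetric g) :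
    AlgebraicConditions g P := by
  rw [algebraicConditions_iff]
  intro x
  obtain ⟨W, -, hx, A, hA, hreg, hPA⟩ := h x
  rw [hPA x hx]
  exact algebraicAt_tracelessSquare (hg.lorentz_compAt x) (hA.transpose_compAt hx) (hreg x hx)

theorem isTracelessSquareOn_rotatedForm (hg : IsLorentzMetric g) (hP : IsSymmTensor P)
    (h : AlgebraicConditions g P) (hX : IsAdmissibleOn g P W X) :
    IsTracelessSquareOn g W P (rotatedForm g P X ψ) := fun x hx => by
  rw [compAt_rotatedForm, ((algebraicConditions_iff.1 h x).rotated (hg.lorentz_compAt x)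
      (hP.transpose_compAt x) (hX.transpose_compAt hx) (hX.ne_zero x hx) _).2.2.1]

theorem isRegularOn_rotatedForm (hg : IsLorentzMetric g) (hP : IsSymmTensor P)
    (h : AlgebraicConditions g P) (hX : IsAdmissibleOn g P W X) :
    IsRegularOn g W (rotatedForm g P X ψ) := fun x hx => by
  obtain ⟨-, -, -, hu, hv⟩ := (algebraicConditions_iff.1 h x).rotated (hg.lorentz_compAt x)
      (hP.transpose_compAt x) (hX.transpose_compAt hx) (hX.ne_zero x hx) (ψ x)
  rw [compAt_rotatedForm]
  exact regular_of_invariants (Real.sqrt_pos.2 ((algebraicConditions_iff.1 h x).tr_pos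
    (hg.lorentz_compAt x) (hP.transpose_compAt x))).ne' hu hv

/-- The 2-form with constant components `X₀` in the chart `e`. -/
def constForm (e : OpenPartialHomeomorph M E4) (X₀ : Mat4) : Tensor2 M := fun x =>
  Matrix.toBilin (stdBasis x) (cong (jac (trans (chartAt E4 x) e) (chartAt E4 x x)) X₀)

theorem compAt_constForm (e : OpenPartialHomeomorph M E4) (X₀ : Mat4) (x : M) :
    compAt (constForm e X₀) x = cong (jac (trans (chartAt E4 x) e) (chartAt E4 x x)) X₀ :=
  compAt_toBilin _ x

variable [IsManifold (𝓡 4) ∞ M]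

theorem comp_rotatedForm (hM : IsOrientedAtlas M) (he : e ∈ atlas E4 M) (hy : y ∈ e.target) :
    comp e (rotatedForm g P X ψ) y =
      rotated (comp e g y) (-comp e P y) (comp e X y) (ψ (e.symm y)) := by
  simp only [comp_eq he hy, compAt_rotatedForm]
  rw [← cong_neg, rotated_cong (hM.comp_pos he hy)]

theorem IsLorentzMetric.lorentz_comp (hg : IsLorentzMetric g) (hM : IsOrientedAtlas M)
    (he : e ∈ atlas E4 M) (hy : y ∈ e.target) : IsLorentz (comp e g y) := by
  rw [comp_eq he hy]
  exact (hg.lorentz_compAt _).cong (hM.comp_pos he hy).ne'.isUnit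

theorem IsLorentzMetric.metricAt (hg : IsLorentzMetric g) (hM : IsOrientedAtlas M)
    (he : e ∈ atlas E4 M) (hy : y ∈ e.target) : MetricAt (comp e g) y where
  smooth := hg.smooth.smoothMat isOpen_univ he hy (Set.mem_univ _)
  symm := by
    filter_upwards [e.open_target.mem_nhds hy] with z hz
    exact (hg.lorentz_comp hM he hz).symm
  det_neg := (hg.lorentz_comp hM he hy).det_neg

theorem IsSymmTensor.transpose_comp (hP : IsSymmTensor P) (he : e ∈ atlas E4 M)
    (hy : y ∈ e.target) : (comp e P y)ᵀ = comp e P y := by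
  rw [comp_eq he hy, cong_transpose, hP.transpose_compAt]

theorem IsTwoFormOn.transpose_comp (hA : IsTwoFormOn W A) (he : e ∈ atlas E4 M)
    (hy : y ∈ e.target) (hyW : e.symm y ∈ W) : (comp e A y)ᵀ = -comp e A y := by
  rw [comp_eq he hy, cong_transpose, hA.transpose_compAt hyW, cong_neg]

theorem IsTwoFormOn.formAt (hA : IsTwoFormOn W A) (hg : IsLorentzMetric g)
    (hM : IsOrientedAtlas M) (hW : IsOpen W) (he : e ∈ atlas E4 M) (hy : y ∈ e.target)
    (hyW : e.symm y ∈ W) : FormAt (comp e g) (comp e A) y where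
  smooth_metric := (hg.metricAt hM he hy).smooth
  lorentz := by
    filter_upwards [e.open_target.mem_nhds hy] with z hz
    exact hg.lorentz_comp hM he hz
  smooth := hA.smooth.smoothMat hW he hy hyW
  skew := by
    filter_upwards [eventually_mem_source hy hW hyW] with z hz
    exact hA.transpose_comp he hz.1 hz.2

theorem AlgebraicConditions.algebraicAt (h : AlgebraicConditions g P) (hM : IsOrientedAtlas M)
    (he : e ∈ atlas E4 M) (hy : y ∈ e.target) : AlgebraicAt (comp e g y) (comp e P y) := by
  rw [comp_eq he hy, comp_eq he hy]
  exact (algebraicConditions_iff.1 h _).cong (hM.comp_pos he hy).ne'.isUnit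

theorem IsRegularOn.regular (hA : IsRegularOn g W A) (hM : IsOrientedAtlas M)
    (he : e ∈ atlas E4 M) (hy : y ∈ e.target) (hyW : e.symm y ∈ W) :
    Regular (comp e g y) (comp e A y) := by
  have hJ := hM.comp_pos he hy
  rw [Regular, comp_eq he hy, comp_eq he hy, hodge_cong hJ, form2Inner_cong hJ.ne'.isUnit,
    form2Inner_cong hJ.ne'.isUnit]
  exact hA _ hyW

theorem IsTracelessSquareOn.comp_eventuallyEq (hPA : IsTracelessSquareOn g W P A)
    (hM : IsOrientedAtlas M) (hW : IsOpen W) (he : e ∈ atlas E4 M) (hy : y ∈ e.target)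
    (hyW : e.symm y ∈ W) :
    comp e P =ᶠ[𝓝 y] fun z => tracelessSquare (comp e g z) (comp e A z) := by
  filter_upwards [eventually_mem_source hy hW hyW] with z hz
  rw [comp_eq he hz.1, comp_eq he hz.1, comp_eq he hz.1,
    tracelessSquare_cong (hM.comp_pos he hz.1).ne'.isUnit, hPA _ hz.2]

/-! ### Necessity of the conditions -/

theorem IsLocallyTracelessSquareOfCKY.differentialConditions
    (h : IsLocallyTracelessSquareOfCKY g P) (hg : IsLorentzMetric g) (hM : IsOrientedAtlas M) :
    DifferentialConditions g P := by
  -- The identity between the Rainich form and the angle form is needed on a whole neighbourhood,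
  -- since closedness differentiates it.
  have key : ∀ e ∈ atlas E4 M, ∀ y ∈ e.target, ∃ A : Tensor2 M,
      ∀ᶠ z in 𝓝 y, FormAt (comp e g) (comp e A) z ∧ Regular (comp e g z) (comp e A z) ∧
        CKEq (comp e g) (comp e P) z ∧ ∀ l, rainich (comp e g) (comp e P) z l =
          angleForm (comp e g z) (comp e A z) (covMat (comp e g) (comp e A) z) l := by
    intro e he y hy
    obtain ⟨W, hW, hyW, A, hA, hreg, hPA⟩ := h (e.symm y)
    refine ⟨A, ?_⟩
    filter_upwards [eventually_mem_source hy hW hyW] with z hz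
    have hF := hA.formAt hg hM hW he hz.1 hz.2
    have hr := hreg.regular hM he hz.1 hz.2
    exact ⟨hF, hr, (hF.ckyEq_iff hr (hPA.comp_eventuallyEq hM hW he hz.1 hz.2)).1
      (hA.cky e he z hz.1 hz.2)⟩
  constructor
  · intro e he y hy
    obtain ⟨A, hA⟩ := key e he y hy
    exact hA.self_of_nhds.2.2.1
  · intro e he y hy a b
    obtain ⟨A, hA⟩ := key e he y hy
    have hc : ∀ l, (fun z => rainich (comp e g) (comp e P) z l) =ᶠ[𝓝 y] fun z =>
        angleForm (comp e g z) (comp e A z) (covMat (comp e g) (comp e A) z) l := fun l =>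
      hA.mono fun z hz => hz.2.2.2 l
    rw [pd_congr (hc a), pd_congr (hc b)]
    exact FormAt.pd_angleForm_comm (hA.mono fun z hz => hz.1) hA.self_of_nhds.2.1 a b

/-! ### The conformal Killing-Yano tensor -/

theorem IsAdmissibleOn.QQ_comp_ne (hX : IsAdmissibleOn g P W X) (hM : IsOrientedAtlas M)
    (he : e ∈ atlas E4 M) (hy : y ∈ e.target) (hyW : e.symm y ∈ W) :
    QQ (comp e g y) (-comp e P y) (comp e X y) ≠ 0 := by
  rw [comp_eq he hy, comp_eq he hy, comp_eq he hy, ← cong_neg,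
    QQ_cong (hM.comp_pos he hy).ne'.isUnit]
  exact hX.ne_zero _ hyW

theorem IsRainichIndexOn.smoothAt (hψ : IsRainichIndexOn g P W ψ) (hW : IsOpen W)
    (he : e ∈ atlas E4 M) (hy : y ∈ e.target) (hyW : e.symm y ∈ W) :
    ContDiffAt ℝ ∞ (fun z => ψ (e.symm z)) y := by
  have h1 := (contMDiffOn_symm_of_mem_maximalAtlas (I := 𝓡 4) (n := ∞)
    (IsManifold.subset_maximalAtlas he)).contMDiffAt (e.open_target.mem_nhds hy)
  have h2 := hψ.smooth.contMDiffAt (hW.mem_nhds hyW)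
  exact contMDiffAt_iff_contDiffAt.1 (h2.comp y h1)

theorem tr_mul_neg_neg (G P : Mat4) : tr G (mul G (-P) (-P)) = tr G (mul G P P) := by
  simp [mul]

theorem isTwoFormOn_rotatedForm (hM : IsOrientedAtlas M) (hg : IsLorentzMetric g)
    (hP : IsSymmTensor P) (h : AlgebraicConditions g P) (hW : IsOpen W)
    (hψ : IsRainichIndexOn g P W ψ) (hX : IsAdmissibleOn g P W X) :
    IsTwoFormOn W (rotatedForm g P X ψ) where
  smooth e he i j := fun y hy => by
    obtain ⟨hy, hyW⟩ := hy
    have hG := hg.lorentz_comp hM he hy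
    have hPt := hP.transpose_comp he hy
    have hA := h.algebraicAt hM he hy
    -- Only the positivity of Q(X, X) is wanted here, so the angle 0 is an arbitrary choice.
    have hQ := (hA.rotated hG hPt (hX.transpose_comp he hy hyW)
      (hX.QQ_comp_ne hM he hy hyW) 0).1
    have ht := hA.tr_pos hG hPt
    rw [← tr_mul_neg_neg] at ht
    have hs : SmoothMat (comp e (rotatedForm g P X ψ)) y :=
      ((hg.metricAt hM he hy).smooth_rotated (hP.smoothMat he hy).neg
        (hX.smooth.smoothMat hW he hy hyW) ht hQ (hψ.smoothAt hW he hy hyW)).congr (by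
          filter_upwards [e.open_target.mem_nhds hy] with z hz
          exact comp_rotatedForm hM he hz)
    exact (hs i j).contDiffWithinAt
  skew x hx u v := by
    have hs := ((algebraicConditions_iff.1 h x).rotated (hg.lorentz_compAt x)
      (hP.transpose_compAt x) (hX.transpose_compAt hx) (hX.ne_zero x hx) (ψ x)).2.1
    rw [← compAt_rotatedForm] at hs
    rw [eq_sum_compAt, eq_sum_compAt, Matrix.dotProduct_mulVec, ← Matrix.mulVec_transpose, hs,
      Matrix.neg_mulVec, neg_dotProduct, dotProduct_comm]

theorem isCKYOn_rotatedForm (hM : IsOrientedAtlas M) (hg : IsLorentzMetric g)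
    (hP : IsSymmTensor P) (h : AlgebraicConditions g P) (hd : DifferentialConditions g P)
    (hW : IsOpen W) (hψ : IsRainichIndexOn g P W ψ) (hX : IsAdmissibleOn g P W X) :
    IsCKYOn g W (rotatedForm g P X ψ) where
  toIsTwoFormOn := isTwoFormOn_rotatedForm hM hg hP h hW hψ hX
  cky e he y hy hyW := by
    have hF := (isTwoFormOn_rotatedForm hM hg hP h hW hψ hX).formAt hg hM hW he hy hyW
    have hreg : Regular (comp e g y) (comp e (rotatedForm g P X ψ) y) :=
      (isRegularOn_rotatedForm hg hP h hX).regular hM he hy hyW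
    have hts := (isTracelessSquareOn_rotatedForm (ψ := ψ) hg hP h hX).comp_eventuallyEq
      hM hW he hy hyW
    rw [hF.ckyEq_iff hreg hts]
    -- The conformal Killing equation is assumed; the Rainich form is -2 dψ by hypothesis, and the
    -- angle form of the rotated form is -2 dψ by its invariants.
    refine ⟨hd.ck e he y hy, fun l => ?_⟩
    have hmet := hg.metricAt hM he hy
    have ht := (h.algebraicAt hM he hy).tr_pos (hg.lorentz_comp hM he hy)
      (hP.transpose_comp he hy)
    have hPs := hP.smoothMat he hy
    have hinv := (eventually_mem_source hy hW hyW).mono fun z hz =>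
      ((h.algebraicAt hM he hz.1).rotated (hg.lorentz_comp hM he hz.1)
        (hP.transpose_comp he hz.1) (hX.transpose_comp he hz.1 hz.2)
        (hX.QQ_comp_ne hM he hz.1 hz.2) (ψ (e.symm z))).2.2.2
    have hrot : ∀ᶠ z in 𝓝 y, comp e (rotatedForm g P X ψ) z =
        rotated (comp e g z) (-comp e P z) (comp e X z) (ψ (e.symm z)) := by
      filter_upwards [e.open_target.mem_nhds hy] with z hz
      exact comp_rotatedForm hM he hz
    rw [hF.angleForm_eq_of_invariants
      (r := fun z => Real.sqrt (tr (comp e g z) (mul (comp e g z) (comp e P z) (comp e P z))))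
      ((hmet.smooth_tr (hmet.smooth_mul hPs hPs)).sqrt ht.ne') (hψ.smoothAt hW he hy hyW)
      (Real.sqrt_pos.2 ht).ne', hψ.deriv_eq e he y hy hyW]
    · filter_upwards [hinv, hrot] with z hz hz'
      rw [hz']
      exact hz.1
    · filter_upwards [hinv, hrot] with z hz hz'
      rw [hz']
      exact hz.2

/-! ### Local existence -/

theorem comp_constForm {e' : OpenPartialHomeomorph M E4} (he : e ∈ atlas E4 M)
    (he' : e' ∈ atlas E4 M) (hy : y ∈ e.target) (hy' : e.symm y ∈ e'.source) (X₀ : Mat4) :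
    comp e (constForm e' X₀) y = cong (jac (trans e e') y) X₀ := by
  rw [comp_eq he hy, compAt_constForm, cong_cong,
    jac_trans he (chart_mem_atlas E4 (e.symm y)) he' hy (mem_chart_source E4 _) hy']
  rfl

theorem isTwoFormOn_constForm (he : e ∈ atlas E4 M) {X₀ : Mat4} (hX₀ : X₀ᵀ = -X₀)
    (hW : IsOpen W) (hWe : W ⊆ e.source) : IsTwoFormOn W (constForm e X₀) where
  smooth e' he' i j := fun y hy => by
    have hs : SmoothMat (comp e' (constForm e X₀)) y := by
      have hJ := smooth_jac (contDiffAt_trans he' he hy.1 (hWe hy.2))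
      refine ((hJ.transpose.mul (SmoothMat.const X₀)).mul hJ).congr ?_
      filter_upwards [eventually_mem_source hy.1 hW hy.2] with z hz
      exact comp_constForm he' he hz.1 (hWe hz.2) X₀
    exact (hs i j).contDiffWithinAt
  skew x _ u v := by
    have hs : (compAt (constForm e X₀) x)ᵀ = -compAt (constForm e X₀) x := by
      rw [compAt_constForm, cong_transpose, hX₀, cong_neg]
    rw [eq_sum_compAt, eq_sum_compAt, Matrix.dotProduct_mulVec, ← Matrix.mulVec_transpose, hs,
      Matrix.neg_mulVec, neg_dotProduct, dotProduct_comm]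

theorem exists_index_and_form (hM : IsOrientedAtlas M) (hg : IsLorentzMetric g)
    (hP : IsSymmTensor P) (h : AlgebraicConditions g P) (hd : DifferentialConditions g P)
    (x : M) : ∃ W : Set M, IsOpen W ∧ x ∈ W ∧ (∃ ψ : M → ℝ, IsRainichIndexOn g P W ψ) ∧
      ∃ X : Tensor2 M, IsAdmissibleOn g P W X := by
  set e := chartAt E4 x with he_def
  have he : e ∈ atlas E4 M := chart_mem_atlas E4 x
  have hx : x ∈ e.source := mem_chart_source E4 x
  have hex := e.map_source hx
  have hlor := fun {y} (hy : y ∈ e.target) => hg.lorentz_comp hM he hy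
  have hPt := fun {y} (hy : y ∈ e.target) => hP.transpose_comp he hy
  have hA := fun {y} (hy : y ∈ e.target) => h.algebraicAt hM he hy
  have hmet := fun {y} (hy : y ∈ e.target) => hg.metricAt hM he hy
  have hPs := fun {y} (hy : y ∈ e.target) => hP.smoothMat he hy
  obtain ⟨X₀, hX₀, hQ⟩ := (hA hex).exists_QQ_ne_zero (hlor hex) (hPt hex)
  have ht := (hA hex).tr_pos (hlor hex) (hPt hex)
  rw [← tr_mul_neg_neg] at ht
  -- A form chosen at the centre and extended with constant components stays admissible nearby by
  -- continuity; a coordinate ball is then taken for its convexity.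
  have hev : ∀ᶠ z in 𝓝 (e x), z ∈ e.target ∧ QQ (comp e g z) (-comp e P z) X₀ ≠ 0 :=
    (e.open_target.eventually_mem hex).and
      (((hmet hex).smooth_QQ (hPs hex).neg (SmoothMat.const X₀) ht).continuousAt.eventually_ne hQ)
  obtain ⟨ε, hε, hball⟩ := Metric.eventually_nhds_iff_ball.1 hev
  obtain ⟨f, hf⟩ := exists_potential (convex_ball (e x) ε) Metric.isOpen_ball
    (θ := fun i z => -(1 / 2) * rainich (comp e g) (comp e P) z i)
    (fun i y hy => contDiffAt_const.mul ((hmet (hball y hy).1).smooth_rainich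
      (hPs (hball y hy).1) (hA (hball y hy).1).square_ne i))
    (fun y hy a b => by
      have hr := fun i => differentiableAt_of_smooth ((hmet (hball y hy).1).smooth_rainich
        (hPs (hball y hy).1) (hA (hball y hy).1).square_ne i)
      rw [pd_mul a (differentiableAt_const _) (hr b), pd_mul b (differentiableAt_const _) (hr a),
        pd_const, pd_const, hd.closed e he y (hball y hy).1 a b, zero_mul, zero_mul])
  have hW : IsOpen (e.source ∩ e ⁻¹' Metric.ball (e x) ε) :=
    e.isOpen_inter_preimage Metric.isOpen_ball
  refine ⟨_, hW, ⟨hx, Metric.mem_ball_self hε⟩, ⟨fun z => f (e z), ?_, ?_⟩,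
    constForm e X₀, isTwoFormOn_constForm he hX₀ hW Set.inter_subset_left, ?_⟩
  · intro z hz
    have h1 := (contMDiffOn_of_mem_maximalAtlas (I := 𝓡 4) (n := ∞)
      (IsManifold.subset_maximalAtlas he)).contMDiffAt (e.open_source.mem_nhds hz.1)
    have h2 : ContMDiffAt (𝓡 4) 𝓘(ℝ, ℝ) ∞ f (e z) := contMDiffAt_iff_contDiffAt.2 (hf _ hz.2).1
    exact (h2.comp z h1).contMDiffWithinAt
  · intro e' he' y hy hyW a
    -- The potential solves the equation in the chart `e`. For every other chart of the atlas the
    -- tensoriality of the Rainich form is required, and with it that of ∇.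
    have hφ := contDiffAt_trans he' he hy hyW.1
    have ht' : trans e' e y ∈ e.target := e.map_source hyW.1
    rw [rainich_cong_jac hφ (hM.det_pos he' he hy hyW.1) (hg.metricAt hM he' hy) (hmet ht')
      (comp_trans_eventually he' he hy hyW.1 g) (hPs ht')
      (comp_trans_eventually he' he hy hyW.1 P)]
    have h3 := pd_comp hφ (differentiableAt_of_smooth (hf _ hyW.2).1) a
    rw [show pd a (fun z => f (e (e'.symm z))) y = _ from h3, Finset.mul_sum]
    refine Finset.sum_congr rfl fun k _ => ?_
    rw [(hf (trans e' e y) hyW.2).2 k]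
    ring
  · intro z hz
    have hez := e.map_source hz.1
    have hs := e.left_inv hz.1
    have h1 := (hball _ hz.2).2
    have h2 : comp e (constForm e X₀) (e z) = X₀ := by
      rw [comp_constForm he he hez (by rw [hs]; exact hz.1), jac_trans_self hez, cong_one]
    rw [← h2, comp_eq he hez, comp_eq he hez, comp_eq he hez, ← cong_neg,
      QQ_cong (hM.comp_pos he hez).ne'.isUnit, hs] at h1
    exact h1

end Fields

end CKY

end

/-! ### The theorem -/

theorem mainTheorem3 {M : Type*} [TopologicalSpace M] [ChartedSpace CKY.E4 M]
    [IsManifold (𝓡 4) ∞ M] (hM : CKY.IsOrientedAtlas M)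
    (g : CKY.Tensor2 M) (hg : CKY.IsLorentzMetric g)
    (P : CKY.Tensor2 M) (hP : CKY.IsSymmTensor P) :
    (CKY.IsLocallyTracelessSquareOfCKY g P ↔
      CKY.AlgebraicConditions g P ∧ CKY.DifferentialConditions g P) ∧
    (CKY.AlgebraicConditions g P → CKY.DifferentialConditions g P →
      (∀ x : M, ∃ W : Set M, IsOpen W ∧ x ∈ W ∧
        (∃ ψ : M → ℝ, CKY.IsRainichIndexOn g P W ψ) ∧
        (∃ X : CKY.Tensor2 M, CKY.IsAdmissibleOn g P W X)) ∧
      (∀ W : Set M, IsOpen W → ∀ ψ : M → ℝ, CKY.IsRainichIndexOn g P W ψ →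
        ∀ X : CKY.Tensor2 M, CKY.IsAdmissibleOn g P W X →
          CKY.IsCKYOn g W (CKY.rotatedForm g P X ψ) ∧
          CKY.IsRegularOn g W (CKY.rotatedForm g P X ψ) ∧
          CKY.IsTracelessSquareOn g W P (CKY.rotatedForm g P X ψ))) := by
  have hii : CKY.AlgebraicConditions g P → CKY.DifferentialConditions g P →
      (∀ x : M, ∃ W : Set M, IsOpen W ∧ x ∈ W ∧
        (∃ ψ : M → ℝ, CKY.IsRainichIndexOn g P W ψ) ∧
        (∃ X : CKY.Tensor2 M, CKY.IsAdmissibleOn g P W X)) ∧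
      (∀ W : Set M, IsOpen W → ∀ ψ : M → ℝ, CKY.IsRainichIndexOn g P W ψ →
        ∀ X : CKY.Tensor2 M, CKY.IsAdmissibleOn g P W X →
          CKY.IsCKYOn g W (CKY.rotatedForm g P X ψ) ∧
          CKY.IsRegularOn g W (CKY.rotatedForm g P X ψ) ∧
          CKY.IsTracelessSquareOn g W P (CKY.rotatedForm g P X ψ)) := fun h hd =>
    ⟨CKY.exists_index_and_form hM hg hP h hd, fun _ hW _ hψ _ hX =>
      ⟨CKY.isCKYOn_rotatedForm hM hg hP h hd hW hψ hX, CKY.isRegularOn_rotatedForm hg hP h hX,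
        CKY.isTracelessSquareOn_rotatedForm hg hP h hX⟩⟩
  refine ⟨⟨fun h => ⟨CKY.IsLocallyTracelessSquareOfCKY.algebraicConditions h hg,
    CKY.IsLocallyTracelessSquareOfCKY.differentialConditions h hg hM⟩, ?_⟩, hii⟩
  -- Sufficiency in (i) follows from (ii): the local data ψ and X exist, and the explicit form
  -- solves the problem.
  rintro ⟨h, hd⟩ x
  obtain ⟨hex, hall⟩ := hii h hd
  obtain ⟨W, hW, hx, ⟨ψ, hψ⟩, X, hX⟩ := hex x
  exact ⟨W, hW, hx, _, hall W hW ψ hψ X hX⟩
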